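/- **Setting.** Let $(Z,d)$ be a non-empty bounded metric space with a Borel (regular) measure $\mu$ for which every open ball has positive finite measure, and let $Q>0$ and $C$ be such that $\mu(B(\xi,\lambda r))\le C\lambda^Q\mu(B(\xi,r))$ for all $\xi\in Z$, $r>0$, $\lambda\ge1$. For $n\ge1$ choose a maximal set $\{\xi_x\}_{x\in X_n}\subset Z$ with mutual distances at least $2^{-n-1}$, and put $B(x)=B(\xi_x,2^{-n})$ for $x\in X_n$; let $X_0=\{\mathbf 0\}$, $B(\mathbf 0)=Z$, $X=\bigsqcup_{n\ge0}X_n$, and $|x|=n$ for $x\in X_n$. Write $x\sim y$ if $x\ne y$, $||x|-|y||\le1$ and $B(x)\cap B(y)\ne\emptyset$. For $u\colon X\to\mathbb C$ let $|du|(x)=(\sum_{y\sim x}|u(y)-u(x)|^2)^{1/2}$, and let $J^s_{p,q}(X)$ be the space of all $u$ with $$\|u\|_{J^s_{p,q}(X)}=\Big(\int_Z\big\|(2^{|x|s}|u(x)|)_{x:\,\xi\in B(x)}\big\|_{\ell^q}^p\,d\mu(\xi)\Big)^{1/p}<\infty .$$ Fix non-negative Lipschitz functions $\psi_x$ on $Z$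 ($x\in X$) vanishing off $B(x)$, with Lipschitz constants $\le L2^{|x|}$ ($L$ independent of $x$) and $\sum_{x\in X_n}\psi_x=1$ for all $n\ge0$. The trace of $u$ is $\operatorname{Tr}u=\lim_{n\to\infty}\sum_{x\in X_n}u(x)\psi_x$, when the limit exists in $L^1(Z)$ and $\mu$-almost everywhere. For $f\in L^1_{\rm loc}(Z)$ (integrable on bounded measurable sets) let $Pf(x)=\frac1{\mu(B(x))}\int_{B(x)}f\,d\mu$, and let $\mathcal F$ be the vector space of all such $f$ with $\|f\|_{\dot F^s_{p,q}(Z)}:=\|\,|d(Pf)|\,\|_{J^s_{p,q}(X)}<\infty$. The quasi-normed space $\dot F^s_{p,q}(Z)$ is $\mathcal F$ modulo the functions that are constant $\mu$-almost everywhere. Let $D$ be the space of all $u\colon X\to\mathbb C$ with $|du|\in J^s_{p,q}(X)$ and $u(\mathbf 0)=0$, with quasi-norm $\|\,|du|\,\|_{J^s_{p,q}(X)}$, and let $J_0=\{u\in J^s_{p,q}(X):u(\mathbf 0)=0\}$. Quotients of $D$ carry the infimum of the quasi-norm over the coset. **Theorem 2.6.** Let $0<s<\infty$, $Q/(Q+s)<p<\infty$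 and $Q/(Q+s)<q\le\infty$. (i) $J_0\subset D$; every $u\in D$ has a trace; and $\operatorname{Tr}u=0$ $\mu$-almost everywhere if and only if $u\in J_0$. (ii) The trace induces an isomorphism of quasi-normed spaces from $D/J_0$ onto $\mathcal F$ modulo equality almost everywhere, with the quasi-norm $\big|\frac1{\mu(Z)}\int_Zf\,d\mu\big|+\|f\|_{\dot F^s_{p,q}(Z)}$. Dividing out constants on both sides, the trace induces an isomorphism of quasi-normed spaces $$D/\big(D\cap(J^s_{p,q}(X)+\mathbb C\mathbf 1)\big)\;\approx\;\dot F^s_{p,q}(Z),$$ where $\mathbf 1$ is the constant sequence $1$. In particular $\dot F^s_{p,q}(Z)$ is a quasi-Banach space, and when $1<p,q<\infty$ it is a reflexive Banach space. -/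

import Mathlib

open Set Filter Topology MeasureTheory
open scoped ENNReal NNReal

noncomputable section

namespace TriebelLizorkin

/-! ### Quasi-norms -/

section QuasiNorm

variable {E F : Type*} [AddCommGroup E] [Module ℂ E] [AddCommGroup F] [Module ℂ F]

/-- `N` is a quasi-norm on the complex vector space `E`. -/
structure IsQuasiNorm (N : E → ℝ) : Prop where
  nonneg : ∀ x, 0 ≤ N x
  eq_zero_iff : ∀ x, N x = 0 ↔ x = 0
  smul : ∀ (c : ℂ) (x : E), N (c • x) = ‖c‖ * N x
  add_le : ∃ K : ℝ, ∀ x y, N (x + y) ≤ K * (N x + N y)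

/-- `(E, N)` is a quasi-Banach space: `N` is a quasi-norm, and Cauchy sequences converge. -/
structure IsQuasiBanach (N : E → ℝ) : Prop extends IsQuasiNorm N where
  complete : ∀ v : ℕ → E,
    (∀ ε > 0, ∃ n₀, ∀ m ≥ n₀, ∀ n ≥ n₀, N (v m - v n) < ε) →
      ∃ w : E, Tendsto (fun n => N (v n - w)) atTop (𝓝 0)

/-- `(E, N)` is (that is, it is isometrically isomorphic to) a Banach space whose canonical
embedding into its double dual is onto. -/
def IsReflexiveBanach.{v} {E : Type v} [AddCommGroup E] [Module ℂ E] (N : E → ℝ) : Prop :=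
  ∃ (G : Type v) (_ : NormedAddCommGroup G) (_ : NormedSpace ℂ G) (e : E ≃ₗ[ℂ] G),
    (∀ x, ‖e x‖ = N x) ∧ CompleteSpace G ∧
      Function.Surjective (NormedSpace.inclusionInDoubleDual ℂ G)

/-- The quotient quasi-norm: the infimum of `N` over the coset. -/
def quotientNorm (S : Submodule ℂ E) (N : E → ℝ) (x : E ⧸ S) : ℝ :=
  ⨅ v : {v : E // (Submodule.Quotient.mk v : E ⧸ S) = x}, N v

/-- The linear bijection `e` is an isomorphism of quasi-normed spaces: on both sides we have a
quasi-norm, and `e` and its inverse are bounded. -/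
def IsQuasiNormIso (N₁ : E → ℝ) (N₂ : F → ℝ) (e : E ≃ₗ[ℂ] F) : Prop :=
  IsQuasiNorm N₁ ∧ IsQuasiNorm N₂ ∧ ∃ C : ℝ, ∀ x, N₂ (e x) ≤ C * N₁ x ∧ N₁ x ≤ C * N₂ (e x)

end QuasiNorm

/-! ### The `ℓ^q` quasi-norm of a family -/

/-- The `ℓ^q` quasi-norm of a family of numbers in `[0, ∞]`, for `0 < q ≤ ∞`. -/
def ellq {ι : Type*} (q : ℝ≥0∞) (a : ι → ℝ≥0∞) : ℝ≥0∞ :=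
  if q = ∞ then ⨆ i, a i else (∑' i, a i ^ q.toReal) ^ (1 / q.toReal)

lemma ellq_mono {ι : Type*} (q : ℝ≥0∞) {a b : ι → ℝ≥0∞} (h : ∀ i, a i ≤ b i) :
    ellq q a ≤ ellq q b := by
  unfold ellq
  split_ifs
  · exact iSup_mono h
  · exact ENNReal.rpow_le_rpow
      (ENNReal.tsum_le_tsum fun i => ENNReal.rpow_le_rpow (h i) ENNReal.toReal_nonneg)
      (by positivity)

lemma ellq_const_mul {ι : Type*} {q : ℝ≥0∞} (hq : 0 < q) (c : ℝ≥0∞) (a : ι → ℝ≥0∞) :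
    ellq q (fun i => c * a i) = c * ellq q a := by
  unfold ellq
  split_ifs with h
  · rw [ENNReal.mul_iSup]
  · have hq' : 0 < q.toReal := ENNReal.toReal_pos hq.ne' h
    simp_rw [ENNReal.mul_rpow_of_nonneg _ _ hq'.le]
    rw [ENNReal.tsum_mul_left, ENNReal.mul_rpow_of_nonneg _ _ (by positivity),
      ← ENNReal.rpow_mul, mul_one_div_cancel hq'.ne', ENNReal.rpow_one]

lemma rpow_add_le' {r : ℝ} (hr : 0 < r) (a b : ℝ≥0∞) :
    (a + b) ^ r ≤ 2 ^ r * (a ^ r + b ^ r) := by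
  have h : a + b ≤ 2 * max a b := by
    rw [two_mul]; exact add_le_add (le_max_left _ _) (le_max_right _ _)
  refine (ENNReal.rpow_le_rpow h hr.le).trans ?_
  rw [ENNReal.mul_rpow_of_nonneg _ _ hr.le]
  gcongr
  rcases le_total a b with hab | hab
  · rw [max_eq_right hab]; exact le_add_self
  · rw [max_eq_left hab]; exact le_self_add

lemma ellq_add_le {q : ℝ≥0∞} (hq : 0 < q) :
    ∃ K : ℝ≥0∞, K < ∞ ∧ ∀ {ι : Type*} (a b : ι → ℝ≥0∞),
      ellq q (fun i => a i + b i) ≤ K * (ellq q a + ellq q b) := by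
  by_cases h : q = ∞
  · refine ⟨1, by simp, fun a b => ?_⟩
    simp only [ellq, h, if_true, one_mul]
    exact iSup_le fun i => add_le_add (le_iSup a i) (le_iSup b i)
  · have hq' : 0 < q.toReal := ENNReal.toReal_pos hq.ne' h
    have hq'' : 0 < 1 / q.toReal := by positivity
    refine ⟨2 * 2 ^ (1 / q.toReal), ?_, fun a b => ?_⟩
    · exact ENNReal.mul_lt_top (by simp) (ENNReal.rpow_lt_top_of_nonneg hq''.le (by simp))
    · simp only [ellq, h, if_false]
      calc (∑' i, (a i + b i) ^ q.toReal) ^ (1 / q.toReal)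
          ≤ (2 ^ q.toReal * (∑' i, a i ^ q.toReal + ∑' i, b i ^ q.toReal)) ^ (1 / q.toReal) := by
            refine ENNReal.rpow_le_rpow ?_ hq''.le
            rw [← ENNReal.tsum_add, ← ENNReal.tsum_mul_left]
            exact ENNReal.tsum_le_tsum fun i => rpow_add_le' hq' _ _
        _ = 2 * (∑' i, a i ^ q.toReal + ∑' i, b i ^ q.toReal) ^ (1 / q.toReal) := by
            rw [ENNReal.mul_rpow_of_nonneg _ _ hq''.le, ← ENNReal.rpow_mul,
              mul_one_div_cancel hq'.ne', ENNReal.rpow_one]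
        _ ≤ _ := by
            rw [mul_assoc]
            gcongr
            exact rpow_add_le' hq'' _ _

lemma ellq_subtype {ι : Type*} {q : ℝ≥0∞} (hq : 0 < q) (S : Set ι) (a : ι → ℝ≥0∞) :
    ellq q (fun i : S => a i) = ellq q (S.indicator a) := by
  unfold ellq
  split_ifs with h
  · apply le_antisymm
    · exact iSup_le fun i => le_iSup_of_le i.1 (by rw [indicator_of_mem i.2])
    · refine iSup_le fun i => ?_
      by_cases hi : i ∈ S
      · rw [indicator_of_mem hi]; exact le_iSup (fun i : S => a i) ⟨i, hi⟩
      · rw [indicator_of_notMem hi]; exact zero_le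
  · have hq' : 0 < q.toReal := ENNReal.toReal_pos hq.ne' h
    congr 1
    rw [tsum_subtype S (fun i => a i ^ q.toReal)]
    congr 1
    ext i
    by_cases hi : i ∈ S
    · simp [hi]
    · simp [hi, hq']

/-! ### Hyperbolic fillings -/

variable {Z : Type*} [MetricSpace Z]

/-- The choice behind a hyperbolic filling of `Z`: for each `n ≥ 1` a maximal subset `net n` of `Z`
with mutual distances at least `2^{-n-1}`. (The value `net 0` plays no role.) -/
structure HyperbolicFilling (Z : Type*) [MetricSpace Z] where
  net : ℕ → Set Z
  maximal : ∀ n : ℕ, 1 ≤ n → Maximal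
    (fun A : Set Z => A.Pairwise fun z w => (2 : ℝ) ^ (-((n : ℕ) : ℤ) - 1) ≤ dist z w) (net n)

namespace HyperbolicFilling

/-- The vertex set `X` of the filling: one vertex `root` on level `0`, and for `n ≥ 1` one vertex
for each point of `net n`. -/
inductive Vertex (H : HyperbolicFilling Z) : Type _
  | root : Vertex H
  | node (n : ℕ) (hn : 1 ≤ n) (z : Z) (hz : z ∈ H.net n) : Vertex H

variable {H : HyperbolicFilling Z}

/-- The level `|x|` of a vertex. -/
def level : H.Vertex → ℕ
  | .root => 0
  | .node n _ _ _ => n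

/-- The set `B(x)`: all of `Z` for the root, the ball of radius `2^{-n}` about the point
belonging to `x` when `x` has level `n ≥ 1`. -/
def ball : H.Vertex → Set Z
  | .root => univ
  | .node n _ z _ => Metric.ball z ((2 : ℝ) ^ (-(n : ℤ)))

lemma isOpen_ball (x : H.Vertex) : IsOpen (ball x) := by
  cases x
  · exact isOpen_univ
  · exact Metric.isOpen_ball

/-- The graph on `X`: distinct vertices whose levels differ by at most one and whose balls meet
are joined. -/
def graph (H : HyperbolicFilling Z) : SimpleGraph H.Vertex where
  Adj x y := x ≠ y ∧ level x ≤ level y + 1 ∧ level y ≤ level x + 1 ∧ (ball x ∩ ball y).Nonempty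
  symm := ⟨fun _ _ h => ⟨h.1.symm, h.2.2.1, h.2.1, by rw [inter_comm]; exact h.2.2.2⟩⟩
  loopless := ⟨fun _ h => h.1 rfl⟩

/-- The size `|du|(x) = (∑_{y ∼ x} |u(y) - u(x)|²)^{1/2}` of the discrete derivative. -/
def absD (u : H.Vertex → ℂ) (x : H.Vertex) : ℝ≥0∞ :=
  ellq 2 fun y : {y // H.graph.Adj x y} => ‖u y - u x‖ₑ

lemma absD_smul (c : ℂ) (u : H.Vertex → ℂ) (x : H.Vertex) :
    absD (c • u) x = ‖c‖ₑ * absD u x := by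
  unfold absD
  rw [← ellq_const_mul (by simp)]
  congr 1
  ext y
  rw [Pi.smul_apply, Pi.smul_apply, ← smul_sub, enorm_smul]

/-- The cone `Γ(ξ) = {x : ξ ∈ B(x)}`. -/
def cone (H : HyperbolicFilling Z) (ξ : Z) : Set H.Vertex := {x | ξ ∈ ball x}

variable [MeasurableSpace Z]

/-- The quasi-norm of `J^s_{p,q}(X)`, on families of numbers in `[0, ∞]`:
`(∫_Z ‖(2^{|x|s} g(x))_{x ∈ Γ(ξ)}‖_{ℓ^q}^p dμ(ξ))^{1/p}`. -/
def jNorm (μ : Measure Z) (s p : ℝ) (q : ℝ≥0∞) (g : H.Vertex → ℝ≥0∞) : ℝ≥0∞ :=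
  (∫⁻ ξ, ellq q (fun x : H.cone ξ => ENNReal.ofReal ((2 : ℝ) ^ ((level x.1 : ℝ) * s)) * g x.1) ^ p
    ∂μ) ^ (1 / p)

lemma measurable_ellq_cone [BorelSpace Z] {q : ℝ≥0∞} (hq : 0 < q) (g : H.Vertex → ℝ≥0∞) :
    Measurable fun ξ => ellq q (fun x : H.cone ξ => g x.1) := by
  have hl : ∀ c : H.Vertex → ℝ≥0∞, ∀ x,
      LowerSemicontinuous fun ξ => (H.cone ξ).indicator c x := by
    intro c x
    have : (fun ξ => (H.cone ξ).indicator c x) = (ball x).indicator (fun _ => c x) := by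
      ext ξ
      by_cases h : ξ ∈ ball x
      · rw [indicator_of_mem h, indicator_of_mem (show x ∈ H.cone ξ from h)]
      · rw [indicator_of_notMem h, indicator_of_notMem (show x ∉ H.cone ξ from h)]
    rw [this]
    exact (isOpen_ball x).lowerSemicontinuous_indicator zero_le
  simp_rw [ellq_subtype hq]
  unfold ellq
  split_ifs with h
  · exact (lowerSemicontinuous_iSup fun x => hl g x).measurable
  · have hq' : 0 < q.toReal := ENNReal.toReal_pos hq.ne' h
    have : ∀ ξ x, (H.cone ξ).indicator g x ^ q.toReal
        = (H.cone ξ).indicator (fun x => g x ^ q.toReal) x := by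
      intro ξ x
      by_cases hx : x ∈ H.cone ξ
      · simp [hx]
      · simp [hx, hq']
    simp_rw [this]
    exact (lowerSemicontinuous_tsum fun x => hl _ x).measurable.pow_const _

lemma jNorm_mono (μ : Measure Z) (s : ℝ) {p : ℝ} (hp : 0 < p) (q : ℝ≥0∞)
    {f g : H.Vertex → ℝ≥0∞} (h : ∀ x, f x ≤ g x) : jNorm μ s p q f ≤ jNorm μ s p q g := by
  unfold jNorm
  refine ENNReal.rpow_le_rpow (lintegral_mono fun ξ => ?_) (by positivity)
  exact ENNReal.rpow_le_rpow (ellq_mono q fun x => by gcongr; exact h _) hp.le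

lemma jNorm_const_mul (μ : Measure Z) (s : ℝ) {p : ℝ} (hp : 0 < p) {q : ℝ≥0∞} (hq : 0 < q)
    {c : ℝ≥0∞} (hc : c < ∞) (g : H.Vertex → ℝ≥0∞) :
    jNorm μ s p q (fun x => c * g x) = c * jNorm μ s p q g := by
  unfold jNorm
  simp_rw [mul_left_comm _ c, ellq_const_mul hq, ENNReal.mul_rpow_of_nonneg _ _ hp.le]
  rw [lintegral_const_mul' _ _ (ENNReal.rpow_lt_top_of_nonneg hp.le hc.ne).ne,
    ENNReal.mul_rpow_of_nonneg _ _ (by positivity), ← ENNReal.rpow_mul,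
    mul_one_div_cancel hp.ne', ENNReal.rpow_one]

lemma jNorm_add_lt_top [BorelSpace Z] (μ : Measure Z) (s : ℝ) {p : ℝ} (hp : 0 < p)
    {q : ℝ≥0∞} (hq : 0 < q) {f g : H.Vertex → ℝ≥0∞} (hf : jNorm μ s p q f < ∞)
    (hg : jNorm μ s p q g < ∞) : jNorm μ s p q (fun x => f x + g x) < ∞ := by
  obtain ⟨K, hK, h⟩ := ellq_add_le hq
  have hp' : 0 < 1 / p := by positivity
  unfold jNorm at *
  rw [ENNReal.rpow_lt_top_iff_of_pos hp'] at *
  simp_rw [mul_add]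
  refine lt_of_le_of_lt (lintegral_mono fun ξ => (ENNReal.rpow_le_rpow (h _ _) hp.le).trans
    ((ENNReal.mul_rpow_of_nonneg _ _ hp.le).le.trans
      (mul_le_mul_right (rpow_add_le' hp _ _) _))) ?_
  have hKp := (ENNReal.rpow_lt_top_of_nonneg hp.le hK.ne)
  have h2 : (2 : ℝ≥0∞) ^ p < ∞ := ENNReal.rpow_lt_top_of_nonneg hp.le (by simp)
  rw [lintegral_const_mul' _ _ hKp.ne, lintegral_const_mul' _ _ h2.ne, lintegral_add_left]
  · exact ENNReal.mul_lt_top hKp (ENNReal.mul_lt_top h2 (ENNReal.add_lt_top.2 ⟨hf, hg⟩))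
  · exact (measurable_ellq_cone (H := H) hq
      fun x => ENNReal.ofReal ((2 : ℝ) ^ ((level x : ℝ) * s)) * f x).pow_const _

lemma jNorm_absD_add_lt_top [BorelSpace Z] (μ : Measure Z) (s : ℝ) {p : ℝ} (hp : 0 < p)
    {q : ℝ≥0∞} (hq : 0 < q) {u v : H.Vertex → ℂ} (hu : jNorm μ s p q (absD u) < ∞)
    (hv : jNorm μ s p q (absD v) < ∞) : jNorm μ s p q (absD (u + v)) < ∞ := by
  obtain ⟨K, hK, h⟩ := ellq_add_le (q := 2) (by simp)
  refine lt_of_le_of_lt (jNorm_mono (H := H) μ s hp q (g := fun x => K * (absD u x + absD v x))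
    fun x => ?_) ?_
  · refine (ellq_mono 2 fun y => ?_).trans
      (h (fun y : {y // H.graph.Adj x y} => ‖u y - u x‖ₑ) fun y => ‖v y - v x‖ₑ)
    rw [Pi.add_apply, Pi.add_apply, add_sub_add_comm]
    exact enorm_add_le _ _
  · rw [jNorm_const_mul μ s hp hq hK]
    exact ENNReal.mul_lt_top hK (jNorm_add_lt_top (H := H) μ s hp hq hu hv)

/-- The sequence space `J^s_{p,q}(X)`. -/
def seqSpace (H : HyperbolicFilling Z) [BorelSpace Z] (μ : Measure Z) (s : ℝ) {p : ℝ}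
    (hp : 0 < p) {q : ℝ≥0∞} (hq : 0 < q) : Submodule ℂ (H.Vertex → ℂ) where
  carrier := {u | jNorm μ s p q (fun x => ‖u x‖ₑ) < ∞}
  add_mem' {u v} hu hv := lt_of_le_of_lt
    (jNorm_mono μ s hp q fun x => enorm_add_le (u x) (v x))
    (jNorm_add_lt_top (H := H) μ s hp hq hu hv)
  zero_mem' := by
    have := jNorm_const_mul (H := H) μ s hp hq (c := 0) (by simp) 0
    simp only [zero_mul] at this
    simp [this]
  smul_mem' c u hu := by
    simp only [mem_ofPred_eq, Pi.smul_apply, enorm_smul] at *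
    rw [jNorm_const_mul μ s hp hq (by simp)]
    exact ENNReal.mul_lt_top (by simp) hu

/-- The sequences in `J^s_{p,q}(X)` that vanish at the root. -/
def seqSpaceZero (H : HyperbolicFilling Z) [BorelSpace Z] (μ : Measure Z) (s : ℝ) {p : ℝ}
    (hp : 0 < p) {q : ℝ≥0∞} (hq : 0 < q) : Submodule ℂ (H.Vertex → ℂ) :=
  H.seqSpace μ s hp hq ⊓ LinearMap.ker (LinearMap.proj Vertex.root)

/-- The sequences which differ from an element of `J^s_{p,q}(X)` by a constant sequence. -/
def seqSpaceConst (H : HyperbolicFilling Z) [BorelSpace Z] (μ : Measure Z) (s : ℝ) {p : ℝ}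
    (hp : 0 < p) {q : ℝ≥0∞} (hq : 0 < q) : Submodule ℂ (H.Vertex → ℂ) :=
  H.seqSpace μ s hp hq ⊔ Submodule.span ℂ {fun _ => (1 : ℂ)}

/-- The difference space: the sequences `u` with `|du| ∈ J^s_{p,q}(X)` and `u(root) = 0`. -/
def diffSpace (H : HyperbolicFilling Z) [BorelSpace Z] (μ : Measure Z) (s : ℝ) {p : ℝ}
    (hp : 0 < p) {q : ℝ≥0∞} (hq : 0 < q) : Submodule ℂ (H.Vertex → ℂ) where
  carrier := {u | jNorm μ s p q (absD u) < ∞ ∧ u Vertex.root = 0}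
  add_mem' {u v} hu hv :=
    ⟨jNorm_absD_add_lt_top μ s hp hq hu.1 hv.1, by simp [hu.2, hv.2]⟩
  zero_mem' := by
    refine ⟨?_, rfl⟩
    have h : absD (0 : H.Vertex → ℂ) = fun x => 0 * absD 0 x := by
      ext x; simpa using absD_smul 0 (0 : H.Vertex → ℂ) x
    rw [h, jNorm_const_mul μ s hp hq (by simp)]
    simp
  smul_mem' c u hu := by
    refine ⟨?_, by simp [hu.2]⟩
    have h : absD (c • u) = fun x => ‖c‖ₑ * absD u x := funext (absD_smul c u)
    rw [h, jNorm_const_mul μ s hp hq (by simp)]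
    exact ENNReal.mul_lt_top (by simp) hu.1

/-- The quasi-norm `‖du‖_{J^s_{p,q}(X)}` of the difference space. -/
def diffNorm (H : HyperbolicFilling Z) [BorelSpace Z] (μ : Measure Z) (s : ℝ) {p : ℝ}
    (hp : 0 < p) {q : ℝ≥0∞} (hq : 0 < q) (u : H.diffSpace μ s hp hq) : ℝ :=
  (jNorm μ s p q (absD u.1)).toReal

/-! ### Traces -/

/-- A family `(ψ_x)` of non-negative Lipschitz functions on `Z` with constants `≲ 2^{|x|}`, such
that `ψ_x` vanishes off `B(x)` and each level forms a partition of unity. -/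
structure LipschitzPartition (H : HyperbolicFilling Z) where
  ψ : H.Vertex → Z → ℝ
  nonneg : ∀ x ξ, 0 ≤ ψ x ξ
  supp : ∀ x ξ, ξ ∉ ball x → ψ x ξ = 0
  sum_eq_one : ∀ (n : ℕ) (ξ : Z), ∑' x : {x : H.Vertex // level x = n}, ψ x ξ = 1
  lip : ∃ L : ℝ≥0, ∀ x, LipschitzWith (L * 2 ^ level x) (ψ x)

/-- `T_n u = ∑_{x ∈ X_n} u(x) ψ_x`. -/
def traceApprox (Ψ : LipschitzPartition H) (u : H.Vertex → ℂ) (n : ℕ) (ξ : Z) : ℂ :=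
  ∑' x : {x : H.Vertex // level x = n}, u x * (Ψ.ψ x ξ : ℂ)

/-- `f` is the trace of `u`: `T_n u → f` in `L¹(Z)` and pointwise almost everywhere. -/
structure HasTrace (μ : Measure Z) (Ψ : LipschitzPartition H) (u : H.Vertex → ℂ) (f : Z → ℂ) :
    Prop where
  integrable : Integrable f μ
  tendsto_L1 : Tendsto (fun n => eLpNorm (traceApprox Ψ u n - f) 1 μ) atTop (𝓝 0)
  tendsto_ae : ∀ᵐ ξ ∂μ, Tendsto (fun n => traceApprox Ψ u n ξ) atTop (𝓝 (f ξ))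

/-! ### The Triebel–Lizorkin space -/

/-- The Poisson extension `Pf(x) = ⨍_{B(x)} f dμ`. -/
def poisson (H : HyperbolicFilling Z) (μ : Measure Z) (f : Z → ℂ) (x : H.Vertex) : ℂ :=
  ⨍ ξ in ball x, f ξ ∂μ

/-- `f ∈ L¹_loc(Z)`: integrability on bounded measurable sets. -/
def LocInt (μ : Measure Z) (f : Z → ℂ) : Prop :=
  ∀ A : Set Z, Bornology.IsBounded A → MeasurableSet A → IntegrableOn f A μ

lemma LocInt.integrableOn [BorelSpace Z] [BoundedSpace Z] {μ : Measure Z} {f : Z → ℂ}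
    (hf : LocInt μ f) (x : H.Vertex) : IntegrableOn f (ball x) μ :=
  hf _ (Bornology.IsBounded.all _) (isOpen_ball x).measurableSet

lemma poisson_add [BorelSpace Z] [BoundedSpace Z] {μ : Measure Z} {f g : Z → ℂ}
    (hf : LocInt μ f) (hg : LocInt μ g) :
    H.poisson μ (f + g) = H.poisson μ f + H.poisson μ g := by
  ext x
  simp only [poisson, Pi.add_apply, setAverage_eq]
  rw [integral_add (hf.integrableOn x) (hg.integrableOn x), smul_add]

lemma poisson_smul (μ : Measure Z) (c : ℂ) (f : Z → ℂ) :
    H.poisson μ (c • f) = c • H.poisson μ f := by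
  ext x
  simp only [poisson, Pi.smul_apply, setAverage_eq]
  rw [integral_smul, smul_comm]

/-- The vector space of all `f ∈ L¹_loc(Z)` with `‖d(Pf)‖_{J^s_{p,q}(X)} < ∞`. -/
def funSpace (H : HyperbolicFilling Z) [BorelSpace Z] [BoundedSpace Z] (μ : Measure Z) (s : ℝ)
    {p : ℝ} (hp : 0 < p) {q : ℝ≥0∞} (hq : 0 < q) : Submodule ℂ (Z → ℂ) where
  carrier := {f | LocInt μ f ∧ jNorm μ s p q (absD (H.poisson μ f)) < ∞}
  add_mem' {f g} hf hg := by
    refine ⟨fun A hA hA' => (hf.1 A hA hA').add (hg.1 A hA hA'), ?_⟩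
    rw [poisson_add hf.1 hg.1]
    exact jNorm_absD_add_lt_top μ s hp hq hf.2 hg.2
  zero_mem' := by
    refine ⟨fun A _ _ => integrableOn_zero, ?_⟩
    have h : H.poisson μ 0 = 0 := by ext x; simp [poisson]
    rw [h]
    exact (H.diffSpace μ s hp hq).zero_mem.1
  smul_mem' c f hf := by
    refine ⟨fun A hA hA' => (hf.1 A hA hA').smul c, ?_⟩
    have h : absD (c • H.poisson μ f) = fun x => ‖c‖ₑ * absD (H.poisson μ f) x :=
      funext (absD_smul c _)
    rw [poisson_smul, h, jNorm_const_mul μ s hp hq (by simp)]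
    exact ENNReal.mul_lt_top (by simp) hf.2

/-- `‖f‖_{Ḟ^s_{p,q}(Z)} = ‖d(Pf)‖_{J^s_{p,q}(X)}`. -/
def funNorm (H : HyperbolicFilling Z) [BorelSpace Z] [BoundedSpace Z] (μ : Measure Z) (s : ℝ)
    {p : ℝ} (hp : 0 < p) {q : ℝ≥0∞} (hq : 0 < q) (f : H.funSpace μ s hp hq) : ℝ :=
  (jNorm μ s p q (absD (H.poisson μ f.1))).toReal

/-- `‖f‖_{Ḟ^s_{p,q}(Z)}` plus the absolute value of the mean of `f` over `Z`. -/
def funNormMean (H : HyperbolicFilling Z) [BorelSpace Z] [BoundedSpace Z] (μ : Measure Z) (s : ℝ)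
    {p : ℝ} (hp : 0 < p) {q : ℝ≥0∞} (hq : 0 < q) (f : H.funSpace μ s hp hq) : ℝ :=
  ‖⨍ ξ, f.1 ξ ∂μ‖ + H.funNorm μ s hp hq f

/-- The functions in `Ḟ^s_{p,q}(Z)` that are constant almost everywhere. -/
def aeConst (H : HyperbolicFilling Z) [BorelSpace Z] [BoundedSpace Z] (μ : Measure Z) (s : ℝ)
    {p : ℝ} (hp : 0 < p) {q : ℝ≥0∞} (hq : 0 < q) : Submodule ℂ (H.funSpace μ s hp hq) where
  carrier := {f | ∃ c : ℂ, f.1 =ᵐ[μ] fun _ => c}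
  add_mem' := by
    rintro f g ⟨c, hc⟩ ⟨d, hd⟩
    exact ⟨c + d, hc.add hd⟩
  zero_mem' := ⟨0, EventuallyEq.rfl⟩
  smul_mem' := by
    rintro a f ⟨c, hc⟩
    exact ⟨a • c, hc.const_smul a⟩

/-- The functions in `Ḟ^s_{p,q}(Z)` that are zero almost everywhere. -/
def aeZero (H : HyperbolicFilling Z) [BorelSpace Z] [BoundedSpace Z] (μ : Measure Z) (s : ℝ)
    {p : ℝ} (hp : 0 < p) {q : ℝ≥0∞} (hq : 0 < q) : Submodule ℂ (H.funSpace μ s hp hq) where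
  carrier := {f | f.1 =ᵐ[μ] 0}
  add_mem' {f g} hf hg := by
    have hf' : f.1 =ᵐ[μ] 0 := hf
    have hg' : g.1 =ᵐ[μ] 0 := hg
    have h : f.1 + g.1 =ᵐ[μ] 0 := by simpa using hf'.add hg'
    exact h
  zero_mem' := by
    have h : (0 : Z → ℂ) =ᵐ[μ] 0 := EventuallyEq.rfl
    exact h
  smul_mem' a f hf := by
    have hf' : f.1 =ᵐ[μ] 0 := hf
    have h : a • f.1 =ᵐ[μ] 0 := by simpa using hf'.const_smul a
    exact h

/-- The quasi-normed space `Ḟ^s_{p,q}(Z)`: functions that are constant almost everywhere are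
divided out. -/
abbrev TL (H : HyperbolicFilling Z) [BorelSpace Z] [BoundedSpace Z] (μ : Measure Z) (s : ℝ)
    {p : ℝ} (hp : 0 < p) {q : ℝ≥0∞} (hq : 0 < q) : Type _ :=
  H.funSpace μ s hp hq ⧸ H.aeConst μ s hp hq

lemma absD_poisson_congr {μ : Measure Z}
    (hμ : ∀ x : H.Vertex, μ (ball x) ≠ 0 ∧ μ (ball x) ≠ ∞) {f g : Z → ℂ} {c : ℂ}
    (hg : ∀ x : H.Vertex, IntegrableOn g (ball x) μ) (h : f - g =ᵐ[μ] fun _ => c) :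
    absD (H.poisson μ f) = absD (H.poisson μ g) := by
  have key : ∀ x, H.poisson μ f x = H.poisson μ g x + c := by
    intro x
    have h1 : f =ᵐ[μ.restrict (ball x)] fun ξ => g ξ + c := by
      filter_upwards [ae_restrict_of_ae h] with ξ hξ
      rw [← hξ, Pi.sub_apply, add_sub_cancel]
    have hfin : IsFiniteMeasure (μ.restrict (ball x)) :=
      ⟨by simpa using (hμ x).2.lt_top⟩
    simp only [poisson, setAverage_eq]
    rw [integral_congr_ae h1, integral_add (hg x) (integrable_const c), smul_add]
    congr 1
    rw [integral_const, smul_smul, measureReal_restrict_apply_univ,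
      inv_mul_cancel₀ (by simp [measureReal_def, ENNReal.toReal_eq_zero_iff, hμ x]), one_smul]
  ext x
  simp [absD, key]

/-- The quasi-norm of `Ḟ^s_{p,q}(Z)` is constant on the classes modulo constants, so that the
quotient quasi-norm is simply its value at any representative. -/
lemma quotientNorm_mk [BorelSpace Z] [BoundedSpace Z] {μ : Measure Z}
    (hμ : ∀ x : H.Vertex, μ (ball x) ≠ 0 ∧ μ (ball x) ≠ ∞) (s : ℝ)
    {p : ℝ} (hp : 0 < p) {q : ℝ≥0∞} (hq : 0 < q) (f : H.funSpace μ s hp hq) :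
    quotientNorm (H.aeConst μ s hp hq) (H.funNorm μ s hp hq) (Submodule.Quotient.mk f)
      = H.funNorm μ s hp hq f := by
  have key : ∀ v : {v // (Submodule.Quotient.mk v : H.TL μ s hp hq) = Submodule.Quotient.mk f},
      H.funNorm μ s hp hq v = H.funNorm μ s hp hq f := by
    rintro ⟨v, hv⟩
    obtain ⟨c, hc⟩ := (Submodule.Quotient.eq _).1 hv
    unfold funNorm
    rw [absD_poisson_congr hμ (fun x => f.2.1.integrableOn x) hc]
  have : Nonempty {v // (Submodule.Quotient.mk v : H.TL μ s hp hq) = Submodule.Quotient.mk f} :=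
    ⟨⟨f, rfl⟩⟩
  unfold quotientNorm
  simp only [key]
  exact ciInf_const

end HyperbolicFilling

end TriebelLizorkin

end

open TriebelLizorkin TriebelLizorkin.HyperbolicFilling

/-! Everything rests on one positive operator. `upSum` sends g to the sum of μ(B(y))/μ(B(x)) g(y)
over the vertices y with |y| ≥ |x| - 1 whose ball meets B(x), and `jNorm_upSum_le` bounds it on
J^s_{p,q}. Choose r < min(p, q, 1) with r > Q/(Q+s). After raising to the power r, volume growth
replaces (μ(B(y))/μ(B(x)))^r by the ratio itself at the price 2^{(|y|-|x|)Q(1-r)}, while the weights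
gain 2^{-(|y|-|x|)sr}. The net factor decays geometrically, because (Q+s)r - Q > 0. What is left are
averages over dilated balls of sums over single levels. Since p/r and q/r exceed 1, these are
controlled by a vector-valued maximal inequality (`IsAveragingFamily.vector_valued`), and for q = ∞
by the scalar one. The averaging operators are positive and self-adjoint, so the vector-valued
inequality follows from the scalar one by duality and Jensen's inequality.

Trace. If ξ ∈ B(x) and |x| = n, then T_n u(ξ) and T_{n+1} u(ξ) are convex combinations of values of
u at x and its neighbours, hence both within |du|(x) of u(x). The telescoping series is thus
dominated by the level sums of |du|, and the mean over B(x) of those from level |x| on is at most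
`upSum` of |du| at x. At the root this gives an integrable majorant, even when p < 1, so the trace
exists in L¹ and almost everywhere. At a general x it gives |P(Tr u) - u| ≤ 3 `upSum` |du|, so P(Tr
u) - u lies in J^s_{p,q} with norm bounded by that of |du| (`jNorm_poisson_trace_sub_le`).

Consequences. If Tr u = 0, this estimate says that u itself is in J^s_{p,q}. Conversely, for u in
J^s_{p,q} the level sums of |u| form a series converging almost everywhere, so T_n u → 0. Since |dv|
is bounded by a multiple of `upSum` |v|, differences are bounded on J^s_{p,q}; hence J_0 ⊂ D, and
writing P(Tr u) = u + (P(Tr u) - u) shows that the trace is bounded. It is onto because Tr(Pf) = f,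
which holds for continuous f by uniform approximation at each point and in general by density in L¹
(`hasTrace_poisson`).

Completeness comes from Fatou's lemma in D and is carried over by the trace. For 1 < p, q < ∞ the
norm is uniformly convex: the inner ℓ² norm satisfies the parallelogram law, and a reformulation of
uniform convexity in powers passes through the ℓ^q sum and the L^p integral. The Milman–Pettis
theorem then gives reflexivity. -/

namespace TriebelLizorkin

/-! ### From a weak estimate on superlevel sets to a strong estimate -/

section Maximal

/-- Absorption: `X ≤ K Y^{1/t} X^{1-1/t}` with `X < ∞` gives `X ≤ K^t Y`. -/
lemma le_of_le_mul_rpow {t : ℝ} (ht : 1 < t) {X Y K : ℝ≥0∞} (hX : X ≠ ∞)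
    (h : X ≤ K * Y ^ (1 / t) * X ^ (1 - 1 / t)) : X ≤ K ^ t * Y := by
  have ht0 : 0 < t := by linarith
  rcases eq_or_ne X 0 with h0 | h0
  · simp [h0]
  have h1 : X ^ (1 / t) ≤ K * Y ^ (1 / t) := by
    have hx : X ^ (1 - 1 / t) ≠ 0 := by simp [ENNReal.rpow_eq_zero_iff, h0, hX]
    have hx' : X ^ (1 - 1 / t) ≠ ∞ := ENNReal.rpow_ne_top_of_ne_zero h0 hX
    refine (ENNReal.mul_le_mul_iff_left hx hx').1 ?_
    rw [← ENNReal.rpow_add _ _ h0 hX]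
    simpa using h
  have h2 := ENNReal.rpow_le_rpow h1 ht0.le
  rwa [ENNReal.mul_rpow_of_nonneg _ _ ht0.le, ← ENNReal.rpow_mul, ← ENNReal.rpow_mul,
    one_div_mul_cancel ht0.ne', ENNReal.rpow_one, ENNReal.rpow_one] at h2

lemma lintegral_mul_rpow_le {α : Type*} [MeasurableSpace α] {μ : Measure α} {t : ℝ} (ht : 1 < t)
    {f g : α → ℝ≥0∞} (hf : AEMeasurable f μ) (hg : AEMeasurable g μ) :
    ∫⁻ x, f x * g x ^ (t - 1) ∂μ
      ≤ (∫⁻ x, f x ^ t ∂μ) ^ (1 / t) * (∫⁻ x, g x ^ t ∂μ) ^ (1 - 1 / t) := by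
  have ht0 : 0 < t := by linarith
  have hc : t.HolderConjugate (t / (t - 1)) := by
    rw [Real.holderConjugate_iff]; refine ⟨ht, ?_⟩
    have : t - 1 ≠ 0 := by linarith
    field_simp
    ring
  refine (ENNReal.lintegral_mul_le_Lp_mul_Lq μ hc hf (hg.pow_const _)).trans (le_of_eq ?_)
  have : t - 1 ≠ 0 := by linarith
  congr 2
  · congr 1
    ext x
    rw [← ENNReal.rpow_mul]
    congr 1
    field_simp
  · field_simp

/-- Doob's argument: the layer cake formula for μ with exponent t and for φμ with exponent t - 1
turns the weak estimate into ∫ F^t ≤ C t/(t-1) ∫ φ F^{t-1}. Hölder's inequality and absorption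
finish the proof; absorption is why ∫ F^t must be known to be finite. -/
lemma lintegral_rpow_le_of_weak {α : Type*} [MeasurableSpace α] {μ : Measure α} {t : ℝ}
    (ht : 1 < t) {F φ : α → ℝ≥0∞} (hF : Measurable F) (hφ : Measurable φ)
    (hFtop : ∀ x, F x ≠ ∞) (hfin : ∫⁻ x, F x ^ t ∂μ ≠ ∞) {C : ℝ≥0∞} (hC : C ≠ ∞)
    (h : ∀ l : ℝ, 0 < l → ENNReal.ofReal l * μ {x | ENNReal.ofReal l < F x}
      ≤ C * ∫⁻ x in {x | ENNReal.ofReal l < F x}, φ x ∂μ) :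
    ∫⁻ x, F x ^ t ∂μ ≤ (ENNReal.ofReal (t / (t - 1)) * C) ^ t * ∫⁻ x, φ x ^ t ∂μ := by
  have ht0 : 0 < t := by linarith
  have ht1 : 0 < t - 1 := by linarith
  refine le_of_le_mul_rpow ht hfin ?_
  have hset : ∀ l : ℝ, 0 < l → {x | l < (F x).toReal} = {x | ENNReal.ofReal l < F x} := by
    intro l hl
    ext x
    simp only [mem_ofPred_eq]
    rw [ENNReal.ofReal_lt_iff_lt_toReal hl.le (hFtop x)]
  have hcake : ∀ (ν : Measure α) (r : ℝ), 0 < r → ∫⁻ x, F x ^ r ∂ν = ENNReal.ofReal r *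
      ∫⁻ l in Ioi (0 : ℝ), ν {x | ENNReal.ofReal l < F x} * ENNReal.ofReal (l ^ (r - 1)) := by
    intro ν r hr
    have := lintegral_rpow_eq_lintegral_meas_lt_mul ν (f := fun x => (F x).toReal)
      (Eventually.of_forall fun x => ENNReal.toReal_nonneg) hF.ennreal_toReal.aemeasurable hr
    rw [show (∫⁻ x, F x ^ r ∂ν) = ∫⁻ x, ENNReal.ofReal ((F x).toReal ^ r) ∂ν from ?_, this]
    · congr 1
      refine setLIntegral_congr_fun measurableSet_Ioi fun l hl => ?_
      simp only [hset l hl]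
    · refine lintegral_congr fun x => ?_
      rw [← ENNReal.ofReal_rpow_of_nonneg ENNReal.toReal_nonneg hr.le,
        ENNReal.ofReal_toReal (hFtop x)]
  have key : ∫⁻ x, F x ^ t ∂μ ≤ ENNReal.ofReal (t / (t - 1)) * C * ∫⁻ x, φ x * F x ^ (t - 1) ∂μ := by
    have h1 : ∫⁻ x, φ x * F x ^ (t - 1) ∂μ = ∫⁻ x, F x ^ (t - 1) ∂(μ.withDensity φ) := by
      rw [lintegral_withDensity_eq_lintegral_mul _ hφ (hF.pow_const _)]
      rfl
    rw [h1, hcake μ t ht0, hcake _ (t - 1) ht1]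
    have h2 : ∫⁻ l in Ioi (0 : ℝ), μ {x | ENNReal.ofReal l < F x} * ENNReal.ofReal (l ^ (t - 1))
        ≤ ∫⁻ l in Ioi (0 : ℝ), C * ((μ.withDensity φ) {x | ENNReal.ofReal l < F x}
          * ENNReal.ofReal (l ^ (t - 1 - 1))) := by
      refine setLIntegral_mono_ae' measurableSet_Ioi (Eventually.of_forall fun l hl => ?_)
      have hl' : 0 < l := hl
      rw [withDensity_apply _ (measurableSet_lt measurable_const hF)]
      have : l ^ (t - 1) = l * l ^ (t - 1 - 1) := by
        rw [Real.rpow_sub_one hl'.ne' (t - 1)]; field_simp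
      rw [this, ENNReal.ofReal_mul hl'.le, ← mul_assoc, mul_comm (μ _), ← mul_assoc]
      exact mul_le_mul_left (h l hl') _
    rw [lintegral_const_mul' _ _ hC] at h2
    calc _ ≤ ENNReal.ofReal t * (C * _) := by gcongr
      _ = _ := by
        have : ENNReal.ofReal t = ENNReal.ofReal (t / (t - 1)) * ENNReal.ofReal (t - 1) := by
          rw [← ENNReal.ofReal_mul (by positivity)]; congr 1; field_simp
        rw [this]; ring
  refine key.trans ?_
  rw [mul_assoc (_ * C)]
  refine mul_le_mul_right ?_ _
  exact lintegral_mul_rpow_le ht hφ.aemeasurable hF.aemeasurable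

/-- The maximal function over a family of sets. -/
noncomputable def maxFun {ι α : Type*} [MeasurableSpace α] (μ : Measure α) (E : ι → Set α)
    (φ : α → ℝ≥0∞) (ξ : α) : ℝ≥0∞ :=
  ⨆ x, (E x).indicator (fun _ => (μ (E x))⁻¹ * ∫⁻ η in E x, φ η ∂μ) ξ

variable {ι α : Type*} [MeasurableSpace α] {μ : Measure α} {E : ι → Set α}

lemma measurable_maxFun [Countable ι] (hE : ∀ x, MeasurableSet (E x)) (φ : α → ℝ≥0∞) :
    Measurable (maxFun μ E φ) :=
  Measurable.iSup fun x => measurable_const.indicator (hE x)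

/-- The maximal inequality, for a countable family of sets with the property of the Vitali
covering theorem. -/
lemma lintegral_maxFun_rpow_le [Countable ι] [IsFiniteMeasure μ] (hE : ∀ x, MeasurableSet (E x))
    (hpos : ∀ x, μ (E x) ≠ 0) {C : ℝ≥0} {E' : ι → Set α} (hE' : ∀ x, μ (E' x) ≤ C * μ (E x))
    (hvitali : ∀ J : Set ι, J.Finite → ∃ u ⊆ J, u.PairwiseDisjoint E ∧
      ∀ a ∈ J, ∃ b ∈ u, E a ⊆ E' b) {t : ℝ} (ht : 1 < t) :
    ∃ A : ℝ≥0, ∀ φ : α → ℝ≥0∞, Measurable φ →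
      ∫⁻ ξ, maxFun μ E φ ξ ^ t ∂μ ≤ A * ∫⁻ ξ, φ ξ ^ t ∂μ := by
  have ht0 : 0 < t := by linarith
  have hA : (ENNReal.ofReal (t / (t - 1)) * (C : ℝ≥0∞)) ^ t ≠ ∞ :=
    ENNReal.rpow_ne_top_of_nonneg ht0.le (ENNReal.mul_ne_top (by simp) (by simp))
  refine ⟨((ENNReal.ofReal (t / (t - 1)) * (C : ℝ≥0∞)) ^ t).toNNReal, fun φ hφ => ?_⟩
  rw [ENNReal.coe_toNNReal hA]
  rcases eq_or_ne (∫⁻ ξ, φ ξ ^ t ∂μ) ∞ with htop | htop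
  · rw [htop]
    -- The right side is infinite unless the constant vanishes. In that case C = 0, every E x would
    -- be null, and so the family is empty.
    rcases eq_or_ne ((ENNReal.ofReal (t / (t - 1)) * (C : ℝ≥0∞)) ^ t) 0 with h0 | h0
    · have hC0 : C = 0 := by
        rw [ENNReal.rpow_eq_zero_iff_of_pos ht0] at h0
        rcases mul_eq_zero.1 h0 with h | h
        · rw [ENNReal.ofReal_eq_zero] at h
          have : 0 < t / (t - 1) := div_pos ht0 (by linarith)
          linarith
        · simpa using h
      have hempty : IsEmpty ι := by
        refine ⟨fun x => hpos x ?_⟩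
        obtain ⟨u, hu, -, h⟩ := hvitali {x} (finite_singleton x)
        obtain ⟨b, hb, hb'⟩ := h x rfl
        have := (measure_mono (μ := μ) hb').trans (hE' b)
        simpa [hC0] using this
      simp [maxFun, ht0]
    · rw [ENNReal.mul_top h0]; exact le_top
  have hφ1 : ∫⁻ ξ, φ ξ ∂μ ≠ ∞ := by
    have h := ENNReal.lintegral_mul_le_Lp_mul_Lq μ (Real.HolderConjugate.conjExponent ht)
      hφ.aemeasurable (g := fun _ => 1) measurable_const.aemeasurable
    simp only [Pi.mul_apply, mul_one, ENNReal.one_rpow, lintegral_one] at h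
    refine ne_top_of_le_ne_top (ENNReal.mul_ne_top ?_ ?_) h
    · exact ENNReal.rpow_ne_top_of_nonneg (by positivity) htop
    · exact ENNReal.rpow_ne_top_of_nonneg
        (by have := (Real.HolderConjugate.conjExponent ht).symm.pos; positivity) (by simp)
  -- Finite subfamilies have bounded maximal functions, so the a priori finiteness holds on a finite
  -- measure space; monotone convergence removes the restriction at the end.
  let MJ : Finset ι → α → ℝ≥0∞ := fun J ξ =>
    ⨆ x ∈ J, (E x).indicator (fun _ => (μ (E x))⁻¹ * ∫⁻ η in E x, φ η ∂μ) ξ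
  have hMJ : ∀ J, Measurable (MJ J) := fun J =>
    Measurable.biSup _ J.countable_toSet fun x _ => measurable_const.indicator (hE x)
  have hbound : ∀ x ξ, (E x).indicator (fun _ => (μ (E x))⁻¹ * ∫⁻ η in E x, φ η ∂μ) ξ
      ≤ (μ (E x))⁻¹ * ∫⁻ η, φ η ∂μ := by
    intro x ξ
    refine (indicator_le_self _ _ _).trans ?_
    exact mul_le_mul_right (setLIntegral_le_lintegral _ _) _
  have hbdd : ∀ J : Finset ι, ∃ B : ℝ≥0∞, B ≠ ∞ ∧ ∀ ξ, MJ J ξ ≤ B := by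
    intro J
    refine ⟨∑ x ∈ J, (μ (E x))⁻¹ * ∫⁻ η, φ η ∂μ, ?_, fun ξ => iSup₂_le fun x hx => ?_⟩
    · exact ENNReal.sum_ne_top.2 fun x _ =>
        ENNReal.mul_ne_top (ENNReal.inv_ne_top.2 (hpos x)) hφ1
    · exact (hbound x ξ).trans (Finset.single_le_sum
        (f := fun x => (μ (E x))⁻¹ * ∫⁻ η, φ η ∂μ) (fun _ _ => zero_le) hx)
  have hJ : ∀ J : Finset ι, ∫⁻ ξ, MJ J ξ ^ t ∂μ
      ≤ (ENNReal.ofReal (t / (t - 1)) * (C : ℝ≥0∞)) ^ t * ∫⁻ ξ, φ ξ ^ t ∂μ := by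
    intro J
    obtain ⟨B, hB, hJB⟩ := hbdd J
    refine lintegral_rpow_le_of_weak ht (hMJ J) hφ (fun x => ne_top_of_le_ne_top hB (hJB x)) ?_
      (by simp) fun l hl => ?_
    · refine ne_top_of_le_ne_top ?_ (lintegral_mono fun ξ => ENNReal.rpow_le_rpow (hJB ξ) ht0.le)
      rw [lintegral_const]
      exact ENNReal.mul_ne_top (ENNReal.rpow_ne_top_of_nonneg ht0.le hB) (by simp)
    · set L := ENNReal.ofReal l
      have hmem : ∀ ξ, L < MJ J ξ ↔ ∃ x ∈ J, ξ ∈ E x ∧ L < (μ (E x))⁻¹ * ∫⁻ η in E x, φ η ∂μ := by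
        intro ξ
        simp only [MJ, lt_iSup_iff]
        refine exists_congr fun x => ⟨fun ⟨hx, h⟩ => ?_, fun ⟨hx, h1, h2⟩ => ⟨hx, ?_⟩⟩
        · by_cases hξ : ξ ∈ E x
          · rw [indicator_of_mem hξ] at h; exact ⟨hx, hξ, h⟩
          · rw [indicator_of_notMem hξ] at h; simp at h
        · rwa [indicator_of_mem h1]
      -- Vitali selection among the sets whose average exceeds L: their union is the superlevel set,
      -- the enlargements of the selected ones cover it, and the selected ones are disjoint subsets
      -- of it.
      obtain ⟨u, huJ, hud, hu⟩ := hvitali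
        {x | x ∈ J ∧ L < (μ (E x))⁻¹ * ∫⁻ η in E x, φ η ∂μ}
        (J.finite_toSet.subset fun x hx => hx.1)
      have hucount : u.Countable := to_countable u
      calc L * μ {ξ | L < MJ J ξ} ≤ L * μ (⋃ b ∈ u, E' b) := by
            gcongr
            intro ξ hξ
            obtain ⟨x, hx, hξx, hL⟩ := (hmem ξ).1 hξ
            obtain ⟨b, hb, hab⟩ := hu x ⟨hx, hL⟩
            exact mem_biUnion hb (hab hξx)
        _ ≤ L * ∑' b : u, μ (E' b) := by gcongr; exact measure_biUnion_le _ hucount _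
        _ ≤ L * ∑' b : u, C * μ (E b) := by
            gcongr with b
            exact hE' b
        _ = C * ∑' b : u, L * μ (E b) := by
            rw [ENNReal.tsum_mul_left, ENNReal.tsum_mul_left]; ring
        _ ≤ C * ∑' b : u, ∫⁻ η in E b, φ η ∂μ := by
            gcongr with b
            have h := (huJ b.2).2
            calc L * μ (E b) ≤ ((μ (E b))⁻¹ * ∫⁻ η in E b, φ η ∂μ) * μ (E b) := by gcongr
              _ = ((μ (E b))⁻¹ * μ (E b)) * ∫⁻ η in E b, φ η ∂μ := by ring
              _ = _ := by rw [ENNReal.inv_mul_cancel (hpos _) (by simp), one_mul]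
        _ = C * ∫⁻ η in ⋃ b ∈ u, E b, φ η ∂μ := by
            rw [lintegral_biUnion hucount (fun b _ => hE b) hud]
        _ ≤ C * ∫⁻ η in {ξ | L < MJ J ξ}, φ η ∂μ := by
            gcongr
            refine iUnion₂_subset fun b hb ξ hξ => (hmem ξ).2 ⟨b, (huJ hb).1, hξ, (huJ hb).2⟩
  have hsup : ∀ ξ, maxFun μ E φ ξ ^ t = ⨆ J : Finset ι, MJ J ξ ^ t := by
    intro ξ
    rw [← ENNReal.orderIsoRpow_apply t ht0, maxFun, iSup_eq_iSup_finset, OrderIso.map_iSup]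
    rfl
  simp_rw [hsup]
  rw [lintegral_iSup_directed (fun J => ((hMJ J).pow_const t).aemeasurable)]
  · exact iSup_le hJ
  · refine Monotone.directed_le fun J J' h ξ => ENNReal.rpow_le_rpow ?_ ht0.le
    exact biSup_mono fun x hx => h hx

end Maximal

end TriebelLizorkin

namespace TriebelLizorkin

/-! ### Geometry of the filling -/

/-- Balls have positive finite measure, with polynomial volume growth of exponent `Q`. -/
structure IsDoublingOfDim {Z : Type*} [MetricSpace Z] [MeasurableSpace Z] (μ : Measure Z) (Q : ℝ)
    (C : ℝ≥0) : Prop where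
  pos : ∀ (z : Z) (r : ℝ), 0 < r → 0 < μ (Metric.ball z r)
  lt_top : ∀ (z : Z) (r : ℝ), 0 < r → μ (Metric.ball z r) < ∞
  exponent_pos : 0 < Q
  doubling : ∀ (z : Z) (r t : ℝ), 0 < r → 1 ≤ t →
      μ (Metric.ball z (t * r)) ≤ C * ENNReal.ofReal (t ^ Q) * μ (Metric.ball z r)

/-- The facts on the geometry of a hyperbolic filling used in the analysis on it: the sets `E x` are
dilated copies of the balls `ball x`. -/
structure FillingGeometry {Z : Type*} [MetricSpace Z] [MeasurableSpace Z]
    (H : HyperbolicFilling Z) (μ : Measure Z) (Q : ℝ) (E : H.Vertex → Set Z) (C : ℝ≥0) (N : ℕ) :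
    Prop where
  measurable : ∀ x, MeasurableSet (E x)
  pos : ∀ x : H.Vertex, 0 < μ (ball x)
  finite : μ univ < ∞
  subset : ∀ x y : H.Vertex, level x ≤ level y + 1 → (ball x ∩ ball y).Nonempty → ball y ⊆ E x
  compare : ∀ x y : H.Vertex, level x ≤ level y + 1 → (ball x ∩ ball y).Nonempty →
    μ (ball x) ≤ C * ENNReal.ofReal (2 ^ (((level y : ℝ) - level x) * Q)) * μ (ball y)
  dilate : ∀ x, μ (E x) ≤ C * μ (ball x)
  overlap : ∀ (n : ℕ) (ξ : Z) (S : Finset H.Vertex), (∀ x ∈ S, level x = n ∧ ξ ∈ E x) → S.card ≤ N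
  degree : ∀ (x : H.Vertex) (S : Finset H.Vertex), (∀ y ∈ S, H.graph.Adj x y) → S.card ≤ N
  finite_level : ∀ n, {x : H.Vertex | level x = n}.Finite
  cover : ∀ (n : ℕ) (ξ : Z), ∃ x : H.Vertex, level x = n ∧ ξ ∈ ball x
  maximal : ∀ t : ℝ, 1 < t → ∃ A : ℝ≥0, ∀ φ : Z → ℝ≥0∞, Measurable φ →
    ∫⁻ ξ, maxFun μ E φ ξ ^ t ∂μ ≤ A * ∫⁻ ξ, φ ξ ^ t ∂μ

namespace HyperbolicFilling

variable {Z : Type*} [MetricSpace Z] {H : HyperbolicFilling Z}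

/-- The centre of the ball of a vertex. -/
noncomputable def center [Nonempty Z] : H.Vertex → Z
  | .root => Classical.arbitrary Z
  | .node _ _ z _ => z

lemma level_eq_zero_iff {x : H.Vertex} : level x = 0 ↔ x = Vertex.root := by
  cases x with
  | root => simp [level]
  | node n hn z hz => simp only [level, reduceCtorEq, iff_false]; omega

lemma ball_eq_of_pos [Nonempty Z] {x : H.Vertex} (hx : 1 ≤ level x) :
    ball x = Metric.ball (center x) ((2 ^ level x)⁻¹) := by
  cases x with
  | root => simp [level] at hx
  | node n hn z hz => simp [ball, center, level]

lemma le_dist_center [Nonempty Z] {x y : H.Vertex} (hl : level x = level y) (hne : x ≠ y) :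
    (2 ^ level x)⁻¹ / 2 ≤ dist (center x) (center y) := by
  cases x with
  | root =>
    exact absurd (level_eq_zero_iff.1 hl.symm).symm hne
  | node n hn z hz =>
    cases y with
    | root => exact absurd (level_eq_zero_iff.1 hl) hne
    | node m hm w hw =>
      obtain rfl : n = m := hl
      have hzw : z ≠ w := fun h => hne (by subst h; rfl)
      have h := (H.maximal n hn).prop hz hw hzw
      simp only [level, center]
      rw [zpow_sub_one₀ (by norm_num), zpow_neg, zpow_natCast] at h
      rw [div_eq_mul_inv]
      exact h

/-- A point at distance at least 2^{-n} from the whole net could be added to it, so by maximality it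
belongs to the net, and then it lies in its own ball. -/
lemma exists_mem_ball (H : HyperbolicFilling Z) (n : ℕ) (ξ : Z) :
    ∃ x : H.Vertex, level x = n ∧ ξ ∈ ball x := by
  rcases Nat.eq_zero_or_pos n with rfl | hn
  · exact ⟨.root, rfl, mem_univ _⟩
  have hpos : (0 : ℝ) < 2 ^ (-(n : ℤ)) := by positivity
  have hhalf : (2 : ℝ) ^ (-(n : ℤ) - 1) < 2 ^ (-(n : ℤ)) := by
    rw [zpow_sub_one₀ (by norm_num)]; linarith
  by_contra! hcon
  have hfar : ∀ z ∈ H.net n, (2 : ℝ) ^ (-(n : ℤ)) ≤ dist ξ z := fun z hz => by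
    have := hcon (.node n hn z hz) rfl
    simpa [ball] using this
  have hmem : ξ ∈ H.net n := by
    refine (H.maximal n hn).le_of_ge (y := insert ξ (H.net n)) ?_ (subset_insert _ _)
      (mem_insert _ _)
    refine (H.maximal n hn).prop.insert fun z hz _ => ?_
    have := hhalf.le.trans (hfar z hz)
    exact ⟨this, by rwa [dist_comm]⟩
  have := hfar ξ hmem
  rw [dist_self] at this
  linarith

end HyperbolicFilling

/-! ### Packing bounds and the dilated balls -/

section Construction

variable {Z : Type*} [MetricSpace Z] [Nonempty Z] [MeasurableSpace Z] {μ : Measure Z} {Q : ℝ}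
  {C : ℝ≥0} {H : HyperbolicFilling Z} {D : ℝ}

lemma ball_subset_ball_center (hD : 2 ≤ D) (hdist : ∀ z w : Z, dist z w < D) (x : H.Vertex) :
    ball x ⊆ Metric.ball (center x) (D * (2 ^ level x)⁻¹) := by
  rcases Nat.eq_zero_or_pos (level x) with h | h
  · intro z _
    rw [h, Metric.mem_ball]
    simpa using hdist z _
  · rw [ball_eq_of_pos h]
    refine Metric.ball_subset_ball ?_
    have : (0 : ℝ) < (2 ^ level x)⁻¹ := by positivity
    nlinarith

/-- The growth condition applied to B(x); the constant C + 1 ≥ 1 takes care of the root, whose set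
is all of Z. -/
lemma measure_ball_center_le (h : IsDoublingOfDim μ Q C) (x : H.Vertex) {t : ℝ} (ht : 1 ≤ t) :
    μ (Metric.ball (center x) (t * (2 ^ level x)⁻¹))
      ≤ (C + 1 : ℝ≥0) * ENNReal.ofReal (t ^ Q) * μ (ball x) := by
  rcases Nat.eq_zero_or_pos (level x) with h0 | h0
  · rw [level_eq_zero_iff.1 h0]
    have h1 : (1 : ℝ≥0∞) ≤ (C + 1 : ℝ≥0) * ENNReal.ofReal (t ^ Q) := by
      have ha : (1 : ℝ≥0∞) ≤ (C + 1 : ℝ≥0) := by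
        rw [ENNReal.coe_add]; exact le_add_self
      have hb : (1 : ℝ≥0∞) ≤ ENNReal.ofReal (t ^ Q) := by
        rw [ENNReal.one_le_ofReal]; exact Real.one_le_rpow ht h.exponent_pos.le
      calc (1 : ℝ≥0∞) = 1 * 1 := by simp
        _ ≤ _ := by gcongr
    calc _ ≤ 1 * μ univ := by rw [one_mul]; exact measure_mono (subset_univ _)
      _ ≤ _ := by gcongr; exact subset_rfl
  · rw [ball_eq_of_pos h0]
    refine (h.doubling _ _ t (by positivity) ht).trans ?_
    gcongr
    simp

lemma measure_ball_pos (h : IsDoublingOfDim μ Q C) (x : H.Vertex) : 0 < μ (ball x) := by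
  rcases Nat.eq_zero_or_pos (level x) with h0 | h0
  · rw [level_eq_zero_iff.1 h0]
    exact (h.pos (Classical.arbitrary Z) 1 one_pos).trans_le (measure_mono (subset_univ _))
  · rw [ball_eq_of_pos h0]; exact h.pos _ _ (by positivity)

/-- Packing: with ρ = 2^{-n}, the balls of radius ρ/4 about the centres are disjoint, since the
centres are ρ/2 apart, and lie in B = B(ξ, (R+1)ρ). Enlarging one of them by the factor 4(2R+1)
covers B, so each has at least a fixed share of μ(B). -/
lemma card_le_of_dist_lt [BorelSpace Z] (h : IsDoublingOfDim μ Q C) (R : ℝ) (hR : 1 ≤ R) :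
    ∃ N : ℕ, ∀ (n : ℕ) (ξ : Z) (S : Finset H.Vertex),
      (∀ x ∈ S, level x = n ∧ dist (center x) ξ < R * (2 ^ n)⁻¹) → S.card ≤ N := by
  set K : ℝ≥0 := C * (((2 * R + 1) * 4) ^ Q).toNNReal with hK
  refine ⟨⌈K⌉₊ + 1, fun n ξ S hS => ?_⟩
  rcases Nat.eq_zero_or_pos n with rfl | hn
  · refine (Finset.card_le_one.2 fun x hx y hy => ?_).trans (by omega)
    rw [level_eq_zero_iff.1 (hS x hx).1, level_eq_zero_iff.1 (hS y hy).1]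
  set ρ : ℝ := (2 ^ n)⁻¹ with hρ
  have hρ0 : 0 < ρ := by positivity
  set B := Metric.ball ξ ((R + 1) * ρ)
  have hB0 : μ B ≠ 0 := (h.pos _ _ (by positivity)).ne'
  have hB1 : μ B ≠ ∞ := (h.lt_top _ _ (by positivity)).ne
  have h1 : ∀ x ∈ S, μ B ≤ K * μ (Metric.ball (center x) (ρ / 4)) := by
    intro x hx
    have hd := h.doubling (center x) (ρ / 4) ((2 * R + 1) * 4) (by positivity) (by linarith)
    have hK' : ((C : ℝ≥0∞) * ENNReal.ofReal (((2 * R + 1) * 4) ^ Q)) = K := by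
      rw [hK, ENNReal.coe_mul]; rfl
    rw [hK'] at hd
    refine (measure_mono ?_).trans hd
    refine Metric.ball_subset_ball' ?_
    have := (hS x hx).2
    rw [dist_comm] at this
    nlinarith
  have hdisj : (S : Set H.Vertex).PairwiseDisjoint fun x => Metric.ball (center x) (ρ / 4) := by
    intro x hx y hy hne
    refine Metric.ball_disjoint_ball ?_
    have := le_dist_center ((hS x hx).1.trans (hS y hy).1.symm) hne
    rw [(hS x hx).1] at this
    linarith
  have h2 : ∑ x ∈ S, μ (Metric.ball (center x) (ρ / 4)) ≤ μ B := by
    rw [← measure_biUnion_finset hdisj fun x _ => Metric.isOpen_ball.measurableSet]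
    refine measure_mono (iUnion₂_subset fun x hx => Metric.ball_subset_ball' ?_)
    have := (hS x hx).2
    nlinarith
  have h3 : (S.card : ℝ≥0∞) * μ B ≤ K * μ B := by
    calc (S.card : ℝ≥0∞) * μ B = ∑ x ∈ S, μ B := by simp
      _ ≤ ∑ x ∈ S, K * μ (Metric.ball (center x) (ρ / 4)) := Finset.sum_le_sum h1
      _ = K * ∑ x ∈ S, μ (Metric.ball (center x) (ρ / 4)) := by rw [Finset.mul_sum]
      _ ≤ _ := by gcongr
  have h4 := (ENNReal.mul_le_mul_iff_left hB0 hB1).1 h3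
  have h5 : (S.card : ℝ≥0) ≤ K := by exact_mod_cast h4
  have h6 : (S.card : ℝ≥0) ≤ ⌈K⌉₊ := h5.trans (Nat.le_ceil K)
  have : S.card ≤ ⌈K⌉₊ := by exact_mod_cast h6
  omega

theorem exists_fillingGeometry [BorelSpace Z] [BoundedSpace Z] (h : IsDoublingOfDim μ Q C)
    (H : HyperbolicFilling Z) :
    ∃ (E : H.Vertex → Set Z) (C' : ℝ≥0) (N : ℕ), FillingGeometry H μ Q E C' N := by
  obtain ⟨D, hD, hdist⟩ : ∃ D : ℝ, 2 ≤ D ∧ ∀ z w : Z, dist z w < D := by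
    obtain ⟨D, hD⟩ := Metric.isBounded_iff.1 (Bornology.IsBounded.all (univ : Set Z))
    refine ⟨max D 1 + 1, by linarith [le_max_right D 1], fun z w => ?_⟩
    have := hD (mem_univ z) (mem_univ w)
    linarith [le_max_left D 1]
  have hQ := h.exponent_pos
  have hfin : μ univ < ∞ := by
    have : (univ : Set Z) = Metric.ball (Classical.arbitrary Z) D := by
      ext z; simpa using hdist z _
    rw [this]; exact h.lt_top _ _ (by linarith)
  have hfinm : IsFiniteMeasure μ := ⟨hfin⟩
  -- D exceeds all distances, so B(x) lies in the ball of radius Dρ_x about the centre, with ρ_x =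
  -- 2^{-|x|}, also for the root. If |x| ≤ |y| + 1 and the balls meet, then ρ_y ≤ 2ρ_x, and B(y) is
  -- within Dρ_x + 2Dρ_y ≤ 5Dρ_x of the centre of x; hence the factor 5.
  set E : H.Vertex → Set Z := fun x => Metric.ball (center x) (5 * D * (2 ^ level x)⁻¹) with hE
  have hEm : ∀ x, MeasurableSet (E x) := fun x => Metric.isOpen_ball.measurableSet
  have hρ : ∀ x : H.Vertex, (0 : ℝ) < (2 ^ level x)⁻¹ := fun x => by positivity
  have hlev : ∀ x y : H.Vertex, level x ≤ level y + 1 →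
      ((2 : ℝ) ^ level y)⁻¹ ≤ 2 * (2 ^ level x)⁻¹ := by
    intro x y hxy
    have : (2 : ℝ) ^ level x ≤ 2 ^ (level y + 1) := pow_le_pow_right₀ (by norm_num) hxy
    rw [pow_succ] at this
    rw [← div_eq_mul_inv, le_div_iff₀ (by positivity), inv_mul_le_iff₀ (by positivity)]
    exact this
  have hball := ball_subset_ball_center (H := H) hD hdist
  have hmeet : ∀ x y : H.Vertex, (ball x ∩ ball y).Nonempty →
      dist (center x) (center y) < D * (2 ^ level x)⁻¹ + D * (2 ^ level y)⁻¹ := by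
    rintro x y ⟨v, hvx, hvy⟩
    have h1 := hball x hvx
    have h2 := hball y hvy
    rw [Metric.mem_ball] at h1 h2
    have := dist_triangle_left (center x) (center y) v
    linarith
  have hEball : ∀ x, ball x ⊆ E x := fun x => (hball x).trans (Metric.ball_subset_ball (by
    have := hρ x; nlinarith))
  obtain ⟨N₁, hN₁⟩ := card_le_of_dist_lt (H := H) h (5 * D) (by linarith)
  set K : ℝ≥0 := (C + 1) * ((25 * D) ^ Q).toNNReal with hK
  have hK' : ∀ t : ℝ, 0 < t → t ≤ 25 * D →
      ((C + 1 : ℝ≥0) : ℝ≥0∞) * ENNReal.ofReal (t ^ Q) ≤ K := by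
    intro t ht ht'
    rw [hK, ENNReal.coe_mul]
    have : ENNReal.ofReal (t ^ Q) ≤ ENNReal.ofReal ((25 * D) ^ Q) :=
      ENNReal.ofReal_le_ofReal (Real.rpow_le_rpow ht.le ht' hQ.le)
    gcongr
    exact this
  -- With R = D 2^n the packing bound sees every vertex of level n, because Z is bounded.
  have hfinlev : ∀ n, {x : H.Vertex | level x = n}.Finite := by
    intro n
    have h1 : 1 ≤ D * 2 ^ n := by
      have : (1 : ℝ) ≤ 2 ^ n := one_le_pow₀ (by norm_num)
      nlinarith
    obtain ⟨N, hN⟩ := card_le_of_dist_lt (H := H) h (D * 2 ^ n) h1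
    by_contra hinf
    obtain ⟨S, hS, hcard⟩ := Set.Infinite.exists_subset_card_eq hinf (N + 1)
    have := hN n (Classical.arbitrary Z) S fun x hx => ⟨hS hx, by
      rw [mul_assoc, mul_inv_cancel₀ (by positivity), mul_one]; exact hdist _ _⟩
    omega
  have hcount : Countable H.Vertex := by
    rw [← countable_univ_iff]
    have : (univ : Set H.Vertex) = ⋃ n : ℕ, {x : H.Vertex | level x = n} := by ext x; simp
    rw [this]
    exact countable_iUnion fun n => (hfinlev n).countable
  refine ⟨E, K, 3 * N₁, ⟨hEm, fun x => measure_ball_pos h x, hfin, ?_, ?_, ?_, ?_, ?_, hfinlev,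
    H.exists_mem_ball, ?_⟩⟩
  · intro x y hxy hne
    refine (hball y).trans (Metric.ball_subset_ball' ?_)
    have h1 := hlev x y hxy
    have h2 := hmeet x y hne
    rw [dist_comm] at h2
    nlinarith
  · intro x y hxy hne
    have h1 := hlev x y hxy
    have h2 := hmeet x y hne
    have hy : (0 : ℝ) < 2 ^ level y := by positivity
    have hx : (0 : ℝ) < 2 ^ level x := by positivity
    -- B(x) lies within 2Dρ_x + Dρ_y ≤ 4Dρ_x of the centre of y; t is this radius measured in units
    -- of ρ_y.
    set t : ℝ := 4 * D * (2 ^ level y * (2 ^ level x)⁻¹) with ht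
    have ht1 : 1 ≤ t := by
      have : (1 : ℝ) ≤ 2 * (2 ^ level y * (2 ^ level x)⁻¹) := by
        have := mul_le_mul_of_nonneg_left h1 hy.le
        rw [mul_inv_cancel₀ hy.ne'] at this
        linarith
      rw [ht]; nlinarith
    have hty : t * (2 ^ level y)⁻¹ = 4 * D * (2 ^ level x)⁻¹ := by
      rw [ht]; field_simp
    have hsub : ball x ⊆ Metric.ball (center y) (t * (2 ^ level y)⁻¹) := by
      refine (hball x).trans (Metric.ball_subset_ball' ?_)
      rw [hty]
      nlinarith
    refine (measure_mono hsub).trans ((measure_ball_center_le h y ht1).trans ?_)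
    gcongr ?_ * _
    have htQ : t ^ Q = (4 * D) ^ Q * 2 ^ (((level y : ℝ) - level x) * Q) := by
      rw [ht, Real.mul_rpow (by positivity) (by positivity), Real.rpow_mul (by norm_num),
        Real.rpow_sub (by norm_num), Real.rpow_natCast, Real.rpow_natCast, div_eq_mul_inv]
    rw [htQ, ENNReal.ofReal_mul (by positivity), ← mul_assoc]
    gcongr
    exact hK' _ (by linarith) (by linarith)
  · intro x
    refine (measure_ball_center_le h x (by linarith)).trans ?_
    gcongr
    exact hK' _ (by linarith) (by linarith)
  · intro n ξ S hS
    refine (hN₁ n ξ S fun x hx => ⟨(hS x hx).1, ?_⟩).trans (by omega)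
    have := (hS x hx).2
    rw [hE, Metric.mem_ball, dist_comm, (hS x hx).1] at this
    exact this
  · intro x S hS
    classical
    have hlevel : ∀ k, (S.filter fun y => level y = k).card ≤ N₁ := by
      intro k
      refine hN₁ k (center x) _ fun y hy => ?_
      rw [Finset.mem_filter] at hy
      refine ⟨hy.2, ?_⟩
      obtain ⟨-, h1, h2, h3⟩ := hS y hy.1
      have h4 := hlev y x h2
      have h5 := hmeet x y h3
      rw [dist_comm, ← hy.2]
      have := hρ y
      nlinarith
    -- Neighbours live on three levels. At the root the truncated subtraction makes two of the
    -- filters coincide, which does no harm to an upper bound.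
    have hsub : S ⊆ ((S.filter fun y => level y = level x - 1) ∪
        (S.filter fun y => level y = level x)) ∪ (S.filter fun y => level y = level x + 1) := by
      intro y hy
      obtain ⟨-, h1, h2, h3⟩ := hS y hy
      simp only [Finset.mem_union, Finset.mem_filter, hy, true_and]
      omega
    have h1 := Finset.card_le_card hsub
    have h2 := Finset.card_union_le ((S.filter fun y => level y = level x - 1) ∪
        (S.filter fun y => level y = level x)) (S.filter fun y => level y = level x + 1)
    have h3 := Finset.card_union_le (S.filter fun y => level y = level x - 1)
        (S.filter fun y => level y = level x)
    have := hlevel (level x - 1)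
    have := hlevel (level x)
    have := hlevel (level x + 1)
    omega
  · intro t ht
    -- Vitali's theorem with ratio 2: if E a meets E b and ρ_a ≤ 2ρ_b, then E a is within 5Dρ_b + 2
    -- · 5Dρ_a ≤ 25Dρ_b of the centre of b.
    refine lintegral_maxFun_rpow_le (C := K)
      (E' := fun x => Metric.ball (center x) (25 * D * (2 ^ level x)⁻¹)) hEm
      (fun x => ((measure_ball_pos h x).trans_le (measure_mono (hEball x))).ne') (fun x => ?_)
      (fun J _ => ?_) ht
    · refine (measure_ball_center_le h x (by linarith)).trans ?_
      have := measure_mono (μ := μ) (hEball x)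
      gcongr
      exact hK' _ (by linarith) le_rfl
    · obtain ⟨u, hu, hud, hcov⟩ := Vitali.exists_disjoint_subfamily_covering_enlargement E J
        (fun x => 5 * D * (2 ^ level x)⁻¹) 2 (by norm_num) (fun a _ => by positivity) (5 * D)
        (fun a _ => by
          have : ((2 : ℝ) ^ level a)⁻¹ ≤ 1 := inv_le_one_of_one_le₀ (one_le_pow₀ (by norm_num))
          nlinarith)
        (fun a _ => ⟨center a, Metric.mem_ball_self (by positivity)⟩)
      refine ⟨u, hu, hud, fun a ha => ?_⟩
      obtain ⟨b, hb, ⟨v, hva, hvb⟩, hab⟩ := hcov a ha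
      refine ⟨b, hb, Metric.ball_subset_ball' ?_⟩
      rw [hE, Metric.mem_ball] at hva hvb
      have := dist_triangle_left (center a) (center b) v
      linarith

end Construction

end TriebelLizorkin

namespace TriebelLizorkin

/-! ### A vector-valued inequality for averaging operators -/

/-- A family of positive self-adjoint averaging operators dominated by a maximal function. -/
structure IsAveragingFamily {I α : Type*} [MeasurableSpace α] (μ : Measure α)
    (A : I → (α → ℝ≥0∞) → α → ℝ≥0∞) : Prop where
  measurable : ∀ i h, Measurable h → Measurable (A i h)
  symm : ∀ i h φ, Measurable h → Measurable φ →
    ∫⁻ ξ, A i h ξ * φ ξ ∂μ = ∫⁻ ξ, h ξ * A i φ ξ ∂μ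
  jensen : ∀ q : ℝ, 1 < q → ∃ c : ℝ≥0, ∀ i h, Measurable h → ∀ ξ,
    A i h ξ ^ q ≤ c * A i (fun η => h η ^ q) ξ
  maximal : ∀ t : ℝ, 1 < t → ∃ c : ℝ≥0, ∀ φ, Measurable φ → ∃ M : α → ℝ≥0∞, Measurable M ∧
    (∀ i ξ, A i φ ξ ≤ M ξ) ∧ ∫⁻ ξ, M ξ ^ t ∂μ ≤ c * ∫⁻ ξ, φ ξ ^ t ∂μ
  one : ∃ c : ℝ≥0, ∀ i ξ, A i (fun _ => 1) ξ ≤ c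

lemma sum_rpow_le_rpow_sum {I : Type*} {q : ℝ} (hq : 1 ≤ q) (J : Finset I) (a : I → ℝ≥0∞) :
    ∑ i ∈ J, a i ^ q ≤ (∑ i ∈ J, a i) ^ q := by
  induction J using Finset.cons_induction with
  | empty => simp
  | cons b s hb ih =>
    rw [Finset.sum_cons, Finset.sum_cons]
    exact (add_le_add le_rfl ih).trans (ENNReal.add_rpow_le_rpow_add _ _ hq)

namespace IsAveragingFamily

variable {I α : Type*} [MeasurableSpace α] {μ : Measure α}
    {A : I → (α → ℝ≥0∞) → α → ℝ≥0∞}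

lemma lintegral_sum_mul_comm (hA : IsAveragingFamily μ A) (J : Finset I) {h φ : I → α → ℝ≥0∞}
    (hh : ∀ i, Measurable (h i)) (hφ : ∀ i, Measurable (φ i)) :
    ∫⁻ ξ, ∑ i ∈ J, A i (h i) ξ * φ i ξ ∂μ = ∫⁻ ξ, ∑ i ∈ J, h i ξ * A i (φ i) ξ ∂μ := by
  have h1 : ∀ i ∈ J, Measurable fun ξ => A i (h i) ξ * φ i ξ := fun i _ =>
    (hA.measurable i _ (hh i)).mul (hφ i)
  have h2 : ∀ i ∈ J, Measurable fun ξ => h i ξ * A i (φ i) ξ := fun i _ =>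
    (hh i).mul (hA.measurable i _ (hφ i))
  rw [lintegral_finsetSum _ h1, lintegral_finsetSum _ h2]
  exact Finset.sum_congr rfl fun i _ => hA.symm i _ _ (hh i) (hφ i)

/-- The a priori finiteness needed for the absorption arguments that follow; its size is irrelevant,
so it may depend on J. -/
lemma lintegral_sum_rpow_lt_top (hA : IsAveragingFamily μ A) {t : ℝ} (ht : 1 < t) (J : Finset I)
    {k : I → α → ℝ≥0∞} (hk : ∀ i, Measurable (k i)) (hfin : ∀ i ∈ J, ∫⁻ ξ, k i ξ ^ t ∂μ ≠ ∞) :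
    ∫⁻ ξ, (∑ i ∈ J, A i (k i) ξ) ^ t ∂μ ≠ ∞ := by
  have hc : ∀ i ∈ J, ∫⁻ ξ, A i (k i) ξ ^ t ∂μ ≠ ∞ := by
    intro i hi
    obtain ⟨c, hc⟩ := hA.maximal t ht
    obtain ⟨M, -, hM1, hM2⟩ := hc (k i) (hk i)
    refine ne_top_of_le_ne_top (ENNReal.mul_ne_top (by simp) (hfin i hi)) (le_trans ?_ hM2)
    exact lintegral_mono fun ξ => ENNReal.rpow_le_rpow (hM1 i ξ) (by linarith)
  refine ne_top_of_le_ne_top ?_ (lintegral_mono fun ξ =>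
    ENNReal.rpow_sum_le_const_mul_sum_rpow J (fun i => A i (k i) ξ) ht.le)
  rw [lintegral_const_mul', lintegral_finsetSum]
  · refine ENNReal.mul_ne_top ?_ (ENNReal.sum_ne_top.2 hc)
    exact ENNReal.rpow_ne_top_of_nonneg (by linarith) (by simp)
  · exact fun i _ => (hA.measurable i _ (hk i)).pow_const t
  · exact ENNReal.rpow_ne_top_of_nonneg (by linarith) (by simp)

/-- Put Φ = ∑ A_i k_i. Self-adjointness moves A_i onto Φ^{t-1}, where a single maximal function M
dominates all i: ∫ Φ^t = ∫ ∑ k_i A_i(Φ^{t-1}) ≤ ∫ (∑ k_i) M. Hölder's inequality, the maximal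
inequality for the conjugate exponent and absorption conclude. For t = 1 the bound on A_i 1
suffices. -/
lemma lintegral_sum_rpow_le (hA : IsAveragingFamily μ A) {t : ℝ} (ht : 1 ≤ t) :
    ∃ c : ℝ≥0, 1 ≤ c ∧ ∀ (J : Finset I) (k : I → α → ℝ≥0∞), (∀ i, Measurable (k i)) →
      ∫⁻ ξ, (∑ i ∈ J, A i (k i) ξ) ^ t ∂μ ≤ c * ∫⁻ ξ, (∑ i ∈ J, k i ξ) ^ t ∂μ := by
  rcases ht.eq_or_lt with rfl | ht
  · obtain ⟨c, hc⟩ := hA.one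
    refine ⟨max c 1, le_max_right _ _, fun J k hk => ?_⟩
    simp only [ENNReal.rpow_one]
    rw [lintegral_finsetSum _ fun i _ => hA.measurable i _ (hk i),
      lintegral_finsetSum _ fun i _ => hk i, Finset.mul_sum]
    refine Finset.sum_le_sum fun i _ => ?_
    have h := hA.symm i (k i) (fun _ => 1) (hk i) measurable_const
    simp only [mul_one] at h
    rw [h, ← lintegral_const_mul _ (hk i)]
    refine lintegral_mono fun ξ => ?_
    rw [mul_comm]
    gcongr
    exact (hc i ξ).trans (by exact_mod_cast le_max_left _ _)
  · have ht0 : 0 < t := by linarith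
    have ht' : 1 < t / (t - 1) := by rw [lt_div_iff₀ (by linarith)]; linarith
    obtain ⟨c, hc⟩ := hA.maximal _ ht'
    set K : ℝ≥0∞ := ((c : ℝ≥0∞) ^ (1 - 1 / t)) ^ t with hK
    have hexp : 0 ≤ 1 - 1 / t := by
      rw [sub_nonneg, div_le_one ht0]; exact ht.le
    have hKtop : K ≠ ∞ := ENNReal.rpow_ne_top_of_nonneg ht0.le
      (ENNReal.rpow_ne_top_of_nonneg hexp (by simp))
    -- A positive constant makes the case of an infinite right side trivial; a constant 0 would give
    -- 0 · ∞ = 0.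
    refine ⟨max K.toNNReal 1, le_max_right _ _, fun J k hk => ?_⟩
    have hKle : K ≤ (max K.toNNReal 1 : ℝ≥0) := by
      rw [← ENNReal.coe_toNNReal hKtop]; exact_mod_cast le_max_left _ _
    by_cases htop : ∫⁻ ξ, (∑ i ∈ J, k i ξ) ^ t ∂μ = ∞
    · rw [htop, ENNReal.mul_top]
      · exact le_top
      · have : (0 : ℝ≥0) < max K.toNNReal 1 := lt_max_of_lt_right one_pos
        exact_mod_cast this.ne'
    have hΦfin : ∫⁻ ξ, (∑ i ∈ J, A i (k i) ξ) ^ t ∂μ ≠ ∞ := by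
      refine hA.lintegral_sum_rpow_lt_top ht J hk fun i hi => ?_
      refine ne_top_of_le_ne_top htop (lintegral_mono fun ξ => ?_)
      exact ENNReal.rpow_le_rpow
        (Finset.single_le_sum (f := fun i => k i ξ) (fun _ _ => zero_le) hi) ht0.le
    refine le_trans (le_of_le_mul_rpow ht (K := (c : ℝ≥0∞) ^ (1 - 1 / t)) hΦfin ?_)
      (mul_le_mul_left hKle _)
    set Φ : α → ℝ≥0∞ := fun ξ => ∑ i ∈ J, A i (k i) ξ with hΦ
    have hΦm : Measurable Φ := Finset.measurable_sum _ fun i _ => hA.measurable i _ (hk i)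
    obtain ⟨M, hMm, hM1, hM2⟩ := hc (fun ξ => Φ ξ ^ (t - 1)) (hΦm.pow_const _)
    have hconj : t.HolderConjugate (t / (t - 1)) := Real.HolderConjugate.conjExponent ht
    have ht1 : t - 1 ≠ 0 := by linarith
    calc ∫⁻ ξ, Φ ξ ^ t ∂μ = ∫⁻ ξ, ∑ i ∈ J, A i (k i) ξ * Φ ξ ^ (t - 1) ∂μ := by
          refine lintegral_congr fun ξ => ?_
          rw [← Finset.sum_mul]
          nth_rewrite 1 [show t = 1 + (t - 1) by ring]
          rw [ENNReal.rpow_add_of_nonneg _ _ zero_le_one (by linarith), ENNReal.rpow_one]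
      _ = ∫⁻ ξ, ∑ i ∈ J, k i ξ * A i (fun ξ => Φ ξ ^ (t - 1)) ξ ∂μ :=
          hA.lintegral_sum_mul_comm J hk fun _ => hΦm.pow_const _
      _ ≤ ∫⁻ ξ, (∑ i ∈ J, k i ξ) * M ξ ∂μ := by
          refine lintegral_mono fun ξ => ?_
          rw [Finset.sum_mul]
          exact Finset.sum_le_sum fun i _ => mul_le_mul_right (hM1 i ξ) _
      _ ≤ (∫⁻ ξ, (∑ i ∈ J, k i ξ) ^ t ∂μ) ^ (1 / t)
            * (∫⁻ ξ, M ξ ^ (t / (t - 1)) ∂μ) ^ (1 / (t / (t - 1))) :=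
          ENNReal.lintegral_mul_le_Lp_mul_Lq μ hconj
            (Finset.measurable_fun_sum _ fun i _ => hk i).aemeasurable hMm.aemeasurable
      _ ≤ (∫⁻ ξ, (∑ i ∈ J, k i ξ) ^ t ∂μ) ^ (1 / t) * (c * ∫⁻ ξ, Φ ξ ^ t ∂μ) ^ (1 - 1 / t) := by
          have he : 1 / (t / (t - 1)) = 1 - 1 / t := by field_simp
          rw [he]
          gcongr
          refine hM2.trans (le_of_eq ?_)
          congr 2
          ext ξ
          rw [← ENNReal.rpow_mul]
          congr 1
          field_simp
      _ = _ := by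
          rw [ENNReal.mul_rpow_of_nonneg _ _ hexp]
          ring

/-- Jensen's inequality moves the power q inside A_i, which leaves the scalar sums of h_i^q with the
exponent P/q ≥ 1. -/
lemma vector_valued_of_le (hA : IsAveragingFamily μ A) {q P : ℝ} (hq : 1 < q) (hqP : q ≤ P) :
    ∃ c : ℝ≥0, ∀ (J : Finset I) (h : I → α → ℝ≥0∞), (∀ i, Measurable (h i)) →
      ∫⁻ ξ, (∑ i ∈ J, A i (h i) ξ ^ q) ^ (P / q) ∂μ
        ≤ c * ∫⁻ ξ, (∑ i ∈ J, h i ξ ^ q) ^ (P / q) ∂μ := by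
  have hq0 : 0 < q := by linarith
  have hPq : 0 < P / q := div_pos (by linarith) hq0
  obtain ⟨c₁, hc₁⟩ := hA.jensen q hq
  obtain ⟨c₂, -, hc₂⟩ := hA.lintegral_sum_rpow_le ((one_le_div hq0).2 hqP)
  have hctop : ((c₁ : ℝ≥0∞) ^ (P / q)) ≠ ∞ := ENNReal.rpow_ne_top_of_nonneg hPq.le (by simp)
  refine ⟨((c₁ : ℝ≥0∞) ^ (P / q)).toNNReal * c₂, fun J h hh => ?_⟩
  rw [ENNReal.coe_mul, ENNReal.coe_toNNReal hctop, mul_assoc]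
  calc ∫⁻ ξ, (∑ i ∈ J, A i (h i) ξ ^ q) ^ (P / q) ∂μ
      ≤ ∫⁻ ξ, (c₁ : ℝ≥0∞) ^ (P / q) * (∑ i ∈ J, A i (fun η => h i η ^ q) ξ) ^ (P / q) ∂μ := by
        refine lintegral_mono fun ξ => ?_
        rw [← ENNReal.mul_rpow_of_nonneg _ _ hPq.le, Finset.mul_sum]
        exact ENNReal.rpow_le_rpow (Finset.sum_le_sum fun i _ => hc₁ i _ (hh i) ξ) hPq.le
    _ = (c₁ : ℝ≥0∞) ^ (P / q) * ∫⁻ ξ, (∑ i ∈ J, A i (fun η => h i η ^ q) ξ) ^ (P / q) ∂μ :=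
        lintegral_const_mul' _ _ hctop
    _ ≤ _ := mul_le_mul_right (hc₂ J _ fun i => (hh i).pow_const q) _

/-- Duality: P < q means q' ≤ P', the case already settled. With F = (∑ (A_i h_i)^q)^{1/q}, test
against the norming family of (A_i h_i), move A_i onto it by self-adjointness, and use Hölder's
inequality twice. -/
lemma vector_valued_of_lt (hA : IsAveragingFamily μ A) {q P : ℝ} (hP : 1 < P) (hPq : P < q) :
    ∃ c : ℝ≥0, ∀ (J : Finset I) (h : I → α → ℝ≥0∞), (∀ i, Measurable (h i)) →
      ∫⁻ ξ, (∑ i ∈ J, A i (h i) ξ ^ q) ^ (P / q) ∂μ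
        ≤ c * ∫⁻ ξ, (∑ i ∈ J, h i ξ ^ q) ^ (P / q) ∂μ := by
  have hq : 1 < q := by linarith
  have hq0 : 0 < q := by linarith
  have hP0 : 0 < P := by linarith
  have hq1 : 0 < q - 1 := by linarith
  have hP1 : 0 < P - 1 := by linarith
  set q' := q / (q - 1) with hq'
  set P' := P / (P - 1) with hP'
  have hqc : q.HolderConjugate q' := Real.HolderConjugate.conjExponent hq
  have hPc : P.HolderConjugate P' := Real.HolderConjugate.conjExponent hP
  have hq'1 : 1 < q' := hqc.symm.lt
  have hq'P' : q' ≤ P' := by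
    rw [hq', hP', div_le_div_iff₀ hq1 hP1]; nlinarith
  have hP'0 : 0 < P' := hPc.symm.pos
  have hq'0 : 0 < q' := hqc.symm.pos
  obtain ⟨c, hc⟩ := hA.vector_valued_of_le hq'1 hq'P'
  set K : ℝ≥0∞ := ((c : ℝ≥0∞) ^ (1 - 1 / P)) ^ P with hK
  have hexp : 0 ≤ 1 - 1 / P := by
    rw [sub_nonneg, div_le_one hP0]; exact hP.le
  have hKtop : K ≠ ∞ := ENNReal.rpow_ne_top_of_nonneg hP0.le
    (ENNReal.rpow_ne_top_of_nonneg hexp (by simp))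
  refine ⟨max K.toNNReal 1, fun J h hh => ?_⟩
  have hKle : K ≤ (max K.toNNReal 1 : ℝ≥0) := by
    rw [← ENNReal.coe_toNNReal hKtop]; exact_mod_cast le_max_left _ _
  by_cases htop : ∫⁻ ξ, (∑ i ∈ J, h i ξ ^ q) ^ (P / q) ∂μ = ∞
  · rw [htop, ENNReal.mul_top]
    · exact le_top
    · have : (0 : ℝ≥0) < max K.toNNReal 1 := lt_max_of_lt_right one_pos
      exact_mod_cast this.ne'
  set F : α → ℝ≥0∞ := fun ξ => (∑ i ∈ J, A i (h i) ξ ^ q) ^ (1 / q) with hF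
  have hAm : ∀ i, Measurable (A i (h i)) := fun i => hA.measurable i _ (hh i)
  have hFm : Measurable F :=
    (Finset.measurable_fun_sum _ fun i _ => (hAm i).pow_const q).pow_const _
  have hFP : ∀ ξ, (∑ i ∈ J, A i (h i) ξ ^ q) ^ (P / q) = F ξ ^ P := by
    intro ξ
    rw [hF, ← ENNReal.rpow_mul]
    congr 1
    field_simp
  have hFq : ∀ ξ, (∑ i ∈ J, A i (h i) ξ ^ q) = F ξ ^ q := by
    intro ξ
    rw [hF, ← ENNReal.rpow_mul, one_div_mul_cancel hq0.ne', ENNReal.rpow_one]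
  simp_rw [hFP]
  have hXfin : ∫⁻ ξ, F ξ ^ P ∂μ ≠ ∞ := by
    refine ne_top_of_le_ne_top (hA.lintegral_sum_rpow_lt_top hP J hh fun i hi => ?_)
      (lintegral_mono fun ξ => ENNReal.rpow_le_rpow (?_ : F ξ ≤ ∑ i ∈ J, A i (h i) ξ) hP0.le)
    · refine ne_top_of_le_ne_top htop (lintegral_mono fun ξ => ?_)
      calc h i ξ ^ P = (h i ξ ^ q) ^ (P / q) := by
            rw [← ENNReal.rpow_mul]; congr 1; field_simp
        _ ≤ _ := ENNReal.rpow_le_rpow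
          (Finset.single_le_sum (f := fun i => h i ξ ^ q) (fun _ _ => zero_le) hi) (by positivity)
    · rw [hF]
      simp only
      have : ∑ i ∈ J, A i (h i) ξ ^ q ≤ (∑ i ∈ J, A i (h i) ξ) ^ q := by
        exact sum_rpow_le_rpow_sum hq.le J _
      refine (ENNReal.rpow_le_rpow this (by positivity)).trans (le_of_eq ?_)
      rw [← ENNReal.rpow_mul, mul_one_div_cancel hq0.ne', ENNReal.rpow_one]
  refine le_trans (le_of_le_mul_rpow hP (K := (c : ℝ≥0∞) ^ (1 - 1 / P)) hXfin ?_)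
    (mul_le_mul_left hKle _)
  -- The norming family for the mixed norm: ∑ A_i h_i · φ_i = F^P and ‖φ‖_{ℓ^{q'}}^{P'} = F^P
  -- wherever 0 < F < ∞. The exponent P - q is negative; the conventions 0 · ∞ = 0 and ∞^{P-q} = 0
  -- keep both formulas right where F = 0, and the inequality below right where F = ∞.
  set φ : I → α → ℝ≥0∞ := fun i ξ => A i (h i) ξ ^ (q - 1) * F ξ ^ (P - q) with hφ
  have hφm : ∀ i, Measurable (φ i) := fun i => ((hAm i).pow_const _).mul (hFm.pow_const _)
  have hφq : ∀ ξ, (∑ i ∈ J, φ i ξ ^ q') ^ (P' / q') ≤ F ξ ^ P := by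
    intro ξ
    have h1 : ∀ i, φ i ξ ^ q' = A i (h i) ξ ^ q * F ξ ^ ((P - q) * q') := by
      intro i
      rw [hφ]
      simp only
      rw [ENNReal.mul_rpow_of_nonneg _ _ hq'0.le, ← ENNReal.rpow_mul, ← ENNReal.rpow_mul]
      congr 2
      rw [hq']; field_simp
    simp_rw [h1, ← Finset.sum_mul, hFq]
    rcases eq_or_ne (F ξ) 0 with h0 | h0
    · rw [h0, ENNReal.zero_rpow_of_pos hq0, zero_mul, ENNReal.zero_rpow_of_pos (by positivity)]
      exact zero_le
    rcases eq_or_ne (F ξ) ∞ with h2 | h2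
    · rw [h2, ENNReal.top_rpow_of_pos hP0]; exact le_top
    rw [← ENNReal.rpow_add _ _ h0 h2, ← ENNReal.rpow_mul]
    refine le_of_eq (congrArg _ ?_)
    rw [hq', hP']
    field_simp
    ring
  calc ∫⁻ ξ, F ξ ^ P ∂μ = ∫⁻ ξ, ∑ i ∈ J, A i (h i) ξ * φ i ξ ∂μ := by
        refine lintegral_congr_ae ?_
        -- Where F = ∞ the pairing would be 0 instead of ∞, but F^P is integrable, so this set is
        -- null.
        filter_upwards [ae_lt_top (hFm.pow_const P) hXfin] with ξ hξ
        have h2 : F ξ ≠ ∞ := by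
          intro h2; rw [h2, ENNReal.top_rpow_of_pos hP0] at hξ; exact hξ.ne rfl
        have h1 : ∀ i, A i (h i) ξ * φ i ξ = A i (h i) ξ ^ q * F ξ ^ (P - q) := by
          intro i
          rw [hφ]
          simp only
          rw [← mul_assoc]
          nth_rewrite 3 [show q = 1 + (q - 1) by ring]
          rw [ENNReal.rpow_add_of_nonneg _ _ zero_le_one hq1.le, ENNReal.rpow_one]
        simp_rw [h1, ← Finset.sum_mul, hFq]
        rcases eq_or_ne (F ξ) 0 with h0 | h0
        · rw [h0, ENNReal.zero_rpow_of_pos hq0, zero_mul, ENNReal.zero_rpow_of_pos hP0]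
        rw [← ENNReal.rpow_add _ _ h0 h2]
        congr 1
        ring
    _ = ∫⁻ ξ, ∑ i ∈ J, h i ξ * A i (φ i) ξ ∂μ := hA.lintegral_sum_mul_comm J hh hφm
    _ ≤ ∫⁻ ξ, (∑ i ∈ J, h i ξ ^ q) ^ (1 / q) * (∑ i ∈ J, A i (φ i) ξ ^ q') ^ (1 / q') ∂μ :=
        lintegral_mono fun ξ => ENNReal.inner_le_Lp_mul_Lq J _ _ hqc
    _ ≤ (∫⁻ ξ, ((∑ i ∈ J, h i ξ ^ q) ^ (1 / q)) ^ P ∂μ) ^ (1 / P)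
          * (∫⁻ ξ, ((∑ i ∈ J, A i (φ i) ξ ^ q') ^ (1 / q')) ^ P' ∂μ) ^ (1 / P') :=
        ENNReal.lintegral_mul_le_Lp_mul_Lq μ hPc
          ((Finset.measurable_fun_sum _ fun i _ => (hh i).pow_const q).pow_const _).aemeasurable
          ((Finset.measurable_fun_sum _ fun i _ =>
            (hA.measurable i _ (hφm i)).pow_const _).pow_const _).aemeasurable
    _ ≤ (∫⁻ ξ, (∑ i ∈ J, h i ξ ^ q) ^ (P / q) ∂μ) ^ (1 / P)
          * (c * ∫⁻ ξ, F ξ ^ P ∂μ) ^ (1 - 1 / P) := by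
        have he : 1 / P' = 1 - 1 / P := by rw [hP']; field_simp
        rw [he]
        simp_rw [← ENNReal.rpow_mul, one_div_mul_eq_div]
        gcongr
        refine (hc J φ hφm).trans ?_
        gcongr with ξ
        exact hφq ξ
    _ = _ := by
        rw [ENNReal.mul_rpow_of_nonneg _ _ hexp]
        ring

/-- The vector-valued inequality for averaging operators. -/
theorem vector_valued [Countable I] (hA : IsAveragingFamily μ A) {q P : ℝ} (hq : 1 < q)
    (hP : 1 < P) :
    ∃ c : ℝ≥0, ∀ h : I → α → ℝ≥0∞, (∀ i, Measurable (h i)) →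
      ∫⁻ ξ, (∑' i, A i (h i) ξ ^ q) ^ (P / q) ∂μ
        ≤ c * ∫⁻ ξ, (∑' i, h i ξ ^ q) ^ (P / q) ∂μ := by
  have hPq : 0 < P / q := by positivity
  obtain ⟨c, hc⟩ : ∃ c : ℝ≥0, ∀ (J : Finset I) (h : I → α → ℝ≥0∞), (∀ i, Measurable (h i)) →
      ∫⁻ ξ, (∑ i ∈ J, A i (h i) ξ ^ q) ^ (P / q) ∂μ
        ≤ c * ∫⁻ ξ, (∑ i ∈ J, h i ξ ^ q) ^ (P / q) ∂μ := by
    rcases le_or_gt q P with h | h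
    · exact hA.vector_valued_of_le hq h
    · exact hA.vector_valued_of_lt hP h
  refine ⟨c, fun h hh => ?_⟩
  have hsup : ∀ ξ, (∑' i, A i (h i) ξ ^ q) ^ (P / q)
      = ⨆ J : Finset I, (∑ i ∈ J, A i (h i) ξ ^ q) ^ (P / q) := by
    intro ξ
    rw [← ENNReal.orderIsoRpow_apply _ hPq, ENNReal.tsum_eq_iSup_sum, OrderIso.map_iSup]
    rfl
  simp_rw [hsup]
  rw [lintegral_iSup_directed]
  · refine iSup_le fun J => (hc J h hh).trans ?_
    gcongr with ξ
    exact ENNReal.sum_le_tsum J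
  · exact fun J => ((Finset.measurable_fun_sum _ fun i _ =>
      (hA.measurable i _ (hh i)).pow_const q).pow_const _).aemeasurable
  · refine Monotone.directed_le fun J J' hJ ξ => ENNReal.rpow_le_rpow ?_ hPq.le
    exact Finset.sum_le_sum_of_subset hJ

end IsAveragingFamily

end TriebelLizorkin

namespace TriebelLizorkin

/-! ### Averages over the levels of a filling -/

lemma rpow_lintegral_le {α : Type*} [MeasurableSpace α] (ν : Measure α) {q : ℝ} (hq : 1 < q)
    {h : α → ℝ≥0∞} (hh : AEMeasurable h ν) :
    (∫⁻ x, h x ∂ν) ^ q ≤ ν univ ^ (q - 1) * ∫⁻ x, h x ^ q ∂ν := by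
  have hq0 : 0 < q := by linarith
  have hq1 : q - 1 ≠ 0 := by linarith
  have := ENNReal.lintegral_mul_le_Lp_mul_Lq ν (Real.HolderConjugate.conjExponent hq)
      hh (g := fun _ => 1) measurable_const.aemeasurable
  simp only [Pi.mul_apply, mul_one, ENNReal.one_rpow, lintegral_one] at this
  refine (ENNReal.rpow_le_rpow this hq0.le).trans (le_of_eq ?_)
  rw [ENNReal.mul_rpow_of_nonneg _ _ hq0.le, ← ENNReal.rpow_mul, ← ENNReal.rpow_mul,
    one_div_mul_cancel hq0.ne', ENNReal.rpow_one, mul_comm]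
  congr 2
  rw [Real.conjExponent]
  field_simp

lemma rpow_average_le {α : Type*} [MeasurableSpace α] {μ : Measure α} {s : Set α}
    (h0 : μ s ≠ 0) (h1 : μ s ≠ ∞) {q : ℝ} (hq : 1 < q) {h : α → ℝ≥0∞} (hh : AEMeasurable h μ) :
    ((μ s)⁻¹ * ∫⁻ x in s, h x ∂μ) ^ q ≤ (μ s)⁻¹ * ∫⁻ x in s, h x ^ q ∂μ := by
  have hq0 : 0 < q := by linarith
  have := rpow_lintegral_le (μ.restrict s) hq hh.restrict
  rw [Measure.restrict_apply_univ] at this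
  rw [ENNReal.mul_rpow_of_nonneg _ _ hq0.le]
  calc _ ≤ (μ s)⁻¹ ^ q * (μ s ^ (q - 1) * ∫⁻ x in s, h x ^ q ∂μ) := by gcongr
    _ = _ := by
      rw [← mul_assoc, ENNReal.inv_rpow, ← ENNReal.rpow_neg, ← ENNReal.rpow_add _ _ h0 h1,
        show -q + (q - 1) = -1 by ring, ENNReal.rpow_neg_one]

variable {Z : Type*} [MetricSpace Z] [MeasurableSpace Z] {H : HyperbolicFilling Z} {μ : Measure Z}
  {Q : ℝ} {E : H.Vertex → Set Z} {C : ℝ≥0} {N : ℕ}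

open Classical in
/-- `∑_{x ∈ X_n} a(x) 1_{B(x)}` for sets `B(x)`. -/
noncomputable def levelSum (B : H.Vertex → Set Z) (n : ℕ) (a : H.Vertex → ℝ≥0∞) (ξ : Z) : ℝ≥0∞ :=
  ∑' x, if level x = n ∧ ξ ∈ B x then a x else 0

/-- The average of `h` over the set `E x`. -/
noncomputable def setAvg (μ : Measure Z) (E : H.Vertex → Set Z) (h : Z → ℝ≥0∞) (x : H.Vertex) :
    ℝ≥0∞ :=
  (μ (E x))⁻¹ * ∫⁻ η in E x, h η ∂μ

/-- The averaging operator of level `n`. -/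
noncomputable def levelAvg (μ : Measure Z) (E : H.Vertex → Set Z) (n : ℕ) (h : Z → ℝ≥0∞) (ξ : Z) :
    ℝ≥0∞ :=
  levelSum E n (setAvg μ E h) ξ

namespace FillingGeometry

lemma countable (hG : FillingGeometry H μ Q E C N) : Countable H.Vertex := by
  rw [← countable_univ_iff]
  have : (univ : Set H.Vertex) = ⋃ n : ℕ, {x : H.Vertex | level x = n} := by ext x; simp
  rw [this]
  exact countable_iUnion fun n => (hG.finite_level n).countable

lemma isFiniteMeasure (hG : FillingGeometry H μ Q E C N) : IsFiniteMeasure μ := ⟨hG.finite⟩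

lemma nonempty_ball (hG : FillingGeometry H μ Q E C N) (x : H.Vertex) : (ball x).Nonempty :=
  nonempty_of_measure_ne_zero (hG.pos x).ne'

lemma ball_subset (hG : FillingGeometry H μ Q E C N) (x : H.Vertex) : ball x ⊆ E x :=
  hG.subset x x (by omega) (by simpa using hG.nonempty_ball x)

lemma measure_E_ne_zero (hG : FillingGeometry H μ Q E C N) (x : H.Vertex) : μ (E x) ≠ 0 :=
  ((hG.pos x).trans_le (measure_mono (hG.ball_subset x))).ne'

lemma measure_ne_top (hG : FillingGeometry H μ Q E C N) (s : Set Z) : μ s ≠ ∞ :=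
  ((measure_mono (subset_univ s)).trans_lt hG.finite).ne

/-- Bounded overlap: at each point a level contributes at most N terms, and the set of vertices
involved does not depend on the coefficients. -/
lemma levelSum_eq_sum (hG : FillingGeometry H μ Q E C N) {B : H.Vertex → Set Z}
    (hB : ∀ x, B x ⊆ E x) (n : ℕ) (ξ : Z) :
    ∃ S : Finset H.Vertex, S.card ≤ N ∧ (∀ x, x ∈ S ↔ level x = n ∧ ξ ∈ B x) ∧
      ∀ a, levelSum B n a ξ = ∑ x ∈ S, a x := by
  classical
  refine ⟨(hG.finite_level n).toFinset.filter fun x => ξ ∈ B x, ?_, fun x => ?_, fun a => ?_⟩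
  · refine hG.overlap n ξ _ fun x hx => ?_
    rw [Finset.mem_filter, Finite.mem_toFinset] at hx
    exact ⟨hx.1, hB x hx.2⟩
  · rw [Finset.mem_filter, Finite.mem_toFinset]; rfl
  · rw [levelSum, tsum_eq_sum (s := (hG.finite_level n).toFinset.filter fun x => ξ ∈ B x)]
    · refine Finset.sum_congr rfl fun x hx => if_pos ?_
      rw [Finset.mem_filter, Finite.mem_toFinset] at hx
      exact hx
    · intro x hx
      rw [Finset.mem_filter, Finite.mem_toFinset] at hx
      exact if_neg hx

lemma measurable_levelSum (hG : FillingGeometry H μ Q E C N) {B : H.Vertex → Set Z}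
    (hB : ∀ x, MeasurableSet (B x)) (n : ℕ) (a : H.Vertex → ℝ≥0∞) :
    Measurable (levelSum B n a) := by
  classical
  have := hG.countable
  refine Measurable.tsum fun x => Measurable.ite ?_ measurable_const measurable_const
  by_cases h : level x = n
  · simpa [h] using hB x
  · simp [h]

lemma levelSum_rpow_le (hG : FillingGeometry H μ Q E C N) {B : H.Vertex → Set Z}
    (hB : ∀ x, B x ⊆ E x) (n : ℕ) (a : H.Vertex → ℝ≥0∞) (ξ : Z) {q : ℝ} (hq : 1 ≤ q) :
    levelSum B n a ξ ^ q ≤ (N : ℝ≥0∞) ^ (q - 1) * levelSum B n (fun x => a x ^ q) ξ := by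
  obtain ⟨S, hS, -, h⟩ := hG.levelSum_eq_sum hB n ξ
  rw [h, h]
  refine (ENNReal.rpow_sum_le_const_mul_sum_rpow S a hq).trans ?_
  gcongr

lemma setAvg_le_levelAvg {x : H.Vertex} {n : ℕ} {ξ : Z} (hx : level x = n) (hξ : ξ ∈ E x)
    (h : Z → ℝ≥0∞) : setAvg μ E h x ≤ levelAvg μ E n h ξ := by
  classical
  refine le_trans (le_of_eq ?_) (ENNReal.le_tsum x)
  rw [if_pos ⟨hx, hξ⟩]

lemma levelAvg_const_mul (E : H.Vertex → Set Z) (n : ℕ) {c : ℝ≥0∞} (hc : c ≠ ∞) (h : Z → ℝ≥0∞)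
    (ξ : Z) : levelAvg μ E n (fun η => c * h η) ξ = c * levelAvg μ E n h ξ := by
  simp only [levelAvg, levelSum]
  rw [← ENNReal.tsum_mul_left]
  congr 1
  ext x
  split_ifs
  · rw [setAvg, setAvg, lintegral_const_mul' _ _ hc]; ring
  · simp

lemma setAvg_le_maxFun {x : H.Vertex} {ξ : Z} (hξ : ξ ∈ E x) (φ : Z → ℝ≥0∞) :
    setAvg μ E φ x ≤ maxFun μ E φ ξ :=
  le_iSup_of_le x (by rw [indicator_of_mem hξ]; rfl)

lemma levelAvg_le_maxFun (hG : FillingGeometry H μ Q E C N) (n : ℕ) (φ : Z → ℝ≥0∞) (ξ : Z) :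
    levelAvg μ E n φ ξ ≤ N * maxFun μ E φ ξ := by
  obtain ⟨S, hS, hSm, h⟩ := hG.levelSum_eq_sum (fun _ => subset_rfl) n ξ
  rw [levelAvg, h]
  calc ∑ x ∈ S, setAvg μ E φ x ≤ ∑ x ∈ S, maxFun μ E φ ξ :=
        Finset.sum_le_sum fun x hx => setAvg_le_maxFun ((hSm x).1 hx).2 φ
    _ = S.card * maxFun μ E φ ξ := by simp
    _ ≤ _ := by gcongr

/-- Serves for self-adjointness: the right side is symmetric in h and φ. -/
lemma lintegral_levelAvg_mul (hG : FillingGeometry H μ Q E C N) (n : ℕ) (h : Z → ℝ≥0∞)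
    {φ : Z → ℝ≥0∞} (hφ : Measurable φ) :
    ∫⁻ ξ, levelAvg μ E n h ξ * φ ξ ∂μ
      = ∑' x, {x : H.Vertex | level x = n}.indicator
        (fun x => (μ (E x))⁻¹ * ((∫⁻ η in E x, h η ∂μ) * ∫⁻ η in E x, φ η ∂μ)) x := by
  classical
  have := hG.countable
  simp only [levelAvg, levelSum, ← ENNReal.tsum_mul_right]
  rw [lintegral_tsum]
  · congr 1
    ext x
    by_cases hx : level x = n
    · rw [indicator_of_mem (by exact hx)]
      have : ∀ ξ, (if level x = n ∧ ξ ∈ E x then setAvg μ E h x else 0) * φ ξ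
          = (E x).indicator (fun ξ => setAvg μ E h x * φ ξ) ξ := by
        intro ξ
        by_cases hξ : ξ ∈ E x <;> simp [hx, hξ]
      simp_rw [this]
      rw [lintegral_indicator (hG.measurable x), lintegral_const_mul _ hφ, setAvg]
      ring
    · rw [indicator_of_notMem (by exact hx)]
      simp [hx]
  · intro x
    refine Measurable.aemeasurable (Measurable.mul ?_ hφ)
    refine Measurable.ite ?_ measurable_const measurable_const
    by_cases h : level x = n
    · simpa [h] using hG.measurable x
    · simp [h]

/-- The operator has the symmetric kernel ∑ 1_{E x}(ξ) 1_{E x}(η)/μ(E x), the sum being over one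
level; bounded overlap gives the remaining estimates. The map l allows the same level to occur for
several indices, as is needed when pairs of levels serve as indices. -/
lemma isAveragingFamily (hG : FillingGeometry H μ Q E C N) {I : Type*} (l : I → ℕ) :
    IsAveragingFamily μ fun i => levelAvg μ E (l i) where
  measurable i h _ := hG.measurable_levelSum hG.measurable _ _
  symm i h φ hh hφ := by
    simp_rw [mul_comm (h _)]
    rw [hG.lintegral_levelAvg_mul _ _ hφ, hG.lintegral_levelAvg_mul _ _ hh]
    congr 1
    ext x
    congr 1
    ext x
    ring
  jensen q hq := by
    refine ⟨(N : ℝ≥0) ^ (q - 1), fun i h hh ξ => ?_⟩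
    rw [ENNReal.coe_rpow_of_nonneg _ (by linarith), ENNReal.coe_natCast]
    refine (hG.levelSum_rpow_le (fun _ => subset_rfl) _ _ ξ hq.le).trans ?_
    gcongr
    refine ENNReal.tsum_le_tsum fun x => ?_
    split_ifs
    · exact rpow_average_le (hG.measure_E_ne_zero x) (hG.measure_ne_top _) hq hh.aemeasurable
    · exact le_rfl
  maximal t ht := by
    have := hG.countable
    obtain ⟨A, hA⟩ := hG.maximal t ht
    refine ⟨(N : ℝ≥0) ^ t * A, fun φ hφ => ⟨fun ξ => N * maxFun μ E φ ξ,
      (measurable_maxFun hG.measurable φ).const_mul _, fun i ξ => hG.levelAvg_le_maxFun _ φ ξ, ?_⟩⟩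
    simp_rw [ENNReal.mul_rpow_of_nonneg _ _ (by linarith : 0 ≤ t)]
    rw [lintegral_const_mul' _ _ (ENNReal.rpow_ne_top_of_nonneg (by linarith) (by simp)),
      ENNReal.coe_mul, ENNReal.coe_rpow_of_nonneg _ (by linarith), ENNReal.coe_natCast, mul_assoc]
    gcongr
    exact hA φ hφ
  one := by
    refine ⟨N, fun i ξ => ?_⟩
    refine (hG.levelAvg_le_maxFun _ _ ξ).trans ?_
    rw [ENNReal.coe_natCast]
    refine mul_le_of_le_one_right' (iSup_le fun x => (indicator_le_self _ _ _).trans ?_)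
    simp only [lintegral_one, Measure.restrict_apply_univ]
    exact (ENNReal.inv_mul_cancel (hG.measure_E_ne_zero x) (hG.measure_ne_top _)).le

end FillingGeometry

end TriebelLizorkin

namespace TriebelLizorkin

/-! ### The summation operator over finer levels is bounded -/

section Sums

lemma ENNReal_rpow_tsum_le {ι : Type*} {r : ℝ} (hr : 0 < r) (hr1 : r ≤ 1) (a : ι → ℝ≥0∞) :
    (∑' i, a i) ^ r ≤ ∑' i, a i ^ r := by
  rw [← ENNReal.orderIsoRpow_apply _ hr, ENNReal.tsum_eq_iSup_sum, OrderIso.map_iSup]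
  refine iSup_le fun J => ?_
  refine le_trans ?_ (ENNReal.sum_le_tsum J)
  rw [ENNReal.orderIsoRpow_apply]
  induction J using Finset.cons_induction with
  | empty => simp [hr]
  | cons b s hb ih =>
    rw [Finset.sum_cons, Finset.sum_cons]
    exact (ENNReal.rpow_add_le_add_rpow _ _ hr.le hr1).trans (add_le_add le_rfl ih)

/-- Hölder's inequality for the weights w; it lets a sum with summable weights be pulled out of a
power. -/
lemma ENNReal_rpow_tsum_mul_le {ι : Type*} {q : ℝ} (hq : 1 ≤ q) (w a : ι → ℝ≥0∞) :
    (∑' i, w i * a i) ^ q ≤ (∑' i, w i) ^ (q - 1) * ∑' i, w i * a i ^ q := by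
  have hq0 : 0 < q := by linarith
  rw [← ENNReal.orderIsoRpow_apply _ hq0, ENNReal.tsum_eq_iSup_sum, OrderIso.map_iSup]
  refine iSup_le fun J => ?_
  rw [ENNReal.orderIsoRpow_apply]
  refine (ENNReal.rpow_le_rpow (ENNReal.inner_le_weight_mul_Lp_of_nonneg J hq w a) hq0.le).trans ?_
  rw [ENNReal.mul_rpow_of_nonneg _ _ hq0.le, ← ENNReal.rpow_mul, ← ENNReal.rpow_mul,
    inv_mul_cancel₀ hq0.ne', ENNReal.rpow_one, sub_mul, one_mul, inv_mul_cancel₀ hq0.ne']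
  gcongr
  · exact ENNReal.sum_le_tsum J
  · exact ENNReal.sum_le_tsum J

open Classical in
lemma ENNReal_tsum_ite_le {ι : Type*} {p : ι → Prop} (hp : ∀ i j, p i → p j → i = j) (d : ℝ≥0∞) :
    ∑' i, (if p i then d else 0) ≤ d := by
  by_cases h : ∃ i, p i
  · obtain ⟨i, hi⟩ := h
    rw [tsum_eq_single i fun j hj => if_neg fun hj' => hj (hp _ _ hj' hi), if_pos hi]
  · push Not at h
    simp [h]

/-- The weight `2^{-ε(m-n)}` for `m ≥ n - 1`. -/
noncomputable def decayWeight (ε : ℝ) (n m : ℕ) : ℝ≥0∞ :=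
  if n ≤ m + 1 then ENNReal.ofReal (2 ^ (((n : ℝ) - m) * ε)) else 0

lemma decayWeight_eq (ε : ℝ) (n m : ℕ) : decayWeight ε n m
    = ∑' k : ℕ, if m + 1 = n + k then ENNReal.ofReal (2 ^ ((1 - (k : ℝ)) * ε)) else 0 := by
  unfold decayWeight
  split_ifs with h
  · obtain ⟨k, hk⟩ := Nat.exists_eq_add_of_le h
    rw [tsum_eq_single k fun j hj => if_neg (by omega), if_pos hk]
    congr 3
    have : (m : ℝ) + 1 = n + k := by exact_mod_cast hk
    linarith
  · symm
    rw [ENNReal.tsum_eq_zero]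
    exact fun k => if_neg (by omega)

/-- A Schur-type condition: since the weight depends only on k = m + 1 - n ≥ 0, its row sums and its
column sums are both bounded by one geometric series. -/
lemma tsum_decayWeight_lt_top {ε : ℝ} (hε : 0 < ε) :
    ∃ c : ℝ≥0, (∀ n, ∑' m, decayWeight ε n m ≤ c) ∧ ∀ m, ∑' n, decayWeight ε n m ≤ c := by
  set d : ℕ → ℝ≥0∞ := fun k => ENNReal.ofReal (2 ^ ((1 - (k : ℝ)) * ε)) with hd
  have hr : (2 : ℝ) ^ (-ε) < 1 := Real.rpow_lt_one_of_one_lt_of_neg (by norm_num) (by linarith)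
  have hsum : Summable fun k : ℕ => (2 : ℝ) ^ ((1 - (k : ℝ)) * ε) := by
    have h1 : ∀ k : ℕ, (2 : ℝ) ^ ((1 - (k : ℝ)) * ε) = 2 ^ ε * (2 ^ (-ε)) ^ k := by
      intro k
      rw [← Real.rpow_natCast, ← Real.rpow_mul (by norm_num), ← Real.rpow_add (by norm_num)]
      congr 1; ring
    simp_rw [h1]
    exact (summable_geometric_of_lt_one (by positivity) hr).mul_left _
  have hdtop : ∑' k, d k ≠ ∞ := by
    rw [← ENNReal.ofReal_tsum_of_nonneg (fun k => by positivity) hsum]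
    exact ENNReal.ofReal_ne_top
  refine ⟨(∑' k, d k).toNNReal, fun n => ?_, fun m => ?_⟩ <;> rw [ENNReal.coe_toNNReal hdtop] <;>
    simp_rw [decayWeight_eq] <;> rw [ENNReal.tsum_comm] <;>
    refine ENNReal.tsum_le_tsum fun k => ?_
  · convert ENNReal_tsum_ite_le (p := fun m => m + 1 = n + k) (fun i j hi hj => by omega) (d k)
  · convert ENNReal_tsum_ite_le (p := fun n => m + 1 = n + k) (fun i j hi hj => by omega) (d k)

end Sums

variable {Z : Type*} [MetricSpace Z] [MeasurableSpace Z] {H : HyperbolicFilling Z} {μ : Measure Z}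
  {Q : ℝ} {E : H.Vertex → Set Z} {C : ℝ≥0} {N : ℕ}

/-- `y` is at most one level above `x` and their balls meet. -/
def IsFiner (x y : H.Vertex) : Prop := level x ≤ level y + 1 ∧ (ball x ∩ ball y).Nonempty

open Classical in
/-- `∑ μ(B(y)) / μ(B(x)) g(y)`, with the sum over all `y` on the levels from `|x| - 1` for which
`B(y)` meets `B(x)`. -/
noncomputable def upSum (μ : Measure Z) (g : H.Vertex → ℝ≥0∞) (x : H.Vertex) : ℝ≥0∞ :=
  ∑' y, if IsFiner x y then (μ (ball x))⁻¹ * μ (ball y) * g y else 0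

/-- `2^{|x|s}`. -/
noncomputable def levelWeight (s : ℝ) (x : H.Vertex) : ℝ≥0∞ :=
  ENNReal.ofReal ((2 : ℝ) ^ ((level x : ℝ) * s))

namespace FillingGeometry

/-- The place where the threshold Q/(Q+s) appears. Since μ(B(x)) ≤ C 2^{(|y|-|x|)Q} μ(B(y)),
replacing the r-th power of the volume ratio by the ratio costs 2^{(|y|-|x|)Q(1-r)}; passing from
the weight of x to that of y gains 2^{-(|y|-|x|)sr}. Altogether the exponent is -(|y|-|x|)((Q+s)r -
Q). -/
lemma weight_rpow_le (hG : FillingGeometry H μ Q E C N) {s r : ℝ} (hr : 0 < r) (hr1 : r ≤ 1)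
    {x y : H.Vertex} (hxy : IsFiner x y) (a : ℝ≥0∞) :
    (levelWeight s x * ((μ (ball x))⁻¹ * μ (ball y) * a)) ^ r
      ≤ (C : ℝ≥0∞) ^ (1 - r) * (decayWeight ((Q + s) * r - Q) (level x) (level y)
          * ((μ (ball x))⁻¹ * (μ (ball y) * (levelWeight s y * a) ^ r))) := by
  have hx0 := (hG.pos x).ne'
  have hx1 := hG.measure_ne_top (ball x)
  have hy0 := (hG.pos y).ne'
  have hy1 := hG.measure_ne_top (ball y)
  set m := μ (ball x)
  set m' := μ (ball y)
  set D := ENNReal.ofReal (2 ^ (((level y : ℝ) - level x) * Q)) with hD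
  have hcmp : m ≤ C * D * m' := hG.compare x y hxy.1 hxy.2
  have h1 : m ^ (1 - r) ≤ (C : ℝ≥0∞) ^ (1 - r) * D ^ (1 - r) * m' ^ (1 - r) := by
    rw [← ENNReal.mul_rpow_of_nonneg _ _ (by linarith), ← ENNReal.mul_rpow_of_nonneg _ _
      (by linarith)]
    exact ENNReal.rpow_le_rpow hcmp (by linarith)
  have h2 : (m⁻¹ * m') ^ r ≤ (C : ℝ≥0∞) ^ (1 - r) * D ^ (1 - r) * (m⁻¹ * m') := by
    rw [ENNReal.mul_rpow_of_nonneg _ _ hr.le, ENNReal.inv_rpow, ← ENNReal.rpow_neg]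
    have e1 : m ^ (-r) = m⁻¹ * m ^ (1 - r) := by
      rw [← ENNReal.rpow_neg_one, ← ENNReal.rpow_add _ _ hx0 hx1]; congr 1; ring
    have e2 : m' = m' ^ (1 - r) * m' ^ r := by
      rw [← ENNReal.rpow_add _ _ hy0 hy1]; simp
    rw [e1]
    calc m⁻¹ * m ^ (1 - r) * m' ^ r
        ≤ m⁻¹ * ((C : ℝ≥0∞) ^ (1 - r) * D ^ (1 - r) * m' ^ (1 - r)) * m' ^ r := by gcongr
      _ = (C : ℝ≥0∞) ^ (1 - r) * D ^ (1 - r) * (m⁻¹ * (m' ^ (1 - r) * m' ^ r)) := by ring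
      _ = _ := by rw [← e2]
  have h3 : levelWeight s x ^ r * D ^ (1 - r)
      = decayWeight ((Q + s) * r - Q) (level x) (level y) * levelWeight s y ^ r := by
    rw [decayWeight, if_pos hxy.1, levelWeight, levelWeight, hD,
      ENNReal.ofReal_rpow_of_pos (by positivity), ENNReal.ofReal_rpow_of_pos (by positivity),
      ENNReal.ofReal_rpow_of_pos (by positivity), ← ENNReal.ofReal_mul (by positivity),
      ← ENNReal.ofReal_mul (by positivity), ← Real.rpow_mul (by norm_num),
      ← Real.rpow_mul (by norm_num), ← Real.rpow_mul (by norm_num), ← Real.rpow_add (by norm_num),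
      ← Real.rpow_add (by norm_num)]
    congr 2
    ring
  rw [ENNReal.mul_rpow_of_nonneg _ _ hr.le, ENNReal.mul_rpow_of_nonneg _ _ hr.le,
    ENNReal.mul_rpow_of_nonneg (levelWeight s y) _ hr.le]
  calc levelWeight s x ^ r * ((m⁻¹ * m') ^ r * a ^ r)
      ≤ levelWeight s x ^ r * ((C : ℝ≥0∞) ^ (1 - r) * D ^ (1 - r) * (m⁻¹ * m') * a ^ r) := by
        gcongr
    _ = (C : ℝ≥0∞) ^ (1 - r) * ((levelWeight s x ^ r * D ^ (1 - r)) * (m⁻¹ * (m' * a ^ r))) := by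
        ring
    _ = _ := by rw [h3]; ring

open Classical in
-- All the balls B(y) in question lie in E x, so the weighted sum is at most an integral of the
-- level sum over E x, and μ(E x) is comparable to μ(B(x)).
lemma sum_finer_level_le (hG : FillingGeometry H μ Q E C N) [OpensMeasurableSpace Z]
    (x : H.Vertex) (m : ℕ) (a : H.Vertex → ℝ≥0∞) :
    ∑' y, (if IsFiner x y ∧ level y = m then (μ (ball x))⁻¹ * (μ (ball y) * a y) else 0)
      ≤ C * setAvg μ E (levelSum ball m a) x := by
  have := hG.countable
  have h1 : (μ (ball x))⁻¹ ≤ C * (μ (E x))⁻¹ := by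
    have h0 := (hG.pos x).ne'
    have h2 := hG.dilate x
    rw [← div_eq_mul_inv, ENNReal.le_div_iff_mul_le (Or.inl (hG.measure_E_ne_zero x))
      (Or.inl (hG.measure_ne_top _)), mul_comm, ← div_eq_mul_inv]
    exact ENNReal.div_le_of_le_mul h2
  have h2 : ∑' y, (if IsFiner x y ∧ level y = m then (μ (ball y) * a y) else 0)
      ≤ ∫⁻ η in E x, levelSum ball m a η ∂μ := by
    simp only [levelSum]
    rw [lintegral_tsum]
    · refine ENNReal.tsum_le_tsum fun y => ?_
      split_ifs with h
      · have hsub := hG.subset x y h.1.1 h.1.2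
        simp only [h.2, true_and]
        calc μ (ball y) * a y = ∫⁻ η in E x, (ball y).indicator (fun _ => a y) η ∂μ := by
              rw [lintegral_indicator (isOpen_ball y).measurableSet,
                Measure.restrict_restrict (isOpen_ball y).measurableSet,
                inter_eq_self_of_subset_left hsub, setLIntegral_const, mul_comm]
          _ ≤ _ := lintegral_mono fun η => by
              by_cases hη : η ∈ ball y <;> simp [hη]
      · exact zero_le
    · intro y
      refine (Measurable.ite ?_ measurable_const measurable_const).aemeasurable
      by_cases h : level y = m
      · simpa [h] using (isOpen_ball y).measurableSet
      · simp [h]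
  calc ∑' y, (if IsFiner x y ∧ level y = m then (μ (ball x))⁻¹ * (μ (ball y) * a y) else 0)
      = (μ (ball x))⁻¹ * ∑' y, (if IsFiner x y ∧ level y = m then (μ (ball y) * a y) else 0) := by
        rw [← ENNReal.tsum_mul_left]
        congr 1; ext y; split_ifs <;> simp
    _ ≤ C * (μ (E x))⁻¹ * ∫⁻ η in E x, levelSum ball m a η ∂μ := by gcongr
    _ = _ := by rw [setAvg, mul_assoc]

/-- As r ≤ 1, the power passes inside the sum; grouping by levels turns `upSum` into averages over E
x with the decay weights as coefficients. -/
lemma upSum_rpow_le (hG : FillingGeometry H μ Q E C N) [OpensMeasurableSpace Z]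
    {s r : ℝ} (hr : 0 < r) (hr1 : r ≤ 1) (g : H.Vertex → ℝ≥0∞) (x : H.Vertex) :
    (levelWeight s x * upSum μ g x) ^ r ≤ (C : ℝ≥0∞) ^ (1 - r) * C *
      ∑' m, decayWeight ((Q + s) * r - Q) (level x) m
        * setAvg μ E (levelSum ball m fun y => (levelWeight s y * g y) ^ r) x := by
  classical
  set ε := (Q + s) * r - Q
  rw [upSum, ← ENNReal.tsum_mul_left]
  refine (ENNReal_rpow_tsum_le hr hr1 _).trans ?_
  calc ∑' y, (levelWeight s x * if IsFiner x y then (μ (ball x))⁻¹ * μ (ball y) * g y else 0) ^ r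
      ≤ ∑' y, ∑' m, (C : ℝ≥0∞) ^ (1 - r) * (decayWeight ε (level x) m *
          if IsFiner x y ∧ level y = m then (μ (ball x))⁻¹ * (μ (ball y) *
            (levelWeight s y * g y) ^ r) else 0) := by
        refine ENNReal.tsum_le_tsum fun y => ?_
        by_cases h : IsFiner x y
        · rw [if_pos h]
          refine (hG.weight_rpow_le hr hr1 h _).trans (le_trans ?_ (ENNReal.le_tsum (level y)))
          rw [if_pos ⟨h, rfl⟩]
        · simp [h, hr]
    _ = ∑' m, (C : ℝ≥0∞) ^ (1 - r) * (decayWeight ε (level x) m * ∑' y,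
          if IsFiner x y ∧ level y = m then (μ (ball x))⁻¹ * (μ (ball y) *
            (levelWeight s y * g y) ^ r) else 0) := by
        rw [ENNReal.tsum_comm]
        simp_rw [ENNReal.tsum_mul_left]
    _ ≤ ∑' m, (C : ℝ≥0∞) ^ (1 - r) * (decayWeight ε (level x) m *
          (C * setAvg μ E (levelSum ball m fun y => (levelWeight s y * g y) ^ r) x)) := by
        gcongr with m
        exact hG.sum_finer_level_le x m _
    _ = _ := by
        rw [← ENNReal.tsum_mul_left]
        congr 1; ext m; ring

open Classical in
lemma tsum_cone (ξ : Z) (a : H.Vertex → ℝ≥0∞) :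
    ∑' x : H.cone ξ, a x = ∑' n, levelSum ball n a ξ := by
  simp only [levelSum]
  rw [ENNReal.tsum_comm, tsum_subtype (H.cone ξ) a]
  congr 1
  ext x
  rw [tsum_eq_single (level x) fun n hn => if_neg fun h => hn h.1.symm]
  by_cases h : ξ ∈ ball x
  · rw [indicator_of_mem (by exact h), if_pos ⟨rfl, h⟩]
  · rw [indicator_of_notMem (by exact h), if_neg fun h' => h h'.2]

/-- Boundedness of `upSum` for finite `q`. -/
lemma jNorm_upSum_le_of_ne_top (hG : FillingGeometry H μ Q E C N) [OpensMeasurableSpace Z]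
    {s r p q : ℝ} (hr : 0 < r) (hr1 : r ≤ 1) (hrp : r < p) (hrq : r < q)
    (hε : 0 < (Q + s) * r - Q) :
    ∃ K : ℝ≥0∞, K ≠ ∞ ∧ ∀ g : H.Vertex → ℝ≥0∞,
      ∫⁻ ξ, (∑' x : H.cone ξ, (levelWeight s x.1 * upSum μ g x.1) ^ q) ^ (p / q) ∂μ
        ≤ K * ∫⁻ ξ, (∑' x : H.cone ξ, (levelWeight s x.1 * g x.1) ^ q) ^ (p / q) ∂μ := by
  have hp : 0 < p := hr.trans hrp
  have hq : 0 < q := hr.trans hrq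
  have hpq : 0 < p / q := div_pos hp hq
  set ε := (Q + s) * r - Q with hεdef
  obtain ⟨c₀, hc₀, hc₀'⟩ := tsum_decayWeight_lt_top hε
  -- Dividing the exponents by r puts q/r and p/r in the range of the vector-valued inequality. It
  -- is applied with pairs (n, m) as indices: n is the level of x, m that of y.
  set q' := q / r with hq'
  have hq'1 : 1 < q' := (one_lt_div hr).2 hrq
  have hP1 : 1 < p / r := (one_lt_div hr).2 hrp
  obtain ⟨c₁, hc₁⟩ := (hG.isAveragingFamily fun i : ℕ × ℕ => i.1).vector_valued hq'1 hP1
  have hexp : p / r / q' = p / q := by rw [hq']; field_simp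
  rw [hexp] at hc₁
  set K₁ : ℝ≥0∞ := ((C : ℝ≥0∞) ^ (1 - r) * C) ^ q' * N * (c₀ : ℝ≥0∞) ^ (q' - 1) with hK₁
  set K₂ : ℝ≥0∞ := c₀ * (N : ℝ≥0∞) ^ (q' - 1) with hK₂
  have hK₁t : K₁ ≠ ∞ := by
    refine ENNReal.mul_ne_top (ENNReal.mul_ne_top ?_ (by simp)) ?_
    · exact ENNReal.rpow_ne_top_of_nonneg (by linarith) (ENNReal.mul_ne_top
        (ENNReal.rpow_ne_top_of_nonneg (by linarith) (by simp)) (by simp))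
    · exact ENNReal.rpow_ne_top_of_nonneg (by linarith) (by simp)
  have hK₂t : K₂ ≠ ∞ :=
    ENNReal.mul_ne_top (by simp) (ENNReal.rpow_ne_top_of_nonneg (by linarith) (by simp))
  have hKp : ∀ K : ℝ≥0∞, K ≠ ∞ → K ^ (p / q) ≠ ∞ := fun K h =>
    ENNReal.rpow_ne_top_of_nonneg hpq.le h
  refine ⟨K₁ ^ (p / q) * (c₁ * K₂ ^ (p / q)), ENNReal.mul_ne_top (hKp _ hK₁t)
    (ENNReal.mul_ne_top (by simp) (hKp _ hK₂t)), fun g => ?_⟩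
  set G : H.Vertex → ℝ≥0∞ := fun y => (levelWeight s y * g y) ^ r with hGdef
  set w : ℕ × ℕ → ℝ≥0∞ := fun i => decayWeight ε i.1 i.2 with hw
  have hwt : ∀ i, w i ≠ ∞ := by
    intro i
    exact ne_top_of_le_ne_top (by simp) ((ENNReal.le_tsum i.2).trans (hc₀ i.1))
  have hwt' : ∀ i, w i ^ (1 / q') ≠ ∞ := fun i =>
    ENNReal.rpow_ne_top_of_nonneg (by positivity) (hwt i)
  -- The weighted Hölder inequality leaves w times a q'-th power, so each function absorbs the
  -- factor w^{1/q'}. Row sums of w are spent on the left below, column sums on the right.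
  set h : ℕ × ℕ → Z → ℝ≥0∞ := fun i η => w i ^ (1 / q') * levelSum ball i.2 G η with hh
  have hhm : ∀ i, Measurable (h i) := fun i =>
    (hG.measurable_levelSum (fun x => (isOpen_ball x).measurableSet) _ _).const_mul _
  have hwq : ∀ i, (w i ^ (1 / q')) ^ q' = w i := by
    intro i
    rw [← ENNReal.rpow_mul, one_div_mul_cancel (by positivity), ENNReal.rpow_one]
  have hleft : ∀ ξ, ∑' x : H.cone ξ, (levelWeight s x.1 * upSum μ g x.1) ^ q
      ≤ K₁ * ∑' i, levelAvg μ E i.1 (h i) ξ ^ q' := by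
    intro ξ
    rw [tsum_cone ξ fun x => (levelWeight s x * upSum μ g x) ^ q, ENNReal.tsum_prod',
      ← ENNReal.tsum_mul_left]
    refine ENNReal.tsum_le_tsum fun n => ?_
    obtain ⟨S, hS, hSm, hSe⟩ := hG.levelSum_eq_sum hG.ball_subset n ξ
    rw [hSe]
    have hterm : ∀ x ∈ S, (levelWeight s x * upSum μ g x) ^ q
        ≤ ((C : ℝ≥0∞) ^ (1 - r) * C) ^ q' * ((c₀ : ℝ≥0∞) ^ (q' - 1) *
          ∑' m, levelAvg μ E n (h (n, m)) ξ ^ q') := by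
      intro x hx
      obtain ⟨hxn, hξ⟩ := (hSm x).1 hx
      calc (levelWeight s x * upSum μ g x) ^ q = ((levelWeight s x * upSum μ g x) ^ r) ^ q' := by
            rw [← ENNReal.rpow_mul, hq', mul_div_cancel₀ _ hr.ne']
        _ ≤ ((C : ℝ≥0∞) ^ (1 - r) * C *
              ∑' m, decayWeight ε n m * levelAvg μ E n (levelSum ball m G) ξ) ^ q' := by
            refine ENNReal.rpow_le_rpow ((hG.upSum_rpow_le hr hr1 g x).trans ?_) (by linarith)
            rw [hxn]
            gcongr with m
            exact setAvg_le_levelAvg hxn (hG.ball_subset x hξ) _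
        _ ≤ _ := by
            rw [ENNReal.mul_rpow_of_nonneg _ _ (by linarith)]
            gcongr
            refine (ENNReal_rpow_tsum_mul_le hq'1.le _ _).trans ?_
            gcongr with m
            · exact hc₀ n
            · rw [hh]
              simp only
              rw [levelAvg_const_mul _ _ (hwt' _), ENNReal.mul_rpow_of_nonneg _ _ (by linarith),
                hwq]
    calc ∑ x ∈ S, (levelWeight s x * upSum μ g x) ^ q
        ≤ ∑ x ∈ S, ((C : ℝ≥0∞) ^ (1 - r) * C) ^ q' * ((c₀ : ℝ≥0∞) ^ (q' - 1) *
          ∑' m, levelAvg μ E n (h (n, m)) ξ ^ q') := Finset.sum_le_sum hterm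
      _ = S.card * (((C : ℝ≥0∞) ^ (1 - r) * C) ^ q' * ((c₀ : ℝ≥0∞) ^ (q' - 1) *
          ∑' m, levelAvg μ E n (h (n, m)) ξ ^ q')) := by simp
      _ ≤ N * (((C : ℝ≥0∞) ^ (1 - r) * C) ^ q' * ((c₀ : ℝ≥0∞) ^ (q' - 1) *
          ∑' m, levelAvg μ E n (h (n, m)) ξ ^ q')) := by gcongr
      _ = _ := by rw [hK₁]; ring
  have hright : ∀ ξ, ∑' i, h i ξ ^ q'
      ≤ K₂ * ∑' x : H.cone ξ, (levelWeight s x.1 * g x.1) ^ q := by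
    intro ξ
    rw [tsum_cone ξ fun x => (levelWeight s x * g x) ^ q, ENNReal.tsum_prod', ENNReal.tsum_comm,
      ← ENNReal.tsum_mul_left]
    refine ENNReal.tsum_le_tsum fun m => ?_
    have e1 : ∀ n, h (n, m) ξ ^ q' = w (n, m) * levelSum ball m G ξ ^ q' := by
      intro n
      rw [hh]
      simp only
      rw [ENNReal.mul_rpow_of_nonneg _ _ (by linarith), hwq]
    simp_rw [e1]
    rw [ENNReal.tsum_mul_right, hK₂, mul_assoc]
    gcongr
    · exact hc₀' m
    · refine (hG.levelSum_rpow_le hG.ball_subset m G ξ hq'1.le).trans (le_of_eq ?_)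
      congr 2
      ext x
      rw [hGdef, ← ENNReal.rpow_mul, hq', mul_div_cancel₀ _ hr.ne']
  calc ∫⁻ ξ, (∑' x : H.cone ξ, (levelWeight s x.1 * upSum μ g x.1) ^ q) ^ (p / q) ∂μ
      ≤ ∫⁻ ξ, K₁ ^ (p / q) * (∑' i, levelAvg μ E i.1 (h i) ξ ^ q') ^ (p / q) ∂μ := by
        refine lintegral_mono fun ξ => ?_
        rw [← ENNReal.mul_rpow_of_nonneg _ _ hpq.le]
        exact ENNReal.rpow_le_rpow (hleft ξ) hpq.le
    _ = K₁ ^ (p / q) * ∫⁻ ξ, (∑' i, levelAvg μ E i.1 (h i) ξ ^ q') ^ (p / q) ∂μ :=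
        lintegral_const_mul' _ _ (hKp _ hK₁t)
    _ ≤ K₁ ^ (p / q) * (c₁ * ∫⁻ ξ, (∑' i, h i ξ ^ q') ^ (p / q) ∂μ) := by
        gcongr
        exact hc₁ h hhm
    _ ≤ K₁ ^ (p / q) * (c₁ * ∫⁻ ξ, K₂ ^ (p / q) *
          (∑' x : H.cone ξ, (levelWeight s x.1 * g x.1) ^ q) ^ (p / q) ∂μ) := by
        gcongr with ξ
        rw [← ENNReal.mul_rpow_of_nonneg _ _ hpq.le]
        exact ENNReal.rpow_le_rpow (hright ξ) hpq.le
    _ = _ := by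
        rw [lintegral_const_mul' _ _ (hKp _ hK₂t)]
        ring

/-- Boundedness of `upSum` for `q = ∞`. -/
lemma jNorm_upSum_le_of_eq_top (hG : FillingGeometry H μ Q E C N) [BorelSpace Z]
    {s r p : ℝ} (hr : 0 < r) (hr1 : r ≤ 1) (hrp : r < p) (hε : 0 < (Q + s) * r - Q) :
    ∃ K : ℝ≥0∞, K ≠ ∞ ∧ ∀ g : H.Vertex → ℝ≥0∞,
      ∫⁻ ξ, (⨆ x : H.cone ξ, levelWeight s x.1 * upSum μ g x.1) ^ p ∂μ
        ≤ K * ∫⁻ ξ, (⨆ x : H.cone ξ, levelWeight s x.1 * g x.1) ^ p ∂μ := by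
  have hp : 0 < p := hr.trans hrp
  set ε := (Q + s) * r - Q with hεdef
  obtain ⟨c₀, hc₀, -⟩ := tsum_decayWeight_lt_top hε
  have hP1 : 1 < p / r := (one_lt_div hr).2 hrp
  have hP0 : 0 < p / r := by linarith
  obtain ⟨c₁, hc₁⟩ := hG.maximal _ hP1
  set K₁ : ℝ≥0∞ := (C : ℝ≥0∞) ^ (1 - r) * C * c₀ with hK₁
  have hK₁t : K₁ ≠ ∞ := ENNReal.mul_ne_top (ENNReal.mul_ne_top
        (ENNReal.rpow_ne_top_of_nonneg (by linarith) (by simp)) (by simp)) (by simp)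
  have hKp : ∀ K : ℝ≥0∞, K ≠ ∞ → K ^ (p / r) ≠ ∞ := fun K h =>
    ENNReal.rpow_ne_top_of_nonneg hP0.le h
  refine ⟨K₁ ^ (p / r) * (c₁ * (N : ℝ≥0∞) ^ (p / r)), ENNReal.mul_ne_top (hKp _ hK₁t)
    (ENNReal.mul_ne_top (by simp) (hKp _ (by simp))), fun g => ?_⟩
  set V : Z → ℝ≥0∞ := fun ξ => ⨆ x : H.cone ξ, levelWeight s x.1 * g x.1 with hV
  have hVm : Measurable V := by
    have := measurable_ellq_cone (q := ∞) (by simp) (fun x : H.Vertex => levelWeight s x * g x)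
    simpa [ellq] using this
  -- One function dominates the sums over all levels at once, by bounded overlap, so the scalar
  -- maximal inequality suffices.
  set φ : Z → ℝ≥0∞ := fun ξ => N * V ξ ^ r with hφ
  have hφm : Measurable φ := (hVm.pow_const r).const_mul _
  have hlev : ∀ m ξ, levelSum ball m (fun y => (levelWeight s y * g y) ^ r) ξ ≤ φ ξ := by
    intro m ξ
    obtain ⟨S, hS, hSm, hSe⟩ := hG.levelSum_eq_sum hG.ball_subset m ξ
    rw [hSe]
    calc _ ≤ ∑ x ∈ S, V ξ ^ r := by
          refine Finset.sum_le_sum fun x hx => ENNReal.rpow_le_rpow ?_ hr.le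
          exact le_iSup (fun x : H.cone ξ => levelWeight s x.1 * g x.1) ⟨x, ((hSm x).1 hx).2⟩
      _ = S.card * V ξ ^ r := by simp
      _ ≤ _ := mul_le_mul_left (by exact_mod_cast hS) _
  have hleft : ∀ ξ, (⨆ x : H.cone ξ, levelWeight s x.1 * upSum μ g x.1) ^ r
      ≤ K₁ * maxFun μ E φ ξ := by
    intro ξ
    rw [← ENNReal.orderIsoRpow_apply _ hr, OrderIso.map_iSup]
    refine iSup_le fun x => ?_
    rw [ENNReal.orderIsoRpow_apply]
    refine (hG.upSum_rpow_le hr hr1 g x.1).trans ?_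
    rw [hK₁, mul_assoc (_ * _) (c₀ : ℝ≥0∞)]
    gcongr
    refine le_trans (ENNReal.tsum_le_tsum fun m => mul_le_mul_right (?_ :
      _ ≤ maxFun μ E φ ξ) _) ?_
    · refine le_trans ?_ (setAvg_le_maxFun (hG.ball_subset x.1 x.2) φ)
      unfold setAvg
      gcongr with η
      exact hlev m η
    · rw [ENNReal.tsum_mul_right]
      gcongr
      exact hc₀ _
  have hpow : ∀ a : ℝ≥0∞, a ^ p = (a ^ r) ^ (p / r) := by
    intro a
    rw [← ENNReal.rpow_mul, mul_div_cancel₀ _ hr.ne']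
  calc ∫⁻ ξ, (⨆ x : H.cone ξ, levelWeight s x.1 * upSum μ g x.1) ^ p ∂μ
      ≤ ∫⁻ ξ, K₁ ^ (p / r) * maxFun μ E φ ξ ^ (p / r) ∂μ := by
        refine lintegral_mono fun ξ => ?_
        rw [← ENNReal.mul_rpow_of_nonneg _ _ hP0.le, hpow]
        exact ENNReal.rpow_le_rpow (hleft ξ) hP0.le
    _ = K₁ ^ (p / r) * ∫⁻ ξ, maxFun μ E φ ξ ^ (p / r) ∂μ :=
        lintegral_const_mul' _ _ (hKp _ hK₁t)
    _ ≤ K₁ ^ (p / r) * (c₁ * ∫⁻ ξ, φ ξ ^ (p / r) ∂μ) := by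
        gcongr
        exact hc₁ φ hφm
    _ = K₁ ^ (p / r) * (c₁ * ∫⁻ ξ, (N : ℝ≥0∞) ^ (p / r) * V ξ ^ p ∂μ) := by
        congr 3
        ext ξ
        rw [hφ, hpow (V ξ)]
        exact ENNReal.mul_rpow_of_nonneg _ _ hP0.le
    _ = _ := by
        rw [lintegral_const_mul' _ _ (hKp _ (by simp))]
        ring

/-- `upSum` is bounded on `J^s_{p,q}(X)`. -/
theorem jNorm_upSum_le (hG : FillingGeometry H μ Q E C N) [BorelSpace Z] {s p : ℝ} {q : ℝ≥0∞}
    (hQ : 0 < Q) (hs : 0 < s) (hpQ : Q / (Q + s) < p) (hqQ : ENNReal.ofReal (Q / (Q + s)) < q) :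
    ∃ K : ℝ≥0, ∀ g : H.Vertex → ℝ≥0∞, jNorm μ s p q (upSum μ g) ≤ K * jNorm μ s p q g := by
  have h0 : 0 < Q / (Q + s) := by positivity
  have h1 : Q / (Q + s) < 1 := by rw [div_lt_one (by positivity)]; linarith
  have hp : 0 < p := h0.trans hpQ
  have hε : ∀ r, Q / (Q + s) < r → 0 < (Q + s) * r - Q := by
    intro r hr
    rw [div_lt_iff₀ (by positivity)] at hr
    linarith
  have hfinal : ∀ A B K : ℝ≥0∞, K ≠ ∞ → A ≤ K * B →
      A ^ (1 / p) ≤ (K ^ (1 / p)).toNNReal * B ^ (1 / p) := by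
    intro A B K hK h
    rw [ENNReal.coe_toNNReal (ENNReal.rpow_ne_top_of_nonneg (by positivity) hK),
      ← ENNReal.mul_rpow_of_nonneg _ _ (by positivity)]
    exact ENNReal.rpow_le_rpow h (by positivity)
  by_cases hq : q = ∞
  -- Here r lies strictly between Q/(Q+s) and min(p, 1); when q is finite, r must also be smaller
  -- than q.
  · obtain ⟨r, hr, hr'⟩ := exists_between (lt_min hpQ h1)
    obtain ⟨hrp, hr1⟩ := lt_min_iff.1 hr'
    obtain ⟨K, hK, h⟩ := hG.jNorm_upSum_le_of_eq_top (h0.trans hr) hr1.le hrp (hε r hr)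
    refine ⟨(K ^ (1 / p)).toNNReal, fun g => ?_⟩
    simp only [jNorm, ellq, hq, if_true]
    exact hfinal _ _ K hK (h g)
  · have hqQ' : Q / (Q + s) < q.toReal := (ENNReal.ofReal_lt_iff_lt_toReal h0.le hq).1 hqQ
    obtain ⟨r, hr, hr'⟩ := exists_between (lt_min (lt_min hpQ hqQ') h1)
    obtain ⟨hr'', hr1⟩ := lt_min_iff.1 hr'
    obtain ⟨hrp, hrq⟩ := lt_min_iff.1 hr''
    obtain ⟨K, hK, h⟩ := hG.jNorm_upSum_le_of_ne_top (h0.trans hr) hr1.le hrp hrq (hε r hr)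
    refine ⟨(K ^ (1 / p)).toNNReal, fun g => ?_⟩
    simp only [jNorm, ellq, hq, if_false, ← ENNReal.rpow_mul, one_div_mul_eq_div]
    exact hfinal _ _ K hK (h g)

end FillingGeometry

end TriebelLizorkin

namespace TriebelLizorkin

/-! ### Estimates for the sequence quasi-norm and the discrete derivative -/

lemma le_ellq {ι : Type*} {q : ℝ≥0∞} (hq : 0 < q) (a : ι → ℝ≥0∞) (i : ι) : a i ≤ ellq q a := by
  unfold ellq
  split_ifs with h
  · exact le_iSup a i
  · have hq' : 0 < q.toReal := ENNReal.toReal_pos hq.ne' h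
    calc a i = (a i ^ q.toReal) ^ (1 / q.toReal) := by
          rw [← ENNReal.rpow_mul, mul_one_div_cancel hq'.ne', ENNReal.rpow_one]
      _ ≤ _ := ENNReal.rpow_le_rpow (ENNReal.le_tsum i) (by positivity)

lemma ellq_two_le_tsum {ι : Type*} (a : ι → ℝ≥0∞) : ellq 2 a ≤ ∑' i, a i := by
  rw [ellq, if_neg (by simp)]
  refine (ENNReal_rpow_tsum_le (by norm_num) (by norm_num) _).trans (le_of_eq ?_)
  congr 1
  ext i
  rw [← ENNReal.rpow_mul]
  norm_num

namespace HyperbolicFilling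

variable {Z : Type*} [MetricSpace Z] {H : HyperbolicFilling Z}

lemma enorm_sub_le_absD {x y : H.Vertex} (h : H.graph.Adj x y) (u : H.Vertex → ℂ) :
    ‖u y - u x‖ₑ ≤ absD u x :=
  le_ellq (by simp) (fun y : {y // H.graph.Adj x y} => ‖u y - u x‖ₑ) ⟨y, h⟩

lemma absD_sub_const (u : H.Vertex → ℂ) (c : ℂ) : absD (u - fun _ => c) = absD u := by
  ext x
  simp [absD]

lemma exists_absD_add_le (H : HyperbolicFilling Z) : ∃ K : ℝ≥0, ∀ (u v : H.Vertex → ℂ) x,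
    absD (u + v) x ≤ K * (absD u x + absD v x) := by
  obtain ⟨K, hK, h⟩ := ellq_add_le (q := 2) (by simp)
  refine ⟨K.toNNReal, fun u v x => ?_⟩
  rw [ENNReal.coe_toNNReal hK.ne]
  refine (ellq_mono 2 fun y => ?_).trans
      (h (fun y : {y // H.graph.Adj x y} => ‖u y - u x‖ₑ) fun y => ‖v y - v x‖ₑ)
  rw [Pi.add_apply, Pi.add_apply, add_sub_add_comm]
  exact enorm_add_le _ _

variable [MeasurableSpace Z] [BorelSpace Z]

lemma exists_jNorm_add_le (H : HyperbolicFilling Z) (μ : Measure Z) (s : ℝ) {p : ℝ} (hp : 0 < p)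
    {q : ℝ≥0∞} (hq : 0 < q) : ∃ K : ℝ≥0, ∀ f g : H.Vertex → ℝ≥0∞,
      jNorm μ s p q (fun x => f x + g x) ≤ K * (jNorm μ s p q f + jNorm μ s p q g) := by
  obtain ⟨K, hK, h⟩ := ellq_add_le hq
  have hp' : 0 < 1 / p := by positivity
  have h2 : (2 : ℝ≥0∞) ^ p ≠ ∞ := ENNReal.rpow_ne_top_of_nonneg hp.le (by simp)
  have h2' : (2 : ℝ≥0∞) ^ (1 / p) ≠ ∞ := ENNReal.rpow_ne_top_of_nonneg hp'.le (by simp)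
  have hKp : K ^ p ≠ ∞ := ENNReal.rpow_ne_top_of_nonneg hp.le hK.ne
  refine ⟨(K * 2 * 2 ^ (1 / p)).toNNReal, fun f g => ?_⟩
  rw [ENNReal.coe_toNNReal (ENNReal.mul_ne_top (ENNReal.mul_ne_top hK.ne (by simp)) h2')]
  unfold jNorm
  simp_rw [mul_add]
  set a : Z → ℝ≥0∞ := fun ξ =>
    ellq q (fun x : H.cone ξ => ENNReal.ofReal ((2 : ℝ) ^ ((level x.1 : ℝ) * s)) * f x.1)
  set b : Z → ℝ≥0∞ := fun ξ =>
    ellq q (fun x : H.cone ξ => ENNReal.ofReal ((2 : ℝ) ^ ((level x.1 : ℝ) * s)) * g x.1)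
  have ha : Measurable a := measurable_ellq_cone hq
    fun x : H.Vertex => ENNReal.ofReal ((2 : ℝ) ^ ((level x : ℝ) * s)) * f x
  calc _ ≤ (∫⁻ ξ, K ^ p * (2 ^ p * (a ξ ^ p + b ξ ^ p)) ∂μ) ^ (1 / p) := by
        refine ENNReal.rpow_le_rpow (lintegral_mono fun ξ => ?_) hp'.le
        refine (ENNReal.rpow_le_rpow (h _ _) hp.le).trans ?_
        rw [ENNReal.mul_rpow_of_nonneg _ _ hp.le]
        gcongr
        exact rpow_add_le' hp _ _
    _ = K * 2 * ((∫⁻ ξ, a ξ ^ p ∂μ) + ∫⁻ ξ, b ξ ^ p ∂μ) ^ (1 / p) := by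
        rw [lintegral_const_mul' _ _ hKp, lintegral_const_mul' _ _ h2,
          lintegral_add_left (ha.pow_const p), ENNReal.mul_rpow_of_nonneg _ _ hp'.le,
          ENNReal.mul_rpow_of_nonneg _ _ hp'.le, ← ENNReal.rpow_mul, ← ENNReal.rpow_mul,
          mul_one_div_cancel hp.ne', ENNReal.rpow_one, ENNReal.rpow_one, mul_assoc]
    _ ≤ K * 2 * (2 ^ (1 / p) * ((∫⁻ ξ, a ξ ^ p ∂μ) ^ (1 / p) + (∫⁻ ξ, b ξ ^ p ∂μ) ^ (1 / p))) := by
        gcongr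
        exact rpow_add_le' hp' _ _
    _ = _ := by ring

/-- On B(x) the integrand contains the term of x. Thus values at a single vertex are controlled by
the quasi-norm. -/
lemma mul_measure_le_jNorm (μ : Measure Z) (s : ℝ) {p : ℝ} (hp : 0 < p) {q : ℝ≥0∞} (hq : 0 < q)
    (g : H.Vertex → ℝ≥0∞) (x : H.Vertex) :
    levelWeight s x * g x * μ (ball x) ^ (1 / p) ≤ jNorm μ s p q g := by
  have hp' : 0 < 1 / p := by positivity
  unfold jNorm
  calc levelWeight s x * g x * μ (ball x) ^ (1 / p)
      = (∫⁻ ξ in ball x, (levelWeight s x * g x) ^ p ∂μ) ^ (1 / p) := by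
        rw [setLIntegral_const, ENNReal.mul_rpow_of_nonneg _ _ hp'.le, ← ENNReal.rpow_mul,
          mul_one_div_cancel hp.ne', ENNReal.rpow_one]
    _ ≤ _ := by
        refine ENNReal.rpow_le_rpow (le_trans ?_ (setLIntegral_le_lintegral (ball x) _)) hp'.le
        refine setLIntegral_mono' (isOpen_ball x).measurableSet fun ξ hξ => ?_
        exact ENNReal.rpow_le_rpow (le_ellq hq (fun x : H.cone ξ =>
          ENNReal.ofReal ((2 : ℝ) ^ ((level x.1 : ℝ) * s)) * g x.1) ⟨x, hξ⟩) hp.le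

end HyperbolicFilling

variable {Z : Type*} [MetricSpace Z] [MeasurableSpace Z] {H : HyperbolicFilling Z} {μ : Measure Z}
  {Q : ℝ} {E : H.Vertex → Set Z} {C : ℝ≥0} {N : ℕ}

namespace FillingGeometry

lemma levelWeight_pos (s : ℝ) (x : H.Vertex) : levelWeight s x ≠ 0 := by
  rw [levelWeight, Ne, ENNReal.ofReal_eq_zero, not_le]; positivity

lemma le_jNorm (hG : FillingGeometry H μ Q E C N) [BorelSpace Z] (s : ℝ) {p : ℝ} (hp : 0 < p)
    {q : ℝ≥0∞} (hq : 0 < q) (x : H.Vertex) :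
    ∃ K : ℝ≥0, ∀ g : H.Vertex → ℝ≥0∞, g x ≤ K * jNorm μ s p q g := by
  have h1 : levelWeight s x * μ (ball x) ^ (1 / p) ≠ 0 :=
    mul_ne_zero (levelWeight_pos s x)
      (by simp [ENNReal.rpow_eq_zero_iff, (hG.pos x).ne', hG.measure_ne_top])
  have h2 : levelWeight s x * μ (ball x) ^ (1 / p) ≠ ∞ :=
    ENNReal.mul_ne_top ENNReal.ofReal_ne_top
      (ENNReal.rpow_ne_top_of_nonneg (by positivity) (hG.measure_ne_top _))
  refine ⟨(levelWeight s x * μ (ball x) ^ (1 / p))⁻¹.toNNReal, fun g => ?_⟩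
  rw [ENNReal.coe_toNNReal (ENNReal.inv_ne_top.2 h1), mul_comm, ← div_eq_mul_inv,
    ENNReal.le_div_iff_mul_le (Or.inl h1) (Or.inl h2)]
  refine le_trans (le_of_eq ?_) (mul_measure_le_jNorm μ s hp hq g x)
  ring

lemma le_upSum (hG : FillingGeometry H μ Q E C N) (g : H.Vertex → ℝ≥0∞) (x : H.Vertex) :
    g x ≤ upSum μ g x := by
  classical
  refine le_trans (le_of_eq ?_) (ENNReal.le_tsum x)
  rw [if_pos ⟨by omega, by simpa using hG.nonempty_ball x⟩,
    ENNReal.inv_mul_cancel (hG.pos x).ne' (hG.measure_ne_top _), one_mul]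

/-- Neighbours of x occur in `upSum` with coefficients bounded below, as their volumes are
comparable to μ(B(x)); the term v(x) is repeated at most N times. -/
lemma absD_le_upSum (hG : FillingGeometry H μ Q E C N) (hQ : 0 < Q) :
    ∃ K : ℝ≥0, ∀ (v : H.Vertex → ℂ) (x : H.Vertex),
      absD v x ≤ K * upSum μ (fun y => ‖v y‖ₑ) x := by
  classical
  have hK : (C : ℝ≥0∞) * ENNReal.ofReal (2 ^ Q) + N ≠ ∞ := by
    simp [ENNReal.mul_eq_top]
  refine ⟨((C : ℝ≥0∞) * ENNReal.ofReal (2 ^ Q) + N).toNNReal, fun v x => ?_⟩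
  rw [ENNReal.coe_toNNReal hK]
  calc absD v x ≤ ∑' y : {y // H.graph.Adj x y}, ‖v y - v x‖ₑ := ellq_two_le_tsum _
    _ ≤ ∑' y : {y // H.graph.Adj x y}, (‖v y‖ₑ + ‖v x‖ₑ) :=
        ENNReal.tsum_le_tsum fun y => enorm_sub_le
    _ = (∑' y : {y // H.graph.Adj x y}, ‖v y‖ₑ) + ∑' y : {y // H.graph.Adj x y}, ‖v x‖ₑ :=
        ENNReal.tsum_add
    _ ≤ (C : ℝ≥0∞) * ENNReal.ofReal (2 ^ Q) * upSum μ (fun y => ‖v y‖ₑ) x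
          + N * upSum μ (fun y => ‖v y‖ₑ) x := by
        gcongr
        · rw [upSum, ← ENNReal.tsum_mul_left]
          refine le_trans ?_ (ENNReal.tsum_comp_le_tsum_of_injective
            (Subtype.val_injective (p := fun y => H.graph.Adj x y)) _)
          refine ENNReal.tsum_le_tsum fun y => ?_
          have hadj := y.2
          have hf : IsFiner x y.1 := ⟨hadj.2.1, hadj.2.2.2⟩
          rw [if_pos hf]
          have h1 := hG.compare x y hf.1 hf.2
          have h2 : (2 : ℝ) ^ (((level y.1 : ℝ) - level x) * Q) ≤ 2 ^ Q := by
            refine Real.rpow_le_rpow_of_exponent_le (by norm_num) ?_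
            have : (level y.1 : ℝ) ≤ level x + 1 := by exact_mod_cast hadj.2.2.1
            nlinarith
          have h3 : μ (ball x) ≤ C * ENNReal.ofReal (2 ^ Q) * μ (ball y.1) := by
            refine h1.trans ?_
            gcongr
          calc ‖v y‖ₑ = (μ (ball x))⁻¹ * μ (ball x) * ‖v y‖ₑ := by
                rw [ENNReal.inv_mul_cancel (hG.pos x).ne' (hG.measure_ne_top _), one_mul]
            _ ≤ (μ (ball x))⁻¹ * (C * ENNReal.ofReal (2 ^ Q) * μ (ball y.1)) * ‖v y‖ₑ := by
                gcongr
            _ = _ := by ring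
        · rw [ENNReal.tsum_eq_iSup_sum]
          refine iSup_le fun S => ?_
          rw [Finset.sum_const, nsmul_eq_mul]
          gcongr
          · have := hG.degree x (S.map (Function.Embedding.subtype _)) (by
              intro y hy
              rw [Finset.mem_map] at hy
              obtain ⟨z, -, rfl⟩ := hy
              exact z.2)
            rwa [Finset.card_map] at this
          · exact hG.le_upSum (fun y => ‖v y‖ₑ) x
    _ = _ := by ring

lemma absD_ne_top (hG : FillingGeometry H μ Q E C N) (u : H.Vertex → ℂ) (x : H.Vertex) :
    absD u x ≠ ∞ := by
  have hfin : Finite {y // H.graph.Adj x y} := by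
    by_contra hinf
    rw [not_finite_iff_infinite] at hinf
    obtain ⟨S, hS⟩ := Infinite.exists_subset_card_eq {y // H.graph.Adj x y} (N + 1)
    have := hG.degree x (S.map (Function.Embedding.subtype _)) (by
      intro y hy
      rw [Finset.mem_map] at hy
      obtain ⟨z, -, rfl⟩ := hy
      exact z.2)
    rw [Finset.card_map] at this
    omega
  have := Fintype.ofFinite {y // H.graph.Adj x y}
  refine ne_top_of_le_ne_top ?_ (ellq_two_le_tsum _)
  rw [tsum_fintype]
  exact ENNReal.sum_ne_top.2 fun y _ => enorm_ne_top

/-- Gives J_0 ⊂ D, and makes corrections by elements of J^s_{p,q}(X) harmless for the quasi-norm of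
D. -/
lemma jNorm_absD_le (hG : FillingGeometry H μ Q E C N) [BorelSpace Z] {s p : ℝ} {q : ℝ≥0∞}
    (hQ : 0 < Q) (hs : 0 < s) (hp : 0 < p) (hq : 0 < q)
    (hpQ : Q / (Q + s) < p) (hqQ : ENNReal.ofReal (Q / (Q + s)) < q) :
    ∃ K : ℝ≥0, ∀ v : H.Vertex → ℂ,
      jNorm μ s p q (absD v) ≤ K * jNorm μ s p q fun x => ‖v x‖ₑ := by
  obtain ⟨K₁, h₁⟩ := hG.absD_le_upSum hQ
  obtain ⟨K₂, h₂⟩ := hG.jNorm_upSum_le (p := p) (q := q) hQ hs hpQ hqQ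
  refine ⟨K₁ * K₂, fun v => ?_⟩
  refine (jNorm_mono μ s hp q (h₁ v)).trans ?_
  rw [jNorm_const_mul μ s hp hq (by simp), ENNReal.coe_mul, mul_assoc]
  gcongr
  exact h₂ _

/-! ### Integrability along the filling -/

lemma lintegral_levelSum (hG : FillingGeometry H μ Q E C N) [BorelSpace Z] (m : ℕ)
    (g : H.Vertex → ℝ≥0∞) (A : Set Z) :
    ∫⁻ ξ in A, levelSum ball m g ξ ∂μ
      = ∑' y, {y : H.Vertex | level y = m}.indicator (fun y => μ (ball y ∩ A) * g y) y := by
  classical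
  have := hG.countable
  simp only [levelSum]
  rw [lintegral_tsum]
  · congr 1
    ext y
    by_cases h : level y = m
    · rw [indicator_of_mem (by exact h)]
      have : ∀ ξ, (if level y = m ∧ ξ ∈ ball y then g y else 0)
          = (ball y).indicator (fun _ => g y) ξ := by
        intro ξ
        by_cases hξ : ξ ∈ ball y <;> simp [h, hξ]
      simp_rw [this]
      rw [lintegral_indicator (isOpen_ball y).measurableSet,
        Measure.restrict_restrict (isOpen_ball y).measurableSet, setLIntegral_const, mul_comm]
    · rw [indicator_of_notMem (by exact h)]
      simp [h]
  · intro y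
    refine (Measurable.ite ?_ measurable_const measurable_const).aemeasurable
    by_cases h : level y = m
    · simpa [h] using (isOpen_ball y).measurableSet
    · simp [h]

/-- By Tonelli's theorem each y on a level ≥ |x| contributes μ(B(x) ∩ B(y)) g(y), and only balls
meeting B(x) count. The right side also has the level |x| - 1, which is not needed here. -/
lemma average_tsum_levelSum_le (hG : FillingGeometry H μ Q E C N) [BorelSpace Z]
    (g : H.Vertex → ℝ≥0∞) (x : H.Vertex) :
    (μ (ball x))⁻¹ * ∫⁻ ξ in ball x, ∑' k, levelSum ball (level x + k) g ξ ∂μ ≤ upSum μ g x := by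
  classical
  rw [lintegral_tsum fun k => (hG.measurable_levelSum
    (fun x => (isOpen_ball x).measurableSet) _ g).aemeasurable]
  simp_rw [hG.lintegral_levelSum]
  rw [ENNReal.tsum_comm, ← ENNReal.tsum_mul_left, upSum]
  refine ENNReal.tsum_le_tsum fun y => ?_
  by_cases hxy : level x ≤ level y
  · obtain ⟨k, hk⟩ := Nat.exists_eq_add_of_le hxy
    rw [tsum_eq_single k fun j hj => indicator_of_notMem (by
      intro h
      have : level y = level x + j := h
      omega) _, indicator_of_mem (by exact hk)]
    split_ifs with h
    · rw [mul_assoc]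
      gcongr
      exact inter_subset_left
    · have hemp : ball y ∩ ball x = ∅ := by
        by_contra hne
        refine h ⟨by omega, ?_⟩
        rw [inter_comm]
        exact nonempty_iff_ne_empty.2 hne
      simp [hemp]
  · have : ∀ k, {y : H.Vertex | level y = level x + k}.indicator
        (fun y => μ (ball y ∩ ball x) * g y) y = 0 := by
      intro k
      refine indicator_of_notMem (fun h => ?_) _
      have : level y = level x + k := h
      omega
    simp [this]

/-- The case x = root of the averaging bound, where B(x) = Z. It yields integrability even for p <
1, where no embedding of L^p into L¹ is available. -/
lemma lintegral_tsum_levelSum_lt_top (hG : FillingGeometry H μ Q E C N) [BorelSpace Z]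
    {s p : ℝ} {q : ℝ≥0∞} (hQ : 0 < Q) (hs : 0 < s) (hp : 0 < p) (hq : 0 < q)
    (hpQ : Q / (Q + s) < p) (hqQ : ENNReal.ofReal (Q / (Q + s)) < q)
    {g : H.Vertex → ℝ≥0∞} (hg : jNorm μ s p q g < ∞) :
    ∫⁻ ξ, ∑' k, levelSum ball k g ξ ∂μ ≠ ∞ := by
  obtain ⟨K, hK⟩ := hG.jNorm_upSum_le (p := p) (q := q) hQ hs hpQ hqQ
  obtain ⟨K', hK'⟩ := hG.le_jNorm s hp hq Vertex.root
  have h1 : upSum μ g Vertex.root ≠ ∞ := by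
    refine ne_top_of_le_ne_top ?_ ((hK' _).trans (mul_le_mul_right (hK g) _))
    exact ENNReal.mul_ne_top (by simp) (ENNReal.mul_ne_top (by simp) hg.ne)
  have h2 := hG.average_tsum_levelSum_le g Vertex.root
  have e : ∀ k, level (Vertex.root : H.Vertex) + k = k := fun k => by simp [level]
  simp only [e, ball, Measure.restrict_univ] at h2
  intro h
  rw [h, ENNReal.mul_top (ENNReal.inv_ne_zero.2 (hG.measure_ne_top _))] at h2
  exact h1 (top_le_iff.1 h2)

end FillingGeometry

end TriebelLizorkin

namespace TriebelLizorkin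

/-! ### Traces -/

variable {Z : Type*} [MetricSpace Z] [MeasurableSpace Z] {H : HyperbolicFilling Z} {μ : Measure Z}
  {Q : ℝ} {E : H.Vertex → Set Z} {C : ℝ≥0} {N : ℕ}

namespace HyperbolicFilling.HasTrace

variable {Ψ : LipschitzPartition H} {u v : H.Vertex → ℂ} {f g : Z → ℂ}

lemma ae_eq (hf : HasTrace μ Ψ u f) (hg : HasTrace μ Ψ u g) : f =ᵐ[μ] g := by
  filter_upwards [hf.tendsto_ae, hg.tendsto_ae] with ξ h1 h2
  exact tendsto_nhds_unique h1 h2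

lemma congr (hf : HasTrace μ Ψ u f) (h : f =ᵐ[μ] g) : HasTrace μ Ψ u g where
  integrable := hf.integrable.congr h
  tendsto_L1 := by
    refine hf.tendsto_L1.congr fun n => eLpNorm_congr_ae ?_
    filter_upwards [h] with ξ hξ
    simp [hξ]
  tendsto_ae := by
    filter_upwards [h, hf.tendsto_ae] with ξ hξ h
    rwa [← hξ]

end HyperbolicFilling.HasTrace

namespace FillingGeometry

variable (Ψ : LipschitzPartition H)

lemma exists_traceApprox_eq_sum (hG : FillingGeometry H μ Q E C N) (n : ℕ) :
    ∃ S : Finset H.Vertex, (∀ x, x ∈ S ↔ level x = n) ∧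
      (∀ (u : H.Vertex → ℂ) ξ, traceApprox Ψ u n ξ = ∑ x ∈ S, u x * (Ψ.ψ x ξ : ℂ)) ∧
      ∀ ξ, ∑ x ∈ S, Ψ.ψ x ξ = 1 := by
  have hmem : ∀ x, x ∈ (hG.finite_level n).toFinset ↔ level x = n := fun x => by
    rw [Finite.mem_toFinset]; rfl
  have hsum : ∀ {M : Type} [AddCommMonoid M] [TopologicalSpace M] [T2Space M] (F : H.Vertex → M),
      ∑' x : {x : H.Vertex // level x = n}, F x = ∑ x ∈ (hG.finite_level n).toFinset, F x := by
    intro M _ _ _ F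
    have hfin : Finite {x : H.Vertex // level x = n} := hG.finite_level n
    have := Fintype.ofFinite {x : H.Vertex // level x = n}
    rw [tsum_fintype]
    exact (Finset.sum_subtype _ hmem F).symm
  refine ⟨(hG.finite_level n).toFinset, hmem, fun u ξ => hsum fun x => u x * (Ψ.ψ x ξ : ℂ), fun ξ => ?_⟩
  rw [← Ψ.sum_eq_one n ξ, hsum fun x => Ψ.ψ x ξ]

lemma traceApprox_add (hG : FillingGeometry H μ Q E C N) (u v : H.Vertex → ℂ) (n : ℕ) :
    traceApprox Ψ (u + v) n = traceApprox Ψ u n + traceApprox Ψ v n := by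
  obtain ⟨S, -, h, -⟩ := hG.exists_traceApprox_eq_sum Ψ n
  ext ξ
  simp only [h, Pi.add_apply, add_mul, Finset.sum_add_distrib]

lemma traceApprox_smul (hG : FillingGeometry H μ Q E C N) (c : ℂ) (u : H.Vertex → ℂ) (n : ℕ) :
    traceApprox Ψ (c • u) n = c • traceApprox Ψ u n := by
  obtain ⟨S, -, h, -⟩ := hG.exists_traceApprox_eq_sum Ψ n
  ext ξ
  simp only [h, Pi.smul_apply, smul_eq_mul, Finset.mul_sum, mul_assoc]

lemma continuous_traceApprox (hG : FillingGeometry H μ Q E C N) (u : H.Vertex → ℂ) (n : ℕ) :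
    Continuous (traceApprox Ψ u n) := by
  obtain ⟨S, -, h, -⟩ := hG.exists_traceApprox_eq_sum Ψ n
  obtain ⟨L, hL⟩ := Ψ.lip
  have : traceApprox Ψ u n = fun ξ => ∑ x ∈ S, u x * (Ψ.ψ x ξ : ℂ) := funext (h u)
  rw [this]
  exact continuous_finsetSum _ fun x _ =>
    continuous_const.mul (Complex.continuous_ofReal.comp (hL x).continuous)

variable {Ψ}

lemma hasTrace_add (hG : FillingGeometry H μ Q E C N) [BorelSpace Z] {u v : H.Vertex → ℂ}
    {f g : Z → ℂ} (hf : HasTrace μ Ψ u f) (hg : HasTrace μ Ψ v g) :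
    HasTrace μ Ψ (u + v) (f + g) where
  integrable := hf.integrable.add hg.integrable
  tendsto_L1 := by
    have h := hf.tendsto_L1.add hg.tendsto_L1
    rw [add_zero] at h
    refine tendsto_of_tendsto_of_tendsto_of_le_of_le tendsto_const_nhds h (fun _ => zero_le)
      fun n => ?_
    have e : traceApprox Ψ (u + v) n - (f + g)
        = (traceApprox Ψ u n - f) + (traceApprox Ψ v n - g) := by
      rw [hG.traceApprox_add]; abel
    simp only
    rw [e]
    exact eLpNorm_add_le
      ((hG.continuous_traceApprox Ψ u n).aestronglyMeasurable.sub hf.integrable.1)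
      ((hG.continuous_traceApprox Ψ v n).aestronglyMeasurable.sub hg.integrable.1) le_rfl
  tendsto_ae := by
    filter_upwards [hf.tendsto_ae, hg.tendsto_ae] with ξ h1 h2
    simp_rw [hG.traceApprox_add]
    exact h1.add h2

lemma hasTrace_smul (hG : FillingGeometry H μ Q E C N) (c : ℂ) {u : H.Vertex → ℂ}
    {f : Z → ℂ} (hf : HasTrace μ Ψ u f) : HasTrace μ Ψ (c • u) (c • f) where
  integrable := hf.integrable.smul c
  tendsto_L1 := by
    have h := ENNReal.Tendsto.const_mul (a := ‖c‖ₑ) hf.tendsto_L1 (Or.inr enorm_ne_top)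
    rw [mul_zero] at h
    refine h.congr fun n => ?_
    rw [hG.traceApprox_smul, ← smul_sub, eLpNorm_const_smul]
  tendsto_ae := by
    filter_upwards [hf.tendsto_ae] with ξ h1
    simp_rw [hG.traceApprox_smul]
    exact h1.const_smul c

/-- Convexity: `T_n u(ξ)` is as close to `c` as the values of `u` at the vertices involved. -/
lemma enorm_traceApprox_sub_le (hG : FillingGeometry H μ Q E C N) {u : H.Vertex → ℂ} {n : ℕ}
    {ξ : Z} {c : ℂ} {B : ℝ≥0∞} (h : ∀ y : H.Vertex, level y = n → ξ ∈ ball y → ‖u y - c‖ₑ ≤ B) :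
    ‖traceApprox Ψ u n ξ - c‖ₑ ≤ B := by
  rcases eq_or_ne B ∞ with rfl | hB
  · exact le_top
  lift B to ℝ≥0 using hB
  obtain ⟨S, hS, he, h1⟩ := hG.exists_traceApprox_eq_sum Ψ n
  have e : traceApprox Ψ u n ξ - c = ∑ x ∈ S, (u x - c) * (Ψ.ψ x ξ : ℂ) := by
    simp only [sub_mul, Finset.sum_sub_distrib]
    rw [← Finset.mul_sum, he, ← Complex.ofReal_sum, h1]
    simp
  have hreal : ‖traceApprox Ψ u n ξ - c‖ ≤ B := by
    rw [e]
    refine (norm_sum_le _ _).trans ?_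
    calc ∑ x ∈ S, ‖(u x - c) * (Ψ.ψ x ξ : ℂ)‖ ≤ ∑ x ∈ S, (B : ℝ) * Ψ.ψ x ξ := by
          refine Finset.sum_le_sum fun x hx => ?_
          rw [norm_mul, Complex.norm_real, Real.norm_of_nonneg (Ψ.nonneg x ξ)]
          by_cases hξ : ξ ∈ ball x
          · have := h x ((hS x).1 hx) hξ
            rw [← ofReal_norm, ENNReal.ofReal_le_iff_le_toReal (by simp)] at this
            exact mul_le_mul_of_nonneg_right this (Ψ.nonneg x ξ)
          · simp [Ψ.supp x ξ hξ]
      _ = B := by rw [← Finset.mul_sum, h1, mul_one]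
  rw [← ofReal_norm]
  exact (ENNReal.ofReal_le_ofReal hreal).trans (le_of_eq (by simp))

lemma enorm_traceApprox_sub_le_absD (hG : FillingGeometry H μ Q E C N) (u : H.Vertex → ℂ)
    {n : ℕ} {ξ : Z} {x : H.Vertex} (hξ : ξ ∈ ball x) (h1 : level x ≤ n + 1) (h2 : n ≤ level x + 1) :
    ‖traceApprox Ψ u n ξ - u x‖ₑ ≤ absD u x := by
  refine hG.enorm_traceApprox_sub_le fun y hy hyξ => ?_
  rcases eq_or_ne x y with rfl | hne
  · simp
  · exact enorm_sub_le_absD ⟨hne, by omega, by omega, ⟨ξ, hξ, hyξ⟩⟩ u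

lemma le_levelSum {B : H.Vertex → Set Z} {n : ℕ} {ξ : Z} {x : H.Vertex} (hx : level x = n)
    (hξ : ξ ∈ B x) (a : H.Vertex → ℝ≥0∞) : a x ≤ levelSum B n a ξ := by
  classical
  refine le_trans (le_of_eq ?_) (ENNReal.le_tsum x)
  rw [if_pos ⟨hx, hξ⟩]

/-- Compare both terms with u(x) for a vertex x of level n whose ball contains ξ: every vertex used
by T_n or T_{n+1} at ξ is x or one of its neighbours. -/
lemma edist_traceApprox_le (hG : FillingGeometry H μ Q E C N) (u : H.Vertex → ℂ) (n : ℕ) (ξ : Z) :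
    edist (traceApprox Ψ u n ξ) (traceApprox Ψ u n.succ ξ)
      ≤ 2 * levelSum ball n (absD u) ξ := by
  obtain ⟨x, hx, hξ⟩ := hG.cover n ξ
  have h1 := hG.enorm_traceApprox_sub_le_absD (Ψ := Ψ) u (n := n) hξ (by omega) (by omega)
  have h2 := hG.enorm_traceApprox_sub_le_absD (Ψ := Ψ) u (n := n.succ) hξ (by omega) (by omega)
  have h3 := le_levelSum hx hξ (absD u)
  rw [← edist_eq_enorm_sub] at h1 h2
  calc _ ≤ edist (traceApprox Ψ u n ξ) (u x) + edist (traceApprox Ψ u n.succ ξ) (u x) :=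
        edist_triangle_right _ _ _
    _ ≤ levelSum ball n (absD u) ξ + levelSum ball n (absD u) ξ :=
        add_le_add (h1.trans h3) (h2.trans h3)
    _ = _ := (two_mul _).symm

lemma enorm_traceApprox_sub_le_tsum (hG : FillingGeometry H μ Q E C N) {u : H.Vertex → ℂ} {ξ : Z}
    {c : ℂ} (h : Tendsto (fun n => traceApprox Ψ u n ξ) atTop (𝓝 c)) (n : ℕ) :
    ‖traceApprox Ψ u n ξ - c‖ₑ ≤ ∑' k, 2 * levelSum ball (n + k) (absD u) ξ := by
  rw [← edist_eq_enorm_sub]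
  exact edist_le_tsum_of_edist_le_of_tendsto _ (hG.edist_traceApprox_le u · ξ) h n

lemma enorm_trace_sub_le (hG : FillingGeometry H μ Q E C N) {u : H.Vertex → ℂ} {ξ : Z}
    {c : ℂ} (h : Tendsto (fun n => traceApprox Ψ u n ξ) atTop (𝓝 c)) {x : H.Vertex}
    (hξ : ξ ∈ ball x) :
    ‖c - u x‖ₑ ≤ absD u x + 2 * ∑' k, levelSum ball (level x + k) (absD u) ξ := by
  have h1 := hG.enorm_traceApprox_sub_le_absD (Ψ := Ψ) u (n := level x) hξ (by omega) (by omega)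
  have h2 := hG.enorm_traceApprox_sub_le_tsum h (level x)
  rw [ENNReal.tsum_mul_left] at h2
  rw [← edist_eq_enorm_sub] at h1 h2 ⊢
  rw [add_comm]
  exact (edist_triangle_left c (u x) (traceApprox Ψ u (level x) ξ)).trans (add_le_add h2 h1)

/-- The increments T_{n+1}u - T_n u are dominated by a series with integrable sum, so T_n u
converges almost everywhere, and the tails of the same series bound the L¹ distance to the limit.
Comparison with u(root) makes the limit integrable. -/
theorem exists_hasTrace (hG : FillingGeometry H μ Q E C N) [BorelSpace Z] (Ψ : LipschitzPartition H)
    {s p : ℝ} {q : ℝ≥0∞} (hQ : 0 < Q) (hs : 0 < s) (hp : 0 < p) (hq : 0 < q)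
    (hpQ : Q / (Q + s) < p) (hqQ : ENNReal.ofReal (Q / (Q + s)) < q)
    {u : H.Vertex → ℂ} (hu : jNorm μ s p q (absD u) < ∞) : ∃ f, HasTrace μ Ψ u f := by
  have hfinm := hG.isFiniteMeasure
  set G : ℕ → Z → ℝ≥0∞ := fun k => levelSum ball k (absD u) with hGdef
  have hGm : ∀ k, Measurable (G k) := fun k =>
    hG.measurable_levelSum (fun x => (isOpen_ball x).measurableSet) _ _
  have hint : ∫⁻ ξ, ∑' k, G k ξ ∂μ ≠ ∞ :=
    hG.lintegral_tsum_levelSum_lt_top hQ hs hp hq hpQ hqQ hu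
  have hae : ∀ᵐ ξ ∂μ, ∑' k, G k ξ < ∞ := ae_lt_top (Measurable.tsum hGm) hint
  have hlim : ∀ᵐ ξ ∂μ, ∃ c, Tendsto (fun n => traceApprox Ψ u n ξ) atTop (𝓝 c) := by
    filter_upwards [hae] with ξ hξ
    refine cauchySeq_tendsto_of_complete (cauchySeq_of_edist_le_of_tsum_ne_top _
      (fun n => hG.edist_traceApprox_le u n ξ) ?_)
    rw [ENNReal.tsum_mul_left]
    exact ENNReal.mul_ne_top (by simp) hξ.ne
  have hTm : ∀ n, AEStronglyMeasurable (traceApprox Ψ u n) μ := fun n =>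
    (hG.continuous_traceApprox Ψ u n).aestronglyMeasurable
  obtain ⟨f, hfm, hf⟩ := exists_stronglyMeasurable_limit_of_tendsto_ae hTm hlim
  have hL1 : Tendsto (fun n => eLpNorm (traceApprox Ψ u n - f) 1 μ) atTop (𝓝 0) := by
    have hsum : ∑' k, ∫⁻ ξ, 2 * G k ξ ∂μ ≠ ∞ := by
      rw [← lintegral_tsum fun k => ((hGm k).const_mul 2).aemeasurable]
      simp_rw [ENNReal.tsum_mul_left]
      rw [lintegral_const_mul' _ _ (by simp)]
      exact ENNReal.mul_ne_top (by simp) hint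
    refine tendsto_of_tendsto_of_tendsto_of_le_of_le tendsto_const_nhds
      (ENNReal.tendsto_sum_nat_add _ hsum) (fun _ => zero_le) fun n => ?_
    simp only
    rw [eLpNorm_one_eq_lintegral_enorm,
      ← lintegral_tsum fun k => ((hGm (k + n)).const_mul 2).aemeasurable]
    refine lintegral_mono_ae ?_
    filter_upwards [hf] with ξ hξ
    simp_rw [add_comm _ n]
    exact hG.enorm_traceApprox_sub_le_tsum hξ n
  refine ⟨f, ⟨⟨hfm.aestronglyMeasurable, ?_⟩, hL1, hf⟩⟩
  rw [hasFiniteIntegral_iff_enorm]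
  refine lt_of_le_of_lt (lintegral_mono_ae (g := fun ξ => (absD u Vertex.root + ‖u Vertex.root‖ₑ)
    + 2 * ∑' k, G k ξ) ?_) ?_
  · filter_upwards [hf] with ξ hξ
    have h := hG.enorm_trace_sub_le hξ (x := Vertex.root) (mem_univ ξ)
    simp only [level, zero_add] at h
    calc ‖f ξ‖ₑ = ‖(f ξ - u Vertex.root) + u Vertex.root‖ₑ := by rw [sub_add_cancel]
      _ ≤ ‖f ξ - u Vertex.root‖ₑ + ‖u Vertex.root‖ₑ := enorm_add_le _ _
      _ ≤ (absD u Vertex.root + 2 * ∑' k, G k ξ) + ‖u Vertex.root‖ₑ := by gcongr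
      _ = _ := by ring
  · rw [lintegral_add_left measurable_const, lintegral_const, lintegral_const_mul' _ _ (by simp)]
    exact ENNReal.add_lt_top.2 ⟨ENNReal.mul_lt_top (ENNReal.add_lt_top.2
      ⟨(hG.absD_ne_top u _).lt_top, enorm_lt_top⟩) hG.finite,
      ENNReal.mul_lt_top (by simp) hint.lt_top⟩

/-! ### Comparison of a sequence with the Poisson extension of its trace -/

lemma enorm_poisson_sub_le (hG : FillingGeometry H μ Q E C N) {f : Z → ℂ} (hf : Integrable f μ)
    (x : H.Vertex) (c : ℂ) :
    ‖H.poisson μ f x - c‖ₑ ≤ (μ (ball x))⁻¹ * ∫⁻ ξ in ball x, ‖f ξ - c‖ₑ ∂μ := by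
  have hfinm := hG.isFiniteMeasure
  have hne : NeZero (μ.restrict (ball x)) :=
    ⟨by rw [Ne, Measure.restrict_eq_zero]; exact (hG.pos x).ne'⟩
  have e : H.poisson μ f x - c = ⨍ ξ in ball x, (f ξ - c) ∂μ := by
    rw [poisson, setAverage_eq, setAverage_eq, integral_sub hf.integrableOn (integrable_const c),
      integral_const, smul_sub, smul_smul, measureReal_restrict_apply_univ, inv_mul_cancel₀,
      one_smul]
    simp [measureReal_def, ENNReal.toReal_eq_zero_iff, (hG.pos x).ne', hG.measure_ne_top]
  rw [e, setAverage_eq, enorm_smul]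
  gcongr
  · rw [measureReal_def, ← ENNReal.toReal_inv, Real.enorm_of_nonneg ENNReal.toReal_nonneg,
      ENNReal.ofReal_toReal (ENNReal.inv_ne_top.2 (hG.pos x).ne')]
  · exact enorm_integral_le_lintegral_enorm _

/-- Average the pointwise bound |f - u(x)| ≤ |du|(x) + 2 ∑ (level sums of |du| from level |x| on)
over B(x); the term |du|(x) contributes once to the constant 3, the series twice. -/
lemma enorm_poisson_trace_sub_le (hG : FillingGeometry H μ Q E C N) [BorelSpace Z]
    {u : H.Vertex → ℂ} {f : Z → ℂ} (hf : HasTrace μ Ψ u f) (x : H.Vertex) :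
    ‖H.poisson μ f x - u x‖ₑ ≤ 3 * upSum μ (absD u) x := by
  have hfinm := hG.isFiniteMeasure
  refine (hG.enorm_poisson_sub_le hf.integrable x (u x)).trans ?_
  calc (μ (ball x))⁻¹ * ∫⁻ ξ in ball x, ‖f ξ - u x‖ₑ ∂μ
      ≤ (μ (ball x))⁻¹ * ∫⁻ ξ in ball x, (absD u x
          + 2 * ∑' k, levelSum ball (level x + k) (absD u) ξ) ∂μ := by
        gcongr 1
        refine setLIntegral_mono_ae' (isOpen_ball x).measurableSet ?_
        filter_upwards [hf.tendsto_ae] with ξ h hξ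
        exact hG.enorm_trace_sub_le h hξ
    _ = absD u x + 2 * ((μ (ball x))⁻¹ *
          ∫⁻ ξ in ball x, ∑' k, levelSum ball (level x + k) (absD u) ξ ∂μ) := by
        rw [lintegral_add_left measurable_const, setLIntegral_const,
          lintegral_const_mul' _ _ (by simp), mul_add, mul_comm (absD u x), ← mul_assoc,
          ENNReal.inv_mul_cancel (hG.pos x).ne' (hG.measure_ne_top _), one_mul]
        ring
    _ ≤ upSum μ (absD u) x + 2 * upSum μ (absD u) x := by
        gcongr
        · exact hG.le_upSum _ x
        · exact hG.average_tsum_levelSum_le _ x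
    _ = _ := by ring

/-- The central estimate: modulo J^s_{p,q}(X), a sequence is the Poisson extension of its trace. It
determines the kernel of the trace, and gives its boundedness. -/
lemma jNorm_poisson_trace_sub_le (hG : FillingGeometry H μ Q E C N) [BorelSpace Z]
    {s p : ℝ} {q : ℝ≥0∞} (hQ : 0 < Q) (hs : 0 < s) (hp : 0 < p) (hq : 0 < q)
    (hpQ : Q / (Q + s) < p) (hqQ : ENNReal.ofReal (Q / (Q + s)) < q) (Ψ : LipschitzPartition H) :
    ∃ K : ℝ≥0, ∀ {u : H.Vertex → ℂ} {f : Z → ℂ}, HasTrace μ Ψ u f →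
      jNorm μ s p q (fun x => ‖H.poisson μ f x - u x‖ₑ) ≤ K * jNorm μ s p q (absD u) := by
  obtain ⟨K, hK⟩ := hG.jNorm_upSum_le (p := p) (q := q) hQ hs hpQ hqQ
  refine ⟨3 * K, fun {u f} hf => ?_⟩
  refine (jNorm_mono μ s hp q (hG.enorm_poisson_trace_sub_le hf)).trans ?_
  rw [jNorm_const_mul μ s hp hq (by simp), ENNReal.coe_mul, mul_assoc]
  gcongr
  · simp
  · exact hK _

/-- Boundedness of the trace: split Pf = u + (Pf - u), where the second term is already controlled
in J^s_{p,q}(X), and differences are bounded there. -/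
lemma jNorm_absD_poisson_trace_le (hG : FillingGeometry H μ Q E C N) [BorelSpace Z]
    {s p : ℝ} {q : ℝ≥0∞} (hQ : 0 < Q) (hs : 0 < s) (hp : 0 < p) (hq : 0 < q)
    (hpQ : Q / (Q + s) < p) (hqQ : ENNReal.ofReal (Q / (Q + s)) < q) (Ψ : LipschitzPartition H) :
    ∃ K : ℝ≥0, ∀ {u : H.Vertex → ℂ} {f : Z → ℂ}, HasTrace μ Ψ u f →
      jNorm μ s p q (absD (H.poisson μ f)) ≤ K * jNorm μ s p q (absD u) := by
  obtain ⟨K₁, h₁⟩ := hG.jNorm_poisson_trace_sub_le hQ hs hp hq hpQ hqQ Ψ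
  obtain ⟨K₂, h₂⟩ := hG.jNorm_absD_le hQ hs hp hq hpQ hqQ
  obtain ⟨K₃, h₃⟩ := H.exists_absD_add_le
  obtain ⟨K₄, h₄⟩ := H.exists_jNorm_add_le μ s hp hq
  refine ⟨K₃ * (K₄ * (1 + K₂ * K₁)), fun {u f} hf => ?_⟩
  have e : H.poisson μ f = u + (H.poisson μ f - u) := by abel
  rw [e]
  refine (jNorm_mono μ s hp q (h₃ u _)).trans ?_
  rw [jNorm_const_mul μ s hp hq (by simp), ENNReal.coe_mul, mul_assoc]
  refine mul_le_mul_right ((h₄ _ _).trans ?_) _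
  rw [ENNReal.coe_mul, mul_assoc]
  gcongr
  rw [ENNReal.coe_add, add_mul, ENNReal.coe_one, one_mul, ENNReal.coe_mul, mul_assoc]
  gcongr
  exact (h₂ _).trans (mul_le_mul_right (h₁ hf) _)

/-- Sequences in `J^s_{p,q}(X)` have trace zero. -/
lemma trace_eq_zero (hG : FillingGeometry H μ Q E C N) [BorelSpace Z]
    {s p : ℝ} {q : ℝ≥0∞} (hQ : 0 < Q) (hs : 0 < s) (hp : 0 < p) (hq : 0 < q)
    (hpQ : Q / (Q + s) < p) (hqQ : ENNReal.ofReal (Q / (Q + s)) < q)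
    {u : H.Vertex → ℂ} {f : Z → ℂ} (hf : HasTrace μ Ψ u f)
    (hu : jNorm μ s p q (fun x => ‖u x‖ₑ) < ∞) : f =ᵐ[μ] 0 := by
  have hm : Measurable fun ξ => ∑' k, levelSum ball k (fun x : H.Vertex => ‖u x‖ₑ) ξ :=
    Measurable.tsum fun k => hG.measurable_levelSum (fun x => (isOpen_ball x).measurableSet) _ _
  filter_upwards [hf.tendsto_ae, ae_lt_top hm
    (hG.lintegral_tsum_levelSum_lt_top hQ hs hp hq hpQ hqQ hu)] with ξ h1 h2
  refine tendsto_nhds_unique h1 ?_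
  rw [Pi.zero_apply, tendsto_iff_edist_tendsto_0]
  -- The level sum of |u| of order n dominates T_n u(ξ) and is the general term of a convergent
  -- series.
  refine tendsto_of_tendsto_of_tendsto_of_le_of_le tendsto_const_nhds
    (ENNReal.tendsto_atTop_zero_of_tsum_ne_top h2.ne) (fun _ => zero_le) fun n => ?_
  simp only
  rw [edist_eq_enorm_sub]
  refine hG.enorm_traceApprox_sub_le fun y hy hξ => ?_
  rw [sub_zero]
  exact le_levelSum hy hξ fun x => ‖u x‖ₑ

/-! ### The trace of the Poisson extension -/

/-- The bound is uniform in n: each ball of level n contributes at most the integral of |f| over it,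
and these balls overlap at most N times. This is what makes the density argument possible. -/
lemma eLpNorm_traceApprox_poisson_le (hG : FillingGeometry H μ Q E C N) [BorelSpace Z]
    {f : Z → ℂ} (hf : Integrable f μ) (n : ℕ) :
    eLpNorm (traceApprox Ψ (H.poisson μ f) n) 1 μ ≤ N * eLpNorm f 1 μ := by
  classical
  have := hG.countable
  have hm : ∀ y : H.Vertex, Measurable fun ξ => if level y = n ∧ ξ ∈ ball y then (1 : ℝ≥0∞) else 0 := by
    intro y
    refine (Measurable.ite ?_ measurable_const measurable_const)
    by_cases h : level y = n
    · simpa [h] using (isOpen_ball y).measurableSet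
    · simp [h]
  rw [eLpNorm_one_eq_lintegral_enorm, eLpNorm_one_eq_lintegral_enorm]
  calc ∫⁻ ξ, ‖traceApprox Ψ (H.poisson μ f) n ξ‖ₑ ∂μ
      ≤ ∫⁻ ξ in univ, levelSum ball n (fun x => ‖H.poisson μ f x‖ₑ) ξ ∂μ := by
        rw [Measure.restrict_univ]
        refine lintegral_mono fun ξ => ?_
        have := hG.enorm_traceApprox_sub_le (Ψ := Ψ) (u := H.poisson μ f) (n := n) (ξ := ξ) (c := 0)
          (B := levelSum ball n (fun x => ‖H.poisson μ f x‖ₑ) ξ) fun y hy hξ => by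
            rw [sub_zero]; exact le_levelSum hy hξ fun x => ‖H.poisson μ f x‖ₑ
        rwa [sub_zero] at this
    _ ≤ ∑' y, ∫⁻ ξ, (if level y = n ∧ ξ ∈ ball y then 1 else 0) * ‖f ξ‖ₑ ∂μ := by
        rw [hG.lintegral_levelSum]
        refine ENNReal.tsum_le_tsum fun y => ?_
        by_cases h : level y = n
        · rw [indicator_of_mem (by exact h), inter_univ]
          have e : ∀ ξ, (if level y = n ∧ ξ ∈ ball y then (1 : ℝ≥0∞) else 0) * ‖f ξ‖ₑ
              = (ball y).indicator (fun ξ => ‖f ξ‖ₑ) ξ := by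
            intro ξ
            by_cases hξ : ξ ∈ ball y <;> simp [h, hξ]
          simp_rw [e]
          rw [lintegral_indicator (isOpen_ball y).measurableSet]
          have h1 := hG.enorm_poisson_sub_le hf y 0
          simp only [sub_zero] at h1
          calc μ (ball y) * ‖H.poisson μ f y‖ₑ
              ≤ μ (ball y) * ((μ (ball y))⁻¹ * ∫⁻ ξ in ball y, ‖f ξ‖ₑ ∂μ) := by gcongr
            _ = _ := by
              rw [← mul_assoc, ENNReal.mul_inv_cancel (hG.pos y).ne' (hG.measure_ne_top _),
                one_mul]
        · rw [indicator_of_notMem (by exact h)]; exact zero_le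
    _ = ∫⁻ ξ, levelSum ball n 1 ξ * ‖f ξ‖ₑ ∂μ := by
        have hm' : ∀ y : H.Vertex, AEMeasurable
            (fun ξ => (if level y = n ∧ ξ ∈ ball y then (1 : ℝ≥0∞) else 0) * ‖f ξ‖ₑ) μ :=
          fun y => (hm y).aemeasurable.mul hf.1.enorm
        rw [← lintegral_tsum hm']
        simp_rw [ENNReal.tsum_mul_right]
        rfl
    _ ≤ ∫⁻ ξ, N * ‖f ξ‖ₑ ∂μ := by
        refine lintegral_mono fun ξ => mul_le_mul_left ?_ _
        obtain ⟨S, hS, -, h⟩ := hG.levelSum_eq_sum hG.ball_subset n ξ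
        rw [h]
        simpa using hS
    _ = _ := lintegral_const_mul' _ _ (by simp)

/-- At ξ the approximation averages φ only over balls of radius 2^{-n} containing ξ, so continuity
gives pointwise convergence, and 2‖φ‖ is an integrable majorant. -/
lemma tendsto_eLpNorm_traceApprox_poisson_sub (hG : FillingGeometry H μ Q E C N) [BorelSpace Z]
    [Nonempty Z] (φ : BoundedContinuousFunction Z ℂ) :
    Tendsto (fun n => eLpNorm (traceApprox Ψ (H.poisson μ φ) n - ⇑φ) 1 μ) atTop (𝓝 0) := by
  have hfinm := hG.isFiniteMeasure
  have hφi : Integrable φ μ := φ.integrable μ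
  simp_rw [eLpNorm_one_eq_lintegral_enorm]
  have h0 : ∫⁻ _ : Z, (0 : ℝ≥0∞) ∂μ = 0 := lintegral_zero
  rw [← h0]
  have hpois : ∀ (y : H.Vertex) (c : ℂ) (B : ℝ≥0∞), (∀ ξ ∈ ball y, ‖φ ξ - c‖ₑ ≤ B) →
      ‖H.poisson μ φ y - c‖ₑ ≤ B := by
    intro y c B h
    refine (hG.enorm_poisson_sub_le hφi y c).trans ?_
    calc (μ (ball y))⁻¹ * ∫⁻ ξ in ball y, ‖φ ξ - c‖ₑ ∂μ
        ≤ (μ (ball y))⁻¹ * ∫⁻ ξ in ball y, B ∂μ := by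
          gcongr 1
          exact setLIntegral_mono' (isOpen_ball y).measurableSet h
      _ = B := by
          rw [setLIntegral_const, mul_comm B, ← mul_assoc,
            ENNReal.inv_mul_cancel (hG.pos y).ne' (hG.measure_ne_top _), one_mul]
  refine tendsto_lintegral_of_dominated_convergence' (fun _ => 2 * ‖φ‖ₑ) (fun n => ?_)
    (fun n => Eventually.of_forall fun ξ => ?_) ?_ (Eventually.of_forall fun ξ => ?_)
  · exact ((hG.continuous_traceApprox Ψ _ n).sub φ.continuous).measurable.enorm.aemeasurable
  · refine hG.enorm_traceApprox_sub_le fun y _ _ => hpois y _ _ fun η _ => ?_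
    have hle : ∀ z, ‖φ z‖ₑ ≤ ‖φ‖ₑ := fun z => by
      rw [← ofReal_norm, ← ofReal_norm]
      exact ENNReal.ofReal_le_ofReal (φ.norm_coe_le_norm z)
    rw [two_mul]
    exact enorm_sub_le.trans (add_le_add (hle η) (hle ξ))
  · rw [lintegral_const]
    exact ENNReal.mul_ne_top (ENNReal.mul_ne_top (by simp) enorm_ne_top) (hG.measure_ne_top _)
  · rw [ENNReal.tendsto_nhds_zero]
    intro ε hε
    obtain ⟨ρ, hρ, hφρ⟩ := EMetric.continuous_iff.1 φ.continuous ξ ε hε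
    have hpow : Tendsto (fun n : ℕ => ENNReal.ofReal (2 * (2 ^ n)⁻¹)) atTop (𝓝 0) := by
      rw [← ENNReal.ofReal_zero]
      refine ENNReal.tendsto_ofReal ?_
      have h := (tendsto_pow_atTop_nhds_zero_of_lt_one (r := (2 : ℝ)⁻¹) (by norm_num)
        (by norm_num)).const_mul 2
      simpa using h
    filter_upwards [hpow.eventually_lt_const hρ, eventually_ge_atTop 1] with n hn hn1
    refine hG.enorm_traceApprox_sub_le fun y hy hξ => hpois y _ _ fun η hη => ?_
    rw [← edist_eq_enorm_sub]
    refine (hφρ η ?_).le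
    refine lt_of_le_of_lt ?_ hn
    rw [edist_dist]
    refine ENNReal.ofReal_le_ofReal ?_
    rw [ball_eq_of_pos (by omega), Metric.mem_ball, hy] at hξ hη
    have := dist_triangle_right η ξ (center y)
    linarith

/-- T_n P is uniformly bounded on L¹ and converges to the identity on the dense set of bounded
continuous functions, hence everywhere. The trace of Pf exists by the general theorem and must be
this L¹ limit. -/
lemma hasTrace_poisson (hG : FillingGeometry H μ Q E C N) [BorelSpace Z] [Nonempty Z]
    [BoundedSpace Z]
    {s p : ℝ} {q : ℝ≥0∞} (hQ : 0 < Q) (hs : 0 < s) (hp : 0 < p) (hq : 0 < q)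
    (hpQ : Q / (Q + s) < p) (hqQ : ENNReal.ofReal (Q / (Q + s)) < q) (Ψ : LipschitzPartition H)
    {f : Z → ℂ} (hf : Integrable f μ) (hJ : jNorm μ s p q (absD (H.poisson μ f)) < ∞) :
    HasTrace μ Ψ (H.poisson μ f) f := by
  have hfinm := hG.isFiniteMeasure
  obtain ⟨g, hg⟩ := hG.exists_hasTrace Ψ hQ hs hp hq hpQ hqQ hJ
  refine hg.congr ?_
  have hTm : ∀ h : Z → ℂ, ∀ n, AEStronglyMeasurable (traceApprox Ψ (H.poisson μ h) n) μ :=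
    fun h n => (hG.continuous_traceApprox Ψ _ n).aestronglyMeasurable
  have hloc : ∀ {h : Z → ℂ}, Integrable h μ → LocInt μ h := fun hh A _ _ => hh.integrableOn
  have hL1 : Tendsto (fun n => eLpNorm (traceApprox Ψ (H.poisson μ f) n - f) 1 μ) atTop (𝓝 0) := by
    rw [ENNReal.tendsto_nhds_zero]
    intro ε hε
    -- The error f - φ enters once with the factor N, through T_n P, and once by itself: N + 1 times
    -- in all. The other half of ε is for φ.
    have hε' : ε / ((N + 1 : ℝ≥0∞) * 2) ≠ 0 :=
      (ENNReal.div_pos hε.ne' (ENNReal.mul_ne_top (by simp) (by simp))).ne'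
    obtain ⟨φ, hφ, -⟩ := hf.exists_boundedContinuous_lintegral_sub_le hε'
    have hφi : Integrable φ μ := φ.integrable μ
    have hd : eLpNorm (f - ⇑φ) 1 μ ≤ ε / ((N + 1 : ℝ≥0∞) * 2) := by
      rw [eLpNorm_one_eq_lintegral_enorm]
      exact hφ
    have h2 : (0 : ℝ≥0∞) < ε / 2 := ENNReal.half_pos hε.ne'
    filter_upwards [ENNReal.tendsto_nhds_zero.1
      (hG.tendsto_eLpNorm_traceApprox_poisson_sub (Ψ := Ψ) φ) _ h2] with n hn
    have e : traceApprox Ψ (H.poisson μ f) n - f = traceApprox Ψ (H.poisson μ (f - ⇑φ)) n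
        + ((traceApprox Ψ (H.poisson μ φ) n - ⇑φ) - (f - ⇑φ)) := by
      have : f = (f - ⇑φ) + ⇑φ := by abel
      nth_rewrite 1 [this]
      rw [poisson_add (hloc (hf.sub hφi)) (hloc hφi), hG.traceApprox_add]
      abel
    rw [e]
    calc _ ≤ eLpNorm (traceApprox Ψ (H.poisson μ (f - ⇑φ)) n) 1 μ
          + (eLpNorm (traceApprox Ψ (H.poisson μ φ) n - ⇑φ) 1 μ + eLpNorm (f - ⇑φ) 1 μ) := by
          have m1 := hTm (f - ⇑φ) n
          have m2 := (hTm φ n).sub hφi.1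
          have m3 := (hf.sub hφi).1
          refine (eLpNorm_add_le m1 (m2.sub m3) le_rfl).trans ?_
          gcongr
          exact eLpNorm_sub_le m2 m3 le_rfl
      _ ≤ N * eLpNorm (f - ⇑φ) 1 μ + (ε / 2 + eLpNorm (f - ⇑φ) 1 μ) := by
          gcongr
          exact hG.eLpNorm_traceApprox_poisson_le (hf.sub hφi) n
      _ = (N + 1) * eLpNorm (f - ⇑φ) 1 μ + ε / 2 := by ring
      _ ≤ (N + 1) * (ε / ((N + 1 : ℝ≥0∞) * 2)) + ε / 2 := by gcongr
      _ = ε / 2 + ε / 2 := by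
          congr 1
          rw [ENNReal.div_eq_inv_mul, ENNReal.mul_inv (Or.inr (by simp)) (Or.inr (by simp)),
            ← mul_assoc, ← mul_assoc, ENNReal.mul_inv_cancel (by simp) (by simp), one_mul,
            ENNReal.div_eq_inv_mul]
      _ = ε := ENNReal.add_halves ε
  have hzero : eLpNorm (g - f) 1 μ = 0 := by
    refine le_antisymm ?_ zero_le
    have := hg.tendsto_L1.add hL1
    rw [add_zero] at this
    refine ge_of_tendsto' this fun n => ?_
    have e : g - f = (traceApprox Ψ (H.poisson μ f) n - f)
        - (traceApprox Ψ (H.poisson μ f) n - g) := by abel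
    rw [e, add_comm]
    exact eLpNorm_sub_le ((hTm f n).sub hf.1) ((hTm f n).sub hg.integrable.1) le_rfl
  rw [eLpNorm_eq_zero_iff (hg.integrable.1.sub hf.1) (by simp)] at hzero
  filter_upwards [hzero] with ξ hξ
  exact sub_eq_zero.1 hξ

end FillingGeometry

end TriebelLizorkin

namespace TriebelLizorkin

/-! ### Quotient quasi-norms -/

section Quotient

variable {E F : Type*} [AddCommGroup E] [Module ℂ E] [AddCommGroup F] [Module ℂ F]

/-- A quasi-norm, except that non-zero vectors may have quasi-norm zero. -/
structure IsQuasiSeminorm (N : E → ℝ) : Prop where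
  nonneg : ∀ x, 0 ≤ N x
  smul : ∀ (c : ℂ) (x : E), N (c • x) = ‖c‖ * N x
  add_le : ∃ K : ℝ, 0 ≤ K ∧ ∀ x y, N (x + y) ≤ K * (N x + N y)

namespace IsQuasiSeminorm

variable {N : E → ℝ} {S : Submodule ℂ E}

lemma map_zero (hN : IsQuasiSeminorm N) : N 0 = 0 := by
  simpa using hN.smul 0 0

lemma isQuasiNorm (hN : IsQuasiSeminorm N) (h : ∀ x, N x = 0 → x = 0) : IsQuasiNorm N where
  nonneg := hN.nonneg
  eq_zero_iff x := ⟨h x, fun hx => by rw [hx, hN.map_zero]⟩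
  smul := hN.smul
  add_le := let ⟨K, _, hK⟩ := hN.add_le; ⟨K, hK⟩

lemma quotientNorm_nonneg (hN : IsQuasiSeminorm N) (x : E ⧸ S) : 0 ≤ quotientNorm S N x :=
  Real.iInf_nonneg fun v => hN.nonneg v

lemma quotientNorm_mk_le (hN : IsQuasiSeminorm N) (v : E) :
    quotientNorm S N (Submodule.Quotient.mk v) ≤ N v :=
  ciInf_le (f := fun w : {w : E // (Submodule.Quotient.mk w : E ⧸ S) = Submodule.Quotient.mk v} =>
    N w) ⟨0, by rintro _ ⟨w, rfl⟩; exact hN.nonneg w⟩ ⟨v, rfl⟩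

lemma exists_lt_of_quotientNorm_lt {x : E ⧸ S} {b : ℝ} (h : quotientNorm S N x < b) :
    ∃ v, (Submodule.Quotient.mk v : E ⧸ S) = x ∧ N v < b := by
  have : Nonempty {v : E // (Submodule.Quotient.mk v : E ⧸ S) = x} :=
    let ⟨v, hv⟩ := Submodule.Quotient.mk_surjective S x; ⟨⟨v, hv⟩⟩
  obtain ⟨v, hv⟩ := exists_lt_of_ciInf_lt h
  exact ⟨v, v.2, hv⟩

lemma quotientNorm_smul_le (hN : IsQuasiSeminorm N) (c : ℂ) (x : E ⧸ S) :
    quotientNorm S N (c • x) ≤ ‖c‖ * quotientNorm S N x := by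
  refine le_of_forall_pos_le_add fun ε hε => ?_
  -- The infimum need not be attained, hence the margin; the + 1 covers c = 0.
  obtain ⟨v, hv, hv'⟩ := exists_lt_of_quotientNorm_lt
    (lt_add_of_pos_right (quotientNorm S N x) (show 0 < ε / (‖c‖ + 1) by positivity))
  rw [← hv, ← Submodule.Quotient.mk_smul]
  refine (hN.quotientNorm_mk_le _).trans ?_
  rw [hN.smul, hv]
  have h1 : ‖c‖ * (ε / (‖c‖ + 1)) ≤ ε := by
    rw [mul_div_assoc', div_le_iff₀ (by positivity)]
    nlinarith [norm_nonneg c]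
  nlinarith [norm_nonneg c, mul_le_mul_of_nonneg_left hv'.le (norm_nonneg c)]

lemma quotient (hN : IsQuasiSeminorm N) (S : Submodule ℂ E) :
    IsQuasiSeminorm (quotientNorm S N) where
  nonneg := hN.quotientNorm_nonneg
  smul c x := by
    refine le_antisymm (hN.quotientNorm_smul_le c x) ?_
    rcases eq_or_ne c 0 with rfl | hc
    · simpa using hN.quotientNorm_nonneg _
    · have h := hN.quotientNorm_smul_le c⁻¹ (c • x)
      rw [smul_smul, inv_mul_cancel₀ hc, one_smul, norm_inv] at h
      have hc' : 0 < ‖c‖ := norm_pos_iff.2 hc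
      rwa [inv_mul_eq_div, le_div_iff₀ hc', mul_comm] at h
  add_le := by
    obtain ⟨K, hK, h⟩ := hN.add_le
    refine ⟨K, hK, fun x y => le_of_forall_pos_le_add fun ε hε => ?_⟩
    have hδ : 0 < ε / (2 * (K + 1)) := by positivity
    obtain ⟨v, hv, hv'⟩ := exists_lt_of_quotientNorm_lt
      (lt_add_of_pos_right (quotientNorm S N x) hδ)
    obtain ⟨w, hw, hw'⟩ := exists_lt_of_quotientNorm_lt
      (lt_add_of_pos_right (quotientNorm S N y) hδ)
    have h1 : K * (2 * (ε / (2 * (K + 1)))) ≤ ε := by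
      rw [show K * (2 * (ε / (2 * (K + 1)))) = K * ε / (K + 1) by field_simp,
        div_le_iff₀ (by positivity)]
      nlinarith
    have h2 : quotientNorm S N (x + y) ≤ N (v + w) := by
      rw [← hv, ← hw, ← Submodule.Quotient.mk_add]
      exact hN.quotientNorm_mk_le _
    have h3 := h v w
    nlinarith [mul_le_mul_of_nonneg_left (add_le_add hv'.le hw'.le) hK]

lemma quotientNorm_mk_eq (hS : ∀ v w, v - w ∈ S → N v = N w) (v : E) :
    quotientNorm S N (Submodule.Quotient.mk v) = N v := by
  have key : ∀ w : {w : E // (Submodule.Quotient.mk w : E ⧸ S) = Submodule.Quotient.mk v},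
      N w = N v := fun w => hS _ _ ((Submodule.Quotient.eq S).1 w.2)
  have : Nonempty {w : E // (Submodule.Quotient.mk w : E ⧸ S) = Submodule.Quotient.mk v} :=
    ⟨⟨v, rfl⟩⟩
  unfold quotientNorm
  simp only [key]
  exact ciInf_const

/-- Boundedness both ways needs checking only on representatives, with any convenient choice of
partner. Definiteness is assumed on the target side alone; the bounds transport it to the source. -/
lemma isQuasiNormIso {N' : F → ℝ} {W : Submodule ℂ F} (hN : IsQuasiSeminorm N)
    (hN' : IsQuasiSeminorm N') (hdef : ∀ y, quotientNorm W N' y = 0 → y = 0)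
    (e : (E ⧸ S) ≃ₗ[ℂ] F ⧸ W) {A : ℝ} (hA : 0 ≤ A)
    (h₁ : ∀ u, ∃ f, e (Submodule.Quotient.mk u) = Submodule.Quotient.mk f ∧ N' f ≤ A * N u)
    (h₂ : ∀ f, ∃ u, e (Submodule.Quotient.mk u) = Submodule.Quotient.mk f ∧ N u ≤ A * N' f) :
    IsQuasiNormIso (quotientNorm S N) (quotientNorm W N') e := by
  have hmul : ∀ {a b : ℝ}, (∀ ε > 0, a ≤ A * (b + ε)) → a ≤ A * b := by
    intro a b h
    refine le_of_forall_pos_le_add fun ε hε => ?_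
    have h1 := h (ε / (A + 1)) (by positivity)
    have h2 : A * (ε / (A + 1)) ≤ ε := by
      rw [mul_div_assoc', div_le_iff₀ (by positivity)]
      nlinarith
    linarith
  have b₁ : ∀ x, quotientNorm W N' (e x) ≤ A * quotientNorm S N x := by
    refine fun x => hmul fun ε hε => ?_
    obtain ⟨v, hv, hv'⟩ := exists_lt_of_quotientNorm_lt
      (lt_add_of_pos_right (quotientNorm S N x) hε)
    obtain ⟨f, hf, hf'⟩ := h₁ v
    rw [hv] at hf
    rw [hf]
    exact (hN'.quotientNorm_mk_le f).trans (hf'.trans (mul_le_mul_of_nonneg_left hv'.le hA))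
  have b₂ : ∀ x, quotientNorm S N x ≤ A * quotientNorm W N' (e x) := by
    refine fun x => hmul fun ε hε => ?_
    obtain ⟨f, hf, hf'⟩ := exists_lt_of_quotientNorm_lt
      (lt_add_of_pos_right (quotientNorm W N' (e x)) hε)
    obtain ⟨u, hu, hu'⟩ := h₂ f
    have : Submodule.Quotient.mk u = x := e.injective (hu.trans hf)
    rw [← this]
    refine (hN.quotientNorm_mk_le u).trans (hu'.trans (mul_le_mul_of_nonneg_left ?_ hA))
    rw [this]
    exact hf'.le
  refine ⟨(hN.quotient S).isQuasiNorm fun x hx => ?_, (hN'.quotient W).isQuasiNorm hdef, A,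
    fun x => ⟨b₁ x, b₂ x⟩⟩
  have h1 := b₁ x
  rw [hx, mul_zero] at h1
  exact e.map_eq_zero_iff.1 (hdef _ (le_antisymm h1 (hN'.quotientNorm_nonneg _)))

end IsQuasiSeminorm

end Quotient

/-! ### The trace isomorphisms -/

variable {Z : Type*} [MetricSpace Z] [MeasurableSpace Z] {H : HyperbolicFilling Z} {μ : Measure Z}
  {Q : ℝ} {E : H.Vertex → Set Z} {C : ℝ≥0} {N : ℕ}

/-- The standing assumptions on the exponents. -/
structure AdmissibleExponents (Q s p : ℝ) (q : ℝ≥0∞) : Prop where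
  Q_pos : 0 < Q
  s_pos : 0 < s
  p_pos : 0 < p
  q_pos : 0 < q
  lt_p : Q / (Q + s) < p
  lt_q : ENNReal.ofReal (Q / (Q + s)) < q

namespace FillingGeometry

variable [BorelSpace Z] {s p : ℝ} {q : ℝ≥0∞}

lemma integrable_of_locInt [BoundedSpace Z] {f : Z → ℂ}
    (hf : LocInt μ f) : Integrable f μ := by
  simpa using hf univ (Bornology.IsBounded.all _) MeasurableSet.univ

lemma locInt_of_integrable {f : Z → ℂ} (hf : Integrable f μ) : LocInt μ f :=
  fun _ _ _ => hf.integrableOn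

lemma poisson_congr {f g : Z → ℂ} (h : f =ᵐ[μ] g) : H.poisson μ f = H.poisson μ g := by
  ext x
  rw [poisson, poisson, setAverage_eq, setAverage_eq, integral_congr_ae (ae_restrict_of_ae h)]

lemma poisson_const (hG : FillingGeometry H μ Q E C N) (c : ℂ) :
    H.poisson μ (fun _ => c) = fun _ => c := by
  have := hG.isFiniteMeasure
  ext x
  exact setAverage_const (hG.pos x).ne' (hG.measure_ne_top _) c

lemma poisson_root (f : Z → ℂ) : H.poisson μ f Vertex.root = ⨍ ξ, f ξ ∂μ := by
  simp [poisson, ball]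

lemma exists_adj_lower (hG : FillingGeometry H μ Q E C N) {x : H.Vertex} {n : ℕ}
    (hx : level x = n + 1) : ∃ y, level y = n ∧ H.graph.Adj x y := by
  obtain ⟨ξ, hξ⟩ := hG.nonempty_ball x
  obtain ⟨y, hy, hyξ⟩ := hG.cover n ξ
  refine ⟨y, hy, ?_, by omega, by omega, ⟨ξ, hξ, hyξ⟩⟩
  rintro rfl
  omega

/-- A sequence is controlled pointwise by its discrete derivative. -/
lemma enorm_sub_root_le (hG : FillingGeometry H μ Q E C N) (hE : AdmissibleExponents Q s p q)
    (x : H.Vertex) : ∃ K : ℝ≥0, ∀ w : H.Vertex → ℂ,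
      ‖w x - w Vertex.root‖ₑ ≤ K * jNorm μ s p q (absD w) := by
  obtain ⟨n, hn⟩ : ∃ n, level x = n := ⟨_, rfl⟩
  induction n generalizing x with
  | zero =>
    rw [level_eq_zero_iff.1 hn]
    exact ⟨0, fun w => by simp⟩
  | succ n ih =>
    obtain ⟨y, hy, hadj⟩ := hG.exists_adj_lower hn
    obtain ⟨K₁, h₁⟩ := ih y hy
    obtain ⟨K₂, h₂⟩ := hG.le_jNorm s hE.p_pos hE.q_pos x
    refine ⟨K₁ + K₂, fun w => ?_⟩
    have h3 := (enorm_sub_le_absD hadj w).trans (h₂ (absD w))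
    have h4 := h₁ w
    rw [← edist_eq_enorm_sub] at h3 h4 ⊢
    rw [ENNReal.coe_add, add_mul, add_comm]
    rw [edist_comm] at h3
    exact (edist_triangle _ _ _).trans (add_le_add h3 h4)

lemma eq_root_of_jNorm_absD_eq_zero (hG : FillingGeometry H μ Q E C N)
    (hE : AdmissibleExponents Q s p q) {w : H.Vertex → ℂ} (h : jNorm μ s p q (absD w) = 0) :
    w = fun _ => w Vertex.root := by
  ext x
  obtain ⟨K, hK⟩ := hG.enorm_sub_root_le hE x
  have := hK w
  rw [h, mul_zero, nonpos_iff_eq_zero, enorm_eq_zero, sub_eq_zero] at this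
  exact this

/-- Written for a linear map T into sequences so as to serve both D, with T the inclusion, and the
function space, with T the Poisson extension. -/
lemma isQuasiSeminorm_jNorm_absD (hE : AdmissibleExponents Q s p q) {V : Type*} [AddCommGroup V]
    [Module ℂ V] (T : V → H.Vertex → ℂ) (hadd : ∀ v w, T (v + w) = T v + T w)
    (hsmul : ∀ (c : ℂ) v, T (c • v) = c • T v) (hfin : ∀ v, jNorm μ s p q (absD (T v)) < ∞) :
    IsQuasiSeminorm fun v => (jNorm μ s p q (absD (T v))).toReal where
  nonneg _ := ENNReal.toReal_nonneg
  smul c v := by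
    have h : absD (c • T v) = fun x => ‖c‖ₑ * absD (T v) x := funext (absD_smul c _)
    simp only [hsmul]
    rw [h, jNorm_const_mul μ s hE.p_pos hE.q_pos (by simp), ENNReal.toReal_mul]
    simp
  add_le := by
    obtain ⟨K₃, h₃⟩ := H.exists_absD_add_le
    obtain ⟨K₄, h₄⟩ := H.exists_jNorm_add_le μ s hE.p_pos hE.q_pos
    refine ⟨K₃ * K₄, by positivity, fun v w => ?_⟩
    have h : jNorm μ s p q (absD (T (v + w)))
        ≤ K₃ * (K₄ * (jNorm μ s p q (absD (T v)) + jNorm μ s p q (absD (T w)))) := by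
      rw [hadd]
      refine (jNorm_mono μ s hE.p_pos q (h₃ _ _)).trans ?_
      rw [jNorm_const_mul μ s hE.p_pos hE.q_pos (by simp)]
      exact mul_le_mul_right (h₄ _ _) _
    have h' := ENNReal.toReal_mono (ENNReal.mul_ne_top (by simp) (ENNReal.mul_ne_top (by simp)
      (ENNReal.add_ne_top.2 ⟨(hfin v).ne, (hfin w).ne⟩))) h
    rw [ENNReal.toReal_mul, ENNReal.toReal_mul, ENNReal.toReal_add (hfin v).ne (hfin w).ne] at h'
    simpa [mul_assoc] using h'

lemma isQuasiSeminorm_diffNorm (hE : AdmissibleExponents Q s p q) :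
    IsQuasiSeminorm (H.diffNorm μ s hE.p_pos hE.q_pos) :=
  isQuasiSeminorm_jNorm_absD hE (fun u : H.diffSpace μ s hE.p_pos hE.q_pos => u.1)
    (fun _ _ => rfl) (fun _ _ => rfl) fun u => u.2.1

variable [BoundedSpace Z]

lemma isQuasiSeminorm_funNorm (hE : AdmissibleExponents Q s p q) :
    IsQuasiSeminorm (H.funNorm μ s hE.p_pos hE.q_pos) :=
  isQuasiSeminorm_jNorm_absD hE (fun f : H.funSpace μ s hE.p_pos hE.q_pos => H.poisson μ f.1)
    (fun f g => poisson_add f.2.1 g.2.1) (fun c f => poisson_smul μ c f.1) fun f => f.2.2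

lemma isQuasiSeminorm_funNormMean
    (hE : AdmissibleExponents Q s p q) :
    IsQuasiSeminorm (H.funNormMean μ s hE.p_pos hE.q_pos) := by
  have h := isQuasiSeminorm_funNorm (H := H) (μ := μ) hE
  have hmean : ∀ f : H.funSpace μ s hE.p_pos hE.q_pos, ⨍ ξ, f.1 ξ ∂μ
      = H.poisson μ f.1 Vertex.root := fun f => (poisson_root f.1).symm
  refine ⟨fun f => add_nonneg (norm_nonneg _) (h.nonneg f), fun c f => ?_, ?_⟩
  · rw [funNormMean, funNormMean, h.smul, hmean, hmean, mul_add]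
    congr 1
    rw [show (c • f).1 = c • f.1 from rfl, poisson_smul, Pi.smul_apply, norm_smul]
  · obtain ⟨K, hK, hK'⟩ := h.add_le
    refine ⟨K + 1, by positivity, fun f g => ?_⟩
    simp only [funNormMean, hmean]
    have h1 := hK' f g
    have h2 : H.poisson μ (f + g).1 Vertex.root
        = H.poisson μ f.1 Vertex.root + H.poisson μ g.1 Vertex.root := by
      rw [show (f + g).1 = f.1 + g.1 from rfl, poisson_add f.2.1 g.2.1]; rfl
    rw [h2]
    have h3 := norm_add_le (H.poisson μ f.1 Vertex.root) (H.poisson μ g.1 Vertex.root)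
    nlinarith [h.nonneg f, h.nonneg g, norm_nonneg (H.poisson μ f.1 Vertex.root),
      norm_nonneg (H.poisson μ g.1 Vertex.root)]

lemma exists_trace_mem (hG : FillingGeometry H μ Q E C N) (hE : AdmissibleExponents Q s p q)
    (Ψ : LipschitzPartition H) (u : H.diffSpace μ s hE.p_pos hE.q_pos) :
    ∃ f : H.funSpace μ s hE.p_pos hE.q_pos, HasTrace μ Ψ u.1 f.1 := by
  obtain ⟨hQ, hs, hp, hq, hpQ, hqQ⟩ := hE
  obtain ⟨f, hf⟩ := hG.exists_hasTrace Ψ hQ hs hp hq hpQ hqQ u.2.1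
  obtain ⟨K, hK⟩ := hG.jNorm_absD_poisson_trace_le hQ hs hp hq hpQ hqQ Ψ
  exact ⟨⟨f, locInt_of_integrable hf.integrable,
    (hK hf).trans_lt (ENNReal.mul_lt_top (by simp) u.2.1)⟩, hf⟩

/-- The isomorphism induced by the trace, for a space `S` of sequences and a space `W` of functions
that correspond to each other. -/
lemma exists_traceEquiv (hG : FillingGeometry H μ Q E C N) (hE : AdmissibleExponents Q s p q)
    (Ψ : LipschitzPartition H) (W : Submodule ℂ (H.funSpace μ s hE.p_pos hE.q_pos))
    (S : Submodule ℂ (H.diffSpace μ s hE.p_pos hE.q_pos))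
    (hW : H.aeZero μ s hE.p_pos hE.q_pos ≤ W)
    (hS : ∀ (u : H.diffSpace μ s hE.p_pos hE.q_pos) (f : H.funSpace μ s hE.p_pos hE.q_pos),
      HasTrace μ Ψ u.1 f.1 → (u ∈ S ↔ f ∈ W))
    (hsurj : ∀ f : H.funSpace μ s hE.p_pos hE.q_pos,
      ∃ (u : H.diffSpace μ s hE.p_pos hE.q_pos) (g : H.funSpace μ s hE.p_pos hE.q_pos),
        HasTrace μ Ψ u.1 g.1 ∧ g - f ∈ W) :
    ∃ e : (H.diffSpace μ s hE.p_pos hE.q_pos ⧸ S) ≃ₗ[ℂ]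
        (H.funSpace μ s hE.p_pos hE.q_pos ⧸ W),
      ∀ (u : H.diffSpace μ s hE.p_pos hE.q_pos) (f : H.funSpace μ s hE.p_pos hE.q_pos),
        HasTrace μ Ψ u.1 f.1 → e (Submodule.Quotient.mk u) = Submodule.Quotient.mk f := by
  -- The chosen traces are not linear in u, but by uniqueness almost everywhere they become so
  -- modulo W, which contains the null functions.
  choose T hT using hG.exists_trace_mem hE Ψ
  have huniq : ∀ (u : H.Vertex → ℂ) (f g : H.funSpace μ s hE.p_pos hE.q_pos),
      HasTrace μ Ψ u f.1 → HasTrace μ Ψ u g.1 →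
        (Submodule.Quotient.mk f : H.funSpace μ s hE.p_pos hE.q_pos ⧸ W)
          = Submodule.Quotient.mk g := by
    intro u f g hf hg
    rw [Submodule.Quotient.eq]
    refine hW ?_
    have h : f.1 - g.1 =ᵐ[μ] 0 := by
      filter_upwards [hf.ae_eq hg] with ξ hξ
      simp [hξ]
    exact h
  let L : H.diffSpace μ s hE.p_pos hE.q_pos →ₗ[ℂ] H.funSpace μ s hE.p_pos hE.q_pos ⧸ W :=
    { toFun := fun u => Submodule.Quotient.mk (T u)
      map_add' := fun u v => by
        rw [← Submodule.Quotient.mk_add]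
        exact huniq (u + v).1 _ _ (hT _) (hG.hasTrace_add (hT u) (hT v))
      map_smul' := fun c u => by
        rw [RingHom.id_apply, ← Submodule.Quotient.mk_smul]
        exact huniq (c • u).1 _ _ (hT _) (hG.hasTrace_smul c (hT u)) }
  have hL : ∀ (u : H.diffSpace μ s hE.p_pos hE.q_pos) (f : H.funSpace μ s hE.p_pos hE.q_pos),
      HasTrace μ Ψ u.1 f.1 → L u = Submodule.Quotient.mk f := fun u f hf =>
    huniq u.1 _ _ (hT u) hf
  have hker : S = LinearMap.ker L := by
    ext u
    rw [LinearMap.mem_ker, hS u _ (hT u), ← Submodule.Quotient.mk_eq_zero W]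
    rfl
  have hsurj' : Function.Surjective L := by
    intro y
    obtain ⟨f, rfl⟩ := Submodule.Quotient.mk_surjective W y
    obtain ⟨u, g, hg, hgf⟩ := hsurj f
    exact ⟨u, (hL u g hg).trans ((Submodule.Quotient.eq W).2 hgf)⟩
  exact ⟨(Submodule.quotEquivOfEq S _ hker).trans (L.quotKerEquivOfSurjective hsurj'),
    fun u f hf => hL u f hf⟩

end FillingGeometry

end TriebelLizorkin

/-! ### The kernel of the trace and the two isomorphisms -/

namespace TriebelLizorkin

variable {Z : Type*} [MetricSpace Z] [MeasurableSpace Z] {H : HyperbolicFilling Z} {μ : Measure Z}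
  {Q : ℝ} {E : H.Vertex → Set Z} {C : ℝ≥0} {N : ℕ}

namespace FillingGeometry

variable [BorelSpace Z] {s p : ℝ} {q : ℝ≥0∞} {Ψ : LipschitzPartition H}

lemma toReal_le_mul {a b : ℝ≥0∞} {K : ℝ≥0} (h : a ≤ K * b) (hb : b < ∞) :
    a.toReal ≤ K * b.toReal := by
  have := ENNReal.toReal_mono (ENNReal.mul_ne_top (by simp) hb.ne) h
  simpa using this

lemma seqSpaceZero_le_diffSpace (hG : FillingGeometry H μ Q E C N)
    (hE : AdmissibleExponents Q s p q) :
    H.seqSpaceZero μ s hE.p_pos hE.q_pos ≤ H.diffSpace μ s hE.p_pos hE.q_pos := by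
  rintro u ⟨hu, hu0⟩
  obtain ⟨K, hK⟩ := hG.jNorm_absD_le hE.Q_pos hE.s_pos hE.p_pos hE.q_pos hE.lt_p hE.lt_q
  have hu' : jNorm μ s p q (fun x => ‖u x‖ₑ) < ∞ := hu
  exact ⟨(hK u).trans_lt (ENNReal.mul_lt_top (by simp) hu'), hu0⟩

/-- A trace is almost everywhere zero exactly for the sequences in `J^s_{p,q}(X)`. -/
lemma trace_eq_zero_iff (hG : FillingGeometry H μ Q E C N) (hE : AdmissibleExponents Q s p q)
    {u : H.Vertex → ℂ} {f : Z → ℂ} (hu : jNorm μ s p q (absD u) < ∞) (hf : HasTrace μ Ψ u f) :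
    f =ᵐ[μ] 0 ↔ u ∈ H.seqSpace μ s hE.p_pos hE.q_pos := by
  obtain ⟨hQ, hs, hp, hq, hpQ, hqQ⟩ := hE
  refine ⟨fun h => ?_, fun h => hG.trace_eq_zero hQ hs hp hq hpQ hqQ hf h⟩
  obtain ⟨K, hK⟩ := hG.jNorm_poisson_trace_sub_le hQ hs hp hq hpQ hqQ Ψ
  have h1 := hK hf
  -- With f = 0 the central estimate bounds 0 - u, that is, u itself.
  rw [poisson_congr h, show (0 : Z → ℂ) = fun _ => 0 from rfl, hG.poisson_const] at h1
  simp only [zero_sub, enorm_neg] at h1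
  exact h1.trans_lt (ENNReal.mul_lt_top (by simp) hu)

lemma traceApprox_const (hG : FillingGeometry H μ Q E C N) (c : ℂ) (n : ℕ) :
    traceApprox Ψ (fun _ => c) n = fun _ => c := by
  ext ξ
  have := hG.enorm_traceApprox_sub_le (Ψ := Ψ) (u := fun _ => c) (n := n) (ξ := ξ) (c := c) (B := 0)
    fun y _ _ => by simp
  rw [nonpos_iff_eq_zero, enorm_eq_zero, sub_eq_zero] at this
  exact this

lemma hasTrace_const (hG : FillingGeometry H μ Q E C N) (Ψ : LipschitzPartition H) (c : ℂ) :
    HasTrace μ Ψ (fun _ => c) (fun _ => c) := by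
  have := hG.isFiniteMeasure
  refine ⟨integrable_const c, ?_, ?_⟩
  · simp_rw [hG.traceApprox_const]
    simp
  · simp_rw [hG.traceApprox_const]
    simp

lemma hasTrace_sub_const (hG : FillingGeometry H μ Q E C N) {u : H.Vertex → ℂ} {f : Z → ℂ}
    (hf : HasTrace μ Ψ u f) (c : ℂ) : HasTrace μ Ψ (u - fun _ => c) (f - fun _ => c) := by
  have h := hG.hasTrace_add hf (hG.hasTrace_const Ψ (-c))
  have e : ∀ {X : Type _} (v : X → ℂ), (v - fun _ => c) = v + fun _ => -c := fun v => by
    ext; simp [sub_eq_add_neg]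
  rw [e u, show (f - fun _ => c) = f + fun _ => -c by ext; simp [sub_eq_add_neg]]
  exact h

/-- A trace is almost everywhere constant exactly for the sequences in `J^s_{p,q}(X) + ℂ1`. -/
lemma trace_eq_const_iff (hG : FillingGeometry H μ Q E C N) (hE : AdmissibleExponents Q s p q)
    {u : H.Vertex → ℂ} {f : Z → ℂ} (hu : jNorm μ s p q (absD u) < ∞) (hf : HasTrace μ Ψ u f) :
    (∃ c : ℂ, f =ᵐ[μ] fun _ => c) ↔ u ∈ H.seqSpaceConst μ s hE.p_pos hE.q_pos := by
  have key : ∀ c : ℂ, (f =ᵐ[μ] fun _ => c) ↔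
      (u - fun _ => c) ∈ H.seqSpace μ s hE.p_pos hE.q_pos := by
    intro c
    rw [← hG.trace_eq_zero_iff hE (by rwa [absD_sub_const]) (hG.hasTrace_sub_const hf c)]
    constructor <;> intro h <;> filter_upwards [h] with ξ hξ
    · simp [hξ]
    · simpa [sub_eq_zero] using hξ
  constructor
  · rintro ⟨c, hc⟩
    rw [← sub_add_cancel u fun _ => c]
    refine Submodule.add_mem_sup ((key c).1 hc) ?_
    refine Submodule.mem_span_singleton.2 ⟨c, ?_⟩
    ext; simp
  · intro h
    obtain ⟨j, hj, k, hk, rfl⟩ := Submodule.mem_sup.1 h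
    obtain ⟨c, rfl⟩ := Submodule.mem_span_singleton.1 hk
    refine ⟨c, (key c).2 ?_⟩
    convert hj using 1
    ext; simp

/-- The indicator of the root belongs to `J^s_{p,q}(X)`. -/
lemma single_root_mem_seqSpace (hG : FillingGeometry H μ Q E C N) (hp : 0 < p) (hq : 0 < q) (s : ℝ)
    [DecidableEq H.Vertex] (c : ℂ) : Pi.single Vertex.root c ∈ H.seqSpace μ s hp hq := by
  have hle : ∀ ξ, ellq q (fun x : H.cone ξ => ENNReal.ofReal ((2 : ℝ) ^ ((level x.1 : ℝ) * s))
      * ‖(Pi.single Vertex.root c : H.Vertex → ℂ) x.1‖ₑ) ≤ ‖c‖ₑ := by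
    intro ξ
    have h0 : ∀ x : H.cone ξ, x ≠ ⟨Vertex.root, mem_univ ξ⟩ →
        ENNReal.ofReal ((2 : ℝ) ^ ((level x.1 : ℝ) * s))
          * ‖(Pi.single Vertex.root c : H.Vertex → ℂ) x.1‖ₑ = 0 := by
      intro x hx
      rw [Pi.single_eq_of_ne fun h => hx (Subtype.ext h)]
      simp
    have h1 : ENNReal.ofReal ((2 : ℝ) ^ ((level (Vertex.root : H.Vertex) : ℝ) * s))
          * ‖(Pi.single Vertex.root c : H.Vertex → ℂ) Vertex.root‖ₑ = ‖c‖ₑ := by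
      simp [level]
    set g : H.cone ξ → ℝ≥0∞ := fun x => ENNReal.ofReal ((2 : ℝ) ^ ((level x.1 : ℝ) * s))
      * ‖(Pi.single Vertex.root c : H.Vertex → ℂ) x.1‖ₑ with hg
    change ∀ x : H.cone ξ, x ≠ ⟨Vertex.root, mem_univ ξ⟩ → g x = 0 at h0
    change g ⟨Vertex.root, mem_univ ξ⟩ = ‖c‖ₑ at h1
    clear_value g
    unfold ellq
    split_ifs with h
    · refine iSup_le fun x => ?_
      by_cases hx : x = ⟨Vertex.root, mem_univ ξ⟩
      · rw [hx]; exact h1.le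
      · rw [h0 x hx]; exact zero_le
    · have hq' : 0 < q.toReal := ENNReal.toReal_pos hq.ne' h
      rw [tsum_eq_single (⟨Vertex.root, show Vertex.root ∈ H.cone ξ from mem_univ ξ⟩ : H.cone ξ)
        fun x hx => by rw [h0 x hx, ENNReal.zero_rpow_of_pos hq']]
      rw [h1, ← ENNReal.rpow_mul, mul_one_div_cancel hq'.ne', ENNReal.rpow_one]
  change jNorm μ s p q (fun x => ‖(Pi.single Vertex.root c : H.Vertex → ℂ) x‖ₑ) < ∞
  unfold jNorm
  rw [ENNReal.rpow_lt_top_iff_of_pos (by positivity)]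
  refine (lintegral_mono fun ξ => ENNReal.rpow_le_rpow (hle ξ) hp.le).trans_lt ?_
  rw [lintegral_const]
  exact ENNReal.mul_lt_top (ENNReal.rpow_lt_top_of_nonneg hp.le enorm_ne_top) hG.finite

variable [BoundedSpace Z] [Nonempty Z]

lemma hasTrace_poisson_funSpace (hG : FillingGeometry H μ Q E C N)
    (hE : AdmissibleExponents Q s p q) (Ψ : LipschitzPartition H)
    (f : H.funSpace μ s hE.p_pos hE.q_pos) : HasTrace μ Ψ (H.poisson μ f.1) f.1 :=
  hG.hasTrace_poisson hE.Q_pos hE.s_pos hE.p_pos hE.q_pos hE.lt_p hE.lt_q Ψ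
    (integrable_of_locInt f.2.1) f.2.2

/-- If d(Pf) vanishes, then Pf is constant, since every vertex is linked to the root by a chain of
edges; the trace of a constant sequence is that constant, and the trace of Pf is f. -/
lemma ae_const_of_funNorm_eq_zero (hG : FillingGeometry H μ Q E C N)
    (hE : AdmissibleExponents Q s p q) (Ψ : LipschitzPartition H)
    {f : H.funSpace μ s hE.p_pos hE.q_pos}
    (hf : H.funNorm μ s hE.p_pos hE.q_pos f = 0) :
    f.1 =ᵐ[μ] fun _ => H.poisson μ f.1 Vertex.root := by
  have h1 : jNorm μ s p q (absD (H.poisson μ f.1)) = 0 := by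
    rcases (ENNReal.toReal_eq_zero_iff _).1 hf with h | h
    · exact h
    · exact absurd h f.2.2.ne
  have h2 := hG.hasTrace_poisson_funSpace hE Ψ f
  rw [hG.eq_root_of_jNorm_absD_eq_zero hE h1] at h2
  exact h2.ae_eq (hG.hasTrace_const Ψ _)

/-- The sequence `P f` made zero at the root. -/
lemma exists_diffSpace_hasTrace (hG : FillingGeometry H μ Q E C N)
    (hE : AdmissibleExponents Q s p q) (Ψ : LipschitzPartition H) :
    ∃ K : ℝ, 0 ≤ K ∧ ∀ f : H.funSpace μ s hE.p_pos hE.q_pos,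
      ∃ u : H.diffSpace μ s hE.p_pos hE.q_pos, HasTrace μ Ψ u.1 f.1 ∧
        H.diffNorm μ s hE.p_pos hE.q_pos u ≤ K * H.funNormMean μ s hE.p_pos hE.q_pos f := by
  classical
  obtain ⟨K₁, h₁⟩ := hG.jNorm_absD_le hE.Q_pos hE.s_pos hE.p_pos hE.q_pos hE.lt_p hE.lt_q
  obtain ⟨K₂, h₂⟩ := H.exists_absD_add_le
  obtain ⟨K₃, h₃⟩ := H.exists_jNorm_add_le μ s hE.p_pos hE.q_pos
  -- Subtracting a constant from Pf would change the trace. Altering only the value at the root does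
  -- not, since the indicator of the root is in J^s_{p,q}(X); the cost is a multiple of |Pf(root)|,
  -- which is the mean in the quasi-norm.
  set r₁ : H.Vertex → ℂ := Pi.single Vertex.root 1 with hr₁
  have hr₁J : jNorm μ s p q (fun x => ‖r₁ x‖ₑ) < ∞ :=
    hG.single_root_mem_seqSpace hE.p_pos hE.q_pos s 1
  have hr₁D : jNorm μ s p q (absD r₁) < ∞ :=
    (h₁ r₁).trans_lt (ENNReal.mul_lt_top (by simp) hr₁J)
  set M := (jNorm μ s p q (absD r₁)).toNNReal with hM
  have hMe : (M : ℝ≥0∞) = jNorm μ s p q (absD r₁) := ENNReal.coe_toNNReal hr₁D.ne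
  refine ⟨K₂ * (K₃ * (1 + M)), by positivity, fun f => ?_⟩
  set c := H.poisson μ f.1 Vertex.root with hc
  have hle : jNorm μ s p q (absD (H.poisson μ f.1 + (-c) • r₁))
      ≤ K₂ * (K₃ * (jNorm μ s p q (absD (H.poisson μ f.1)) + ‖c‖ₑ * M)) := by
    refine (jNorm_mono μ s hE.p_pos q (h₂ _ _)).trans ?_
    rw [jNorm_const_mul μ s hE.p_pos hE.q_pos (by simp)]
    refine mul_le_mul_right ((h₃ _ _).trans (le_of_eq ?_)) _
    have h : absD ((-c) • r₁) = fun x => ‖c‖ₑ * absD r₁ x := by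
      ext x; rw [absD_smul, enorm_neg]
    rw [h, jNorm_const_mul μ s hE.p_pos hE.q_pos (by simp), hMe]
  have hfin : (K₂ : ℝ≥0∞) * (K₃ * (jNorm μ s p q (absD (H.poisson μ f.1)) + ‖c‖ₑ * M)) ≠ ∞ :=
    ENNReal.mul_ne_top (by simp) (ENNReal.mul_ne_top (by simp) (ENNReal.add_ne_top.2
      ⟨f.2.2.ne, ENNReal.mul_ne_top enorm_ne_top (by simp)⟩))
  refine ⟨⟨H.poisson μ f.1 + (-c) • r₁, hle.trans_lt hfin.lt_top, ?_⟩, ?_, ?_⟩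
  · simp [hr₁, hc]
  · obtain ⟨g, hg⟩ := hG.exists_hasTrace Ψ hE.Q_pos hE.s_pos hE.p_pos hE.q_pos hE.lt_p hE.lt_q hr₁D
    have hg0 := hG.trace_eq_zero hE.Q_pos hE.s_pos hE.p_pos hE.q_pos hE.lt_p hE.lt_q hg hr₁J
    refine (hG.hasTrace_add (hG.hasTrace_poisson_funSpace hE Ψ f)
      (hG.hasTrace_smul (-c) hg)).congr ?_
    filter_upwards [hg0] with ξ hξ
    simp [hξ]
  · have h := ENNReal.toReal_mono hfin hle
    rw [ENNReal.toReal_mul, ENNReal.toReal_mul, ENNReal.toReal_add f.2.2.ne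
      (ENNReal.mul_ne_top enorm_ne_top (by simp)), ENNReal.toReal_mul, toReal_enorm] at h
    simp only [ENNReal.coe_toReal] at h
    rw [diffNorm]
    refine h.trans ?_
    rw [mul_assoc, mul_assoc]
    refine mul_le_mul_of_nonneg_left (mul_le_mul_of_nonneg_left ?_ K₃.2) K₂.2
    rw [funNormMean, funNorm, ← poisson_root (H := H)]
    have := ENNReal.toReal_nonneg (a := jNorm μ s p q (absD (H.poisson μ f.1)))
    have hM0 : (0 : ℝ) ≤ M := M.2
    nlinarith [norm_nonneg c, mul_nonneg hM0 this]

lemma funNorm_trace_le (hG : FillingGeometry H μ Q E C N)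
    (hE : AdmissibleExponents Q s p q) (Ψ : LipschitzPartition H) :
    ∃ K : ℝ≥0, ∀ (u : H.diffSpace μ s hE.p_pos hE.q_pos) (f : H.funSpace μ s hE.p_pos hE.q_pos),
      HasTrace μ Ψ u.1 f.1 → H.funNorm μ s hE.p_pos hE.q_pos f
        ≤ K * H.diffNorm μ s hE.p_pos hE.q_pos u := by
  obtain ⟨K, hK⟩ := hG.jNorm_absD_poisson_trace_le hE.Q_pos hE.s_pos hE.p_pos hE.q_pos hE.lt_p
    hE.lt_q Ψ
  exact ⟨K, fun u f hf => toReal_le_mul (hK hf) u.2.1⟩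

/-- As u(root) = 0, the mean of f is the value of Pf - u at the root, and the central estimate
controls this. -/
lemma funNormMean_trace_le (hG : FillingGeometry H μ Q E C N)
    (hE : AdmissibleExponents Q s p q) (Ψ : LipschitzPartition H) :
    ∃ K : ℝ≥0, ∀ (u : H.diffSpace μ s hE.p_pos hE.q_pos) (f : H.funSpace μ s hE.p_pos hE.q_pos),
      HasTrace μ Ψ u.1 f.1 → H.funNormMean μ s hE.p_pos hE.q_pos f
        ≤ K * H.diffNorm μ s hE.p_pos hE.q_pos u := by
  obtain ⟨K₁, h₁⟩ := hG.funNorm_trace_le hE Ψ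
  obtain ⟨K₂, h₂⟩ := hG.jNorm_poisson_trace_sub_le hE.Q_pos hE.s_pos hE.p_pos hE.q_pos hE.lt_p
    hE.lt_q Ψ
  obtain ⟨K₃, h₃⟩ := hG.le_jNorm s hE.p_pos hE.q_pos Vertex.root
  refine ⟨K₃ * K₂ + K₁, fun u f hf => ?_⟩
  rw [funNormMean, NNReal.coe_add, add_mul]
  refine add_le_add ?_ (h₁ u f hf)
  have h4 : ‖H.poisson μ f.1 Vertex.root‖ₑ ≤ (K₃ * K₂ : ℝ≥0) * jNorm μ s p q (absD u.1) := by
    have h5 := (h₃ fun x => ‖H.poisson μ f.1 x - u.1 x‖ₑ).trans (mul_le_mul_right (h₂ hf) _)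
    rw [show u.1 Vertex.root = 0 from u.2.2, sub_zero] at h5
    rwa [ENNReal.coe_mul, mul_assoc]
  have h6 := toReal_le_mul h4 u.2.1
  rwa [toReal_enorm, poisson_root] at h6

/-- The trace isomorphism, constants not divided out. -/
theorem exists_traceEquiv_aeZero (hG : FillingGeometry H μ Q E C N)
    (hE : AdmissibleExponents Q s p q) (Ψ : LipschitzPartition H) :
    ∃ e : (H.diffSpace μ s hE.p_pos hE.q_pos ⧸ (H.seqSpaceZero μ s hE.p_pos hE.q_pos).comap
          (H.diffSpace μ s hE.p_pos hE.q_pos).subtype) ≃ₗ[ℂ]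
        (H.funSpace μ s hE.p_pos hE.q_pos ⧸ H.aeZero μ s hE.p_pos hE.q_pos),
      (∀ u : H.diffSpace μ s hE.p_pos hE.q_pos, ∃ f : H.funSpace μ s hE.p_pos hE.q_pos,
        HasTrace μ Ψ u.1 f.1 ∧ e (Submodule.Quotient.mk u) = Submodule.Quotient.mk f) ∧
      IsQuasiNormIso (quotientNorm _ (H.diffNorm μ s hE.p_pos hE.q_pos))
        (quotientNorm _ (H.funNormMean μ s hE.p_pos hE.q_pos)) e := by
  obtain ⟨K, hK0, hK⟩ := hG.exists_diffSpace_hasTrace hE Ψ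
  obtain ⟨K', hK'⟩ := hG.funNormMean_trace_le hE Ψ
  have hker : ∀ (u : H.diffSpace μ s hE.p_pos hE.q_pos) (f : H.funSpace μ s hE.p_pos hE.q_pos),
      HasTrace μ Ψ u.1 f.1 →
      (u.1 ∈ H.seqSpaceZero μ s hE.p_pos hE.q_pos ↔ f.1 =ᵐ[μ] 0) := by
    intro u f hf
    rw [hG.trace_eq_zero_iff hE u.2.1 hf]
    exact ⟨fun h => h.1, fun h => ⟨h, u.2.2⟩⟩
  obtain ⟨e, he⟩ := hG.exists_traceEquiv hE Ψ (H.aeZero μ s hE.p_pos hE.q_pos)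
    ((H.seqSpaceZero μ s hE.p_pos hE.q_pos).comap (H.diffSpace μ s hE.p_pos hE.q_pos).subtype)
    le_rfl hker fun f => by
      obtain ⟨u, hu, -⟩ := hK f
      exact ⟨u, f, hu, by simp⟩
  refine ⟨e, fun u => ?_, (isQuasiSeminorm_diffNorm hE).isQuasiNormIso
    (isQuasiSeminorm_funNormMean hE) (fun y hy => ?_) e (A := K + K') (by positivity) (fun u => ?_)
    fun f => ?_⟩
  · obtain ⟨f, hf⟩ := hG.exists_trace_mem hE Ψ u
    exact ⟨f, hf, he u f hf⟩
  · obtain ⟨f, rfl⟩ := Submodule.Quotient.mk_surjective _ y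
    rw [IsQuasiSeminorm.quotientNorm_mk_eq] at hy
    · have h1 : 0 ≤ H.funNorm μ s hE.p_pos hE.q_pos f := ENNReal.toReal_nonneg
      rw [funNormMean] at hy
      have h2 : H.funNorm μ s hE.p_pos hE.q_pos f = 0 := by
        linarith [norm_nonneg (⨍ ξ, f.1 ξ ∂μ)]
      have h3 : H.poisson μ f.1 Vertex.root = 0 := by
        rw [poisson_root, ← norm_eq_zero]; linarith
      have h4 := hG.ae_const_of_funNorm_eq_zero hE Ψ h2
      rw [h3] at h4
      rw [Submodule.Quotient.mk_eq_zero]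
      exact h4
    · intro f g hfg
      have h : f.1 =ᵐ[μ] g.1 := by
        have hfg' : f.1 - g.1 =ᵐ[μ] 0 := hfg
        filter_upwards [hfg'] with ξ hξ
        simpa [sub_eq_zero] using hξ
      rw [funNormMean, funNormMean, funNorm, funNorm, ← poisson_root (H := H),
        ← poisson_root (H := H), poisson_congr h]
  · obtain ⟨f, hf⟩ := hG.exists_trace_mem hE Ψ u
    refine ⟨f, he u f hf, (hK' u f hf).trans ?_⟩
    exact mul_le_mul_of_nonneg_right (by linarith) ENNReal.toReal_nonneg
  · obtain ⟨u, hu, hu'⟩ := hK f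
    refine ⟨u, he u f hu, hu'.trans ?_⟩
    exact mul_le_mul_of_nonneg_right (by have := K'.2; linarith [this])
      ((isQuasiSeminorm_funNormMean hE).nonneg f)

lemma aeZero_le_aeConst (hp : 0 < p) (hq : 0 < q) : H.aeZero μ s hp hq ≤ H.aeConst μ s hp hq :=
  fun _ hf => ⟨0, hf⟩

lemma quotientNorm_aeConst_mk (hG : FillingGeometry H μ Q E C N) (s : ℝ) (hp : 0 < p) (hq : 0 < q)
    (f : H.funSpace μ s hp hq) :
    quotientNorm (H.aeConst μ s hp hq) (H.funNorm μ s hp hq) (Submodule.Quotient.mk f)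
      = H.funNorm μ s hp hq f :=
  quotientNorm_mk (fun x => ⟨(hG.pos x).ne', hG.measure_ne_top _⟩) s hp hq f

lemma isQuasiNorm_aeConst (hG : FillingGeometry H μ Q E C N)
    (hE : AdmissibleExponents Q s p q) (Ψ : LipschitzPartition H) :
    IsQuasiNorm (quotientNorm (H.aeConst μ s hE.p_pos hE.q_pos)
      (H.funNorm μ s hE.p_pos hE.q_pos)) := by
  refine ((isQuasiSeminorm_funNorm hE).quotient _).isQuasiNorm fun y hy => ?_
  obtain ⟨f, rfl⟩ := Submodule.Quotient.mk_surjective _ y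
  rw [hG.quotientNorm_aeConst_mk] at hy
  rw [Submodule.Quotient.mk_eq_zero]
  exact ⟨_, hG.ae_const_of_funNorm_eq_zero hE Ψ hy⟩

/-- The trace isomorphism onto `Ḟ^s_{p,q}(Z)`. -/
theorem exists_traceEquiv_aeConst (hG : FillingGeometry H μ Q E C N)
    (hE : AdmissibleExponents Q s p q) (Ψ : LipschitzPartition H) :
    ∃ e : (H.diffSpace μ s hE.p_pos hE.q_pos ⧸ (H.seqSpaceConst μ s hE.p_pos hE.q_pos).comap
          (H.diffSpace μ s hE.p_pos hE.q_pos).subtype) ≃ₗ[ℂ] H.TL μ s hE.p_pos hE.q_pos,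
      (∀ u : H.diffSpace μ s hE.p_pos hE.q_pos, ∃ f : H.funSpace μ s hE.p_pos hE.q_pos,
        HasTrace μ Ψ u.1 f.1 ∧ e (Submodule.Quotient.mk u) = Submodule.Quotient.mk f) ∧
      IsQuasiNormIso (quotientNorm _ (H.diffNorm μ s hE.p_pos hE.q_pos))
        (quotientNorm _ (H.funNorm μ s hE.p_pos hE.q_pos)) e := by
  obtain ⟨K, hK0, hK⟩ := hG.exists_diffSpace_hasTrace hE Ψ
  obtain ⟨K', hK'⟩ := hG.funNorm_trace_le hE Ψ
  obtain ⟨e, he⟩ := hG.exists_traceEquiv hE Ψ (H.aeConst μ s hE.p_pos hE.q_pos)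
    ((H.seqSpaceConst μ s hE.p_pos hE.q_pos).comap (H.diffSpace μ s hE.p_pos hE.q_pos).subtype)
    (aeZero_le_aeConst _ _) (fun u f hf => (hG.trace_eq_const_iff hE u.2.1 hf).symm) fun f => by
      obtain ⟨u, hu, -⟩ := hK f
      exact ⟨u, f, hu, by simp⟩
  refine ⟨e, fun u => ?_, (isQuasiSeminorm_diffNorm hE).isQuasiNormIso
    (isQuasiSeminorm_funNorm hE) (fun y hy => ?_) e (A := 1 + K') (by positivity) (fun u => ?_)
    fun f => ?_⟩
  · obtain ⟨f, hf⟩ := hG.exists_trace_mem hE Ψ u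
    exact ⟨f, hf, he u f hf⟩
  · exact ((hG.isQuasiNorm_aeConst hE Ψ).eq_zero_iff y).1 hy
  · obtain ⟨f, hf⟩ := hG.exists_trace_mem hE Ψ u
    refine ⟨f, he u f hf, (hK' u f hf).trans ?_⟩
    exact mul_le_mul_of_nonneg_right (by linarith) ENNReal.toReal_nonneg
  -- Constants are divided out here, so Pf - Pf(root) may be used; it has the same differences as
  -- Pf, and the bound holds with constant 1.
  · set c := H.poisson μ f.1 Vertex.root with hc
    have ht := hG.hasTrace_sub_const (hG.hasTrace_poisson_funSpace hE Ψ f) c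
    have hD : absD (H.poisson μ f.1 - fun _ => c) = absD (H.poisson μ f.1) := absD_sub_const _ _
    let u : H.diffSpace μ s hE.p_pos hE.q_pos := ⟨H.poisson μ f.1 - fun _ => c, by
      rw [hD]; exact f.2.2, by simp [hc]⟩
    have hu : H.diffNorm μ s hE.p_pos hE.q_pos u = H.funNorm μ s hE.p_pos hE.q_pos f := by
      rw [diffNorm, funNorm]
      exact congrArg (fun w => (jNorm μ s p q w).toReal) hD
    obtain ⟨g, hg⟩ := hG.exists_trace_mem hE Ψ u
    refine ⟨u, (he u g hg).trans ((Submodule.Quotient.eq _).2 ⟨-c, ?_⟩), ?_⟩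
    · filter_upwards [hg.ae_eq ht] with ξ hξ
      change g.1 ξ - f.1 ξ = -c
      rw [hξ]
      simp
    · rw [hu]
      exact le_mul_of_one_le_left ENNReal.toReal_nonneg (by have := K'.2; linarith [this])

end FillingGeometry

end TriebelLizorkin

/-! ### Fatou's lemma and completeness -/

namespace TriebelLizorkin

lemma lowerSemicontinuous_ellq {X ι : Type*} [TopologicalSpace X] {q : ℝ≥0∞}
    {f : ι → X → ℝ≥0∞} (hf : ∀ i, LowerSemicontinuous (f i)) :
    LowerSemicontinuous fun x => ellq q fun i => f i x := by
  unfold ellq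
  split_ifs with h
  · exact lowerSemicontinuous_iSup hf
  · have hpow : ∀ {r : ℝ} {g : X → ℝ≥0∞}, 0 ≤ r → LowerSemicontinuous g →
        LowerSemicontinuous fun x => g x ^ r := fun hr hg =>
      ENNReal.continuous_rpow_const.comp_lowerSemicontinuous hg
        (ENNReal.monotone_rpow_of_nonneg hr)
    exact hpow (by positivity) (lowerSemicontinuous_tsum fun i => hpow ENNReal.toReal_nonneg (hf i))

variable {Z : Type*} [MetricSpace Z] [MeasurableSpace Z] {H : HyperbolicFilling Z} {μ : Measure Z}
  {Q : ℝ} {E : H.Vertex → Set Z} {C : ℝ≥0} {N : ℕ}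

lemma lowerSemicontinuous_absD (x : H.Vertex) :
    LowerSemicontinuous fun u : H.Vertex → ℂ => absD u x :=
  lowerSemicontinuous_ellq fun y => Continuous.lowerSemicontinuous
    (by fun_prop : Continuous fun u : H.Vertex → ℂ => ‖u y - u x‖ₑ)

/-- Fatou's lemma for the quasi-norm of the difference space. -/
lemma jNorm_absD_le_of_tendsto [BorelSpace Z] {s p : ℝ} {q : ℝ≥0∞} (hp : 0 < p) (hq : 0 < q)
    {w : ℕ → H.Vertex → ℂ} {u : H.Vertex → ℂ} (hw : Tendsto w atTop (𝓝 u)) {B : ℝ≥0∞}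
    (hB : ∀ᶠ n in atTop, jNorm μ s p q (absD (w n)) ≤ B) : jNorm μ s p q (absD u) ≤ B := by
  set F : (H.Vertex → ℂ) → Z → ℝ≥0∞ := fun v ξ =>
    ellq q (fun x : H.cone ξ => ENNReal.ofReal ((2 : ℝ) ^ ((level x.1 : ℝ) * s)) * absD v x.1) ^ p
    with hF
  have hlsc : ∀ ξ, LowerSemicontinuous fun v => F v ξ := fun ξ =>
    ENNReal.continuous_rpow_const.comp_lowerSemicontinuous (lowerSemicontinuous_ellq fun x =>
      (ENNReal.continuous_const_mul ENNReal.ofReal_ne_top).comp_lowerSemicontinuous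
        (lowerSemicontinuous_absD x.1) fun _ _ h => mul_le_mul_right h _)
        (ENNReal.monotone_rpow_of_nonneg hp.le)
  have hmeas : ∀ v, Measurable (F v) := fun v =>
    (measurable_ellq_cone (H := H) hq fun x =>
      ENNReal.ofReal ((2 : ℝ) ^ ((level x : ℝ) * s)) * absD v x).pow_const _
  have hiff : ∀ v, jNorm μ s p q (absD v) ≤ B ↔ ∫⁻ ξ, F v ξ ∂μ ≤ B ^ p := by
    intro v
    unfold jNorm
    rw [one_div, ENNReal.rpow_inv_le_iff hp]
  rw [hiff]
  calc ∫⁻ ξ, F u ξ ∂μ ≤ ∫⁻ ξ, liminf (fun n => F (w n) ξ) atTop ∂μ := by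
        refine lintegral_mono fun ξ => ?_
        exact (LowerSemicontinuousAt.le_liminf (hlsc ξ u)).trans (liminf_le_liminf_of_le hw)
    _ ≤ liminf (fun n => ∫⁻ ξ, F (w n) ξ ∂μ) atTop := lintegral_liminf_le fun n => hmeas _
    _ ≤ B ^ p := by
        refine liminf_le_of_frequently_le' (hB.mono fun n hn => (hiff _).1 hn).frequently

namespace FillingGeometry

variable [BorelSpace Z] {s p : ℝ} {q : ℝ≥0∞}

/-- The difference space is complete. -/
lemma exists_tendsto_diffNorm (hG : FillingGeometry H μ Q E C N) (hE : AdmissibleExponents Q s p q)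
    {u : ℕ → H.diffSpace μ s hE.p_pos hE.q_pos}
    (hu : ∀ ε > 0, ∃ n₀, ∀ m ≥ n₀, ∀ n ≥ n₀,
      H.diffNorm μ s hE.p_pos hE.q_pos (u m - u n) < ε) :
    ∃ w, Tendsto (fun n => H.diffNorm μ s hE.p_pos hE.q_pos (u n - w)) atTop (𝓝 0) := by
  have hpt : ∀ x, ∃ c, Tendsto (fun n => (u n).1 x) atTop (𝓝 c) := by
    intro x
    refine cauchySeq_tendsto_of_complete (Metric.cauchySeq_iff.2 fun ε hε => ?_)
    obtain ⟨K, hK⟩ := hG.enorm_sub_root_le hE x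
    obtain ⟨n₀, hn₀⟩ := hu (ε / (K + 1)) (by positivity)
    refine ⟨n₀, fun m hm n hn => ?_⟩
    have h1 := hK (u m - u n).1
    rw [(u m - u n).2.2, sub_zero] at h1
    have h2 := toReal_le_mul h1 (u m - u n).2.1
    rw [toReal_enorm] at h2
    have h3 := hn₀ m hm n hn
    rw [lt_div_iff₀ (by positivity)] at h3
    rw [dist_eq_norm]
    have h4 : 0 ≤ H.diffNorm μ s hE.p_pos hE.q_pos (u m - u n) := ENNReal.toReal_nonneg
    calc ‖(u m).1 x - (u n).1 x‖ ≤ K * H.diffNorm μ s hE.p_pos hE.q_pos (u m - u n) := h2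
      _ < ε := by nlinarith
  choose w hw using hpt
  have hw0 : w Vertex.root = 0 := by
    refine tendsto_nhds_unique (hw _) ?_
    simp only [fun n => show (u n).1 Vertex.root = 0 from (u n).2.2, tendsto_const_nhds]
  have hlim : ∀ m, Tendsto (fun n => (u m - u n).1) atTop (𝓝 ((u m).1 - w)) := fun m =>
    tendsto_const_nhds.sub (tendsto_pi_nhds.2 hw)
  -- Fatou's lemma along n → ∞ bounds u_m - w by the Cauchy bound for u_m - u_n, without the
  -- quasi-triangle inequality and its constant.
  have hle : ∀ ε > 0, ∃ n₀, ∀ m ≥ n₀,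
      jNorm μ s p q (absD ((u m).1 - w)) ≤ ENNReal.ofReal ε := by
    intro ε hε
    obtain ⟨n₀, hn₀⟩ := hu ε hε
    refine ⟨n₀, fun m hm => jNorm_absD_le_of_tendsto hE.p_pos hE.q_pos (hlim m) ?_⟩
    filter_upwards [eventually_ge_atTop n₀] with n hn
    rw [← ENNReal.ofReal_toReal (u m - u n).2.1.ne]
    exact ENNReal.ofReal_le_ofReal (hn₀ m hm n hn).le
  obtain ⟨n₁, hn₁⟩ := hle 1 one_pos
  have hwD : w ∈ H.diffSpace μ s hE.p_pos hE.q_pos := by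
    rw [← sub_sub_cancel (u n₁).1 w]
    exact sub_mem (u n₁).2
      ⟨(hn₁ n₁ le_rfl).trans_lt ENNReal.ofReal_lt_top, by simp [hw0, (u n₁).2.2]⟩
  refine ⟨⟨w, hwD⟩, Metric.tendsto_atTop.2 fun ε hε => ?_⟩
  obtain ⟨n₀, hn₀⟩ := hle (ε / 2) (by positivity)
  refine ⟨n₀, fun n hn => ?_⟩
  have h5 : 0 ≤ H.diffNorm μ s hE.p_pos hE.q_pos (u n - ⟨w, hwD⟩) := ENNReal.toReal_nonneg
  rw [Real.dist_0_eq_abs, abs_of_nonneg h5]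
  exact (ENNReal.toReal_le_of_le_ofReal (by positivity) (hn₀ n hn)).trans_lt (by linarith)

variable [BoundedSpace Z] [Nonempty Z]

/-- The Poisson extension, normalised to vanish at the root. -/
noncomputable def poissonRoot (μ : Measure Z) (hp : 0 < p) (hq : 0 < q) (f : H.funSpace μ s hp hq) :
    H.diffSpace μ s hp hq :=
  ⟨H.poisson μ f.1 - fun _ => H.poisson μ f.1 Vertex.root, by
    rw [absD_sub_const]; exact f.2.2, by simp⟩

lemma diffNorm_poissonRoot (hp : 0 < p) (hq : 0 < q) (f : H.funSpace μ s hp hq) :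
    H.diffNorm μ s hp hq (poissonRoot μ hp hq f) = H.funNorm μ s hp hq f :=
  congrArg (fun w => (jNorm μ s p q w).toReal) (absD_sub_const (H := H) _ _)

lemma poisson_sub (hp : 0 < p) (hq : 0 < q) (f g : H.funSpace μ s hp hq) :
    H.poisson μ (f - g).1 = H.poisson μ f.1 - H.poisson μ g.1 := by
  have h : (f - g).1 = f.1 + (-1 : ℂ) • g.1 := by simp [sub_eq_add_neg]
  rw [h, poisson_add f.2.1 ((H.funSpace μ s hp hq).smul_mem _ g.2).1, poisson_smul]
  simp [sub_eq_add_neg]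

lemma poissonRoot_sub (hp : 0 < p) (hq : 0 < q) (f g : H.funSpace μ s hp hq) :
    poissonRoot μ hp hq (f - g) = poissonRoot μ hp hq f - poissonRoot μ hp hq g := by
  ext x
  change H.poisson μ (f - g).1 x - H.poisson μ (f - g).1 Vertex.root
    = (H.poisson μ f.1 x - H.poisson μ f.1 Vertex.root)
      - (H.poisson μ g.1 x - H.poisson μ g.1 Vertex.root)
  rw [poisson_sub, Pi.sub_apply, Pi.sub_apply]
  ring

/-- `Ḟ^s_{p,q}(Z)` is complete. -/
theorem isQuasiBanach_aeConst (hG : FillingGeometry H μ Q E C N)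
    (hE : AdmissibleExponents Q s p q) (Ψ : LipschitzPartition H) :
    IsQuasiBanach (quotientNorm (H.aeConst μ s hE.p_pos hE.q_pos)
      (H.funNorm μ s hE.p_pos hE.q_pos)) := by
  refine ⟨hG.isQuasiNorm_aeConst hE Ψ, fun v hv => ?_⟩
  choose f hf using fun n => Submodule.Quotient.mk_surjective _ (v n)
  -- Pf_n - Pf_n(root) has the same quasi-norm in D as the class of f_n, so it is Cauchy there; the
  -- trace of its limit is the limit class.
  obtain ⟨w, hw⟩ := hG.exists_tendsto_diffNorm hE
    (u := fun n => poissonRoot μ hE.p_pos hE.q_pos (f n)) (by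
      simpa only [← poissonRoot_sub, diffNorm_poissonRoot, ← hf, ← Submodule.Quotient.mk_sub,
        hG.quotientNorm_aeConst_mk] using hv)
  obtain ⟨g, hg⟩ := hG.exists_trace_mem hE Ψ w
  obtain ⟨K, hK⟩ := hG.funNorm_trace_le hE Ψ
  refine ⟨Submodule.Quotient.mk g, squeeze_zero (fun n =>
    (hG.isQuasiNorm_aeConst hE Ψ).nonneg _) (fun n => ?_) (by simpa using hw.const_mul (K : ℝ))⟩
  obtain ⟨r, hr⟩ := hG.exists_trace_mem hE Ψ (poissonRoot μ hE.p_pos hE.q_pos (f n) - w)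
  have ht := hG.hasTrace_add (hG.hasTrace_sub_const (hG.hasTrace_poisson_funSpace hE Ψ (f n))
    (H.poisson μ (f n).1 Vertex.root)) (hG.hasTrace_smul (-1) hg)
  have hu : (poissonRoot μ hE.p_pos hE.q_pos (f n) - w).1
      = (H.poisson μ (f n).1 - fun _ => H.poisson μ (f n).1 Vertex.root) + (-1 : ℂ) • w.1 := by
    simp [poissonRoot, sub_eq_add_neg]
  rw [← hu] at ht
  -- Modulo constants, f_n - g is the trace of the difference of the sequences, so boundedness of
  -- the trace applies.
  have hrv : v n - Submodule.Quotient.mk g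
      = (Submodule.Quotient.mk r : H.TL μ s hE.p_pos hE.q_pos) := by
    rw [← hf, ← Submodule.Quotient.mk_sub, Submodule.Quotient.eq]
    refine ⟨H.poisson μ (f n).1 Vertex.root, ?_⟩
    filter_upwards [hr.ae_eq ht] with ξ hξ
    change (f n).1 ξ - g.1 ξ - r.1 ξ = _
    rw [hξ]
    simp only [Pi.add_apply, Pi.sub_apply, Pi.smul_apply, smul_eq_mul]
    ring
  rw [hrv, hG.quotientNorm_aeConst_mk]
  exact hK _ r hr

end FillingGeometry

end TriebelLizorkin

/-! ### The Milman–Pettis theorem -/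

namespace TriebelLizorkin

section MilmanPettis

variable {G : Type*} [NormedAddCommGroup G] [NormedSpace ℂ G]

/-- Helly's lemma: an element of the unit ball of the bidual is approximated by elements of the
unit ball, uniformly on finite sets of functionals. -/
lemma exists_norm_le_one_forall_norm_sub_lt {φ : StrongDual ℂ (StrongDual ℂ G)} (hφ : ‖φ‖ ≤ 1)
    {ι : Type*} [Fintype ι] (f : ι → StrongDual ℂ G) {ε : ℝ} (hε : 0 < ε) :
    ∃ x, ‖x‖ ≤ 1 ∧ ∀ i, ‖f i x - φ (f i)‖ < ε := by
  classical
  let T : G →ₗ[ℂ] ι → ℂ := LinearMap.pi fun i => (f i : G →ₗ[ℂ] ℂ)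
  have hmem : (fun i => φ (f i)) ∈ closure (T '' Metric.closedBall 0 1) := by
    by_contra hnot
    have hconv : Convex ℝ (closure (T '' Metric.closedBall (0 : G) 1)) :=
      ((convex_closedBall (0 : G) 1).linear_image (T.restrictScalars ℝ)).closure
    -- A functional separating (φ(f_i)) from the image of the unit ball is a combination F of the
    -- f_i with ‖F‖ ≤ u, while φ(F) has real part above u; this contradicts ‖φ‖ ≤ 1.
    obtain ⟨g, u, hg, hgu⟩ :=
      RCLike.geometric_hahn_banach_closed_point (𝕜 := ℂ) hconv isClosed_closure hnot
    have hsum : ∀ v : ι → ℂ, g v = ∑ i, v i * g fun j => if i = j then 1 else 0 := fun v =>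
      (g : (ι → ℂ) →ₗ[ℂ] ℂ).pi_apply_eq_sum_univ v
    let F : StrongDual ℂ G := ∑ i, (g fun j => if i = j then 1 else 0) • f i
    have hF : ∀ x, F x = g (T x) := fun x => by
      rw [hsum]
      simp [F, T, mul_comm]
    have hφF : φ F = g fun i => φ (f i) := by
      rw [hsum]
      simp [F, mul_comm]
    have hball : ∀ x : G, ‖x‖ ≤ 1 → RCLike.re (F x) < u := fun x hx => by
      rw [hF]
      exact hg _ (subset_closure ⟨x, by simpa using hx, rfl⟩)
    have hu : 0 < u := by simpa using hball 0 (by simp)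
    have hFu : ‖F‖ ≤ u := by
      refine ContinuousLinearMap.opNorm_le_of_unit_norm hu.le fun x hx => ?_
      -- Rotating x by a unimodular factor turns the bound on the real part into one on the modulus.
      obtain ⟨c, hc, hcx⟩ := RCLike.exists_norm_eq_mul_self (F x)
      have h := hball (c • x) (by rw [norm_smul, hc, hx, one_mul])
      rw [map_smul, smul_eq_mul, ← hcx] at h
      exact (by simpa using h : ‖F x‖ < u).le
    have h1 : RCLike.re (φ F) ≤ u := calc
      RCLike.re (φ F) ≤ ‖φ F‖ := RCLike.re_le_norm _
      _ ≤ ‖φ‖ * ‖F‖ := φ.le_opNorm F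
      _ ≤ 1 * u := mul_le_mul hφ hFu (norm_nonneg _) zero_le_one
      _ = u := one_mul u
    rw [hφF] at h1
    linarith
  obtain ⟨-, ⟨x, hx, rfl⟩, hd⟩ := Metric.mem_closure_iff.1 hmem ε hε
  refine ⟨x, by simpa using hx, fun i => ?_⟩
  rw [← dist_eq_norm, dist_comm]
  exact (dist_pi_lt_iff hε).1 hd i

/-- The Milman–Pettis theorem. -/
theorem surjective_inclusionInDoubleDual [UniformConvexSpace G] [CompleteSpace G] :
    Function.Surjective (NormedSpace.inclusionInDoubleDual ℂ G) := by
  suffices h : ∀ φ : StrongDual ℂ (StrongDual ℂ G), ‖φ‖ = 1 →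
      ∃ x, NormedSpace.inclusionInDoubleDual ℂ G x = φ by
    intro φ
    have hnorm : ∀ {W : Type _} [NormedAddCommGroup W] [NormedSpace ℂ W] (v : StrongDual ℂ W),
        v ≠ 0 → ‖(‖v‖ : ℂ)⁻¹ • v‖ = 1 := fun v hv => norm_smul_inv_norm hv
    by_cases hφ : φ = 0
    · exact ⟨0, by rw [hφ, map_zero]⟩
    · have hn : ‖φ‖ ≠ 0 := fun h0 => hφ (φ.opNorm_zero_iff.1 h0)
      obtain ⟨x, hx⟩ := h ((‖φ‖ : ℂ)⁻¹ • φ) (hnorm φ hφ)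
      refine ⟨(‖φ‖ : ℂ) • x, ?_⟩
      rw [map_smul, hx, smul_inv_smul₀ (by exact_mod_cast hn)]
  intro φ hφ
  -- The traces on the unit ball of the weak* neighbourhoods of φ. They are non-empty by Helly's
  -- lemma; uniform convexity makes this filter norm-Cauchy, and its limit represents φ.
  let 𝓕 : Filter G := comap (fun x (f : StrongDual ℂ G) => f x) (𝓝 fun f => φ f)
    ⊓ 𝓟 (Metric.closedBall 0 1)
  have hF : ∀ f : StrongDual ℂ G, Tendsto f 𝓕 (𝓝 (φ f)) := fun f => by
    have h : Tendsto (fun v : StrongDual ℂ G → ℂ => v f) (𝓝 fun f => φ f) (𝓝 (φ f)) :=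
      (continuous_apply f).tendsto _
    exact (h.comp tendsto_comap).mono_left inf_le_left
  have hball : ∀ᶠ x in 𝓕, ‖x‖ ≤ 1 := by
    filter_upwards [mem_inf_of_right (mem_principal_self _)] with x hx
    simpa using hx
  have hne : 𝓕.NeBot := by
    refine inf_principal_neBot_iff.2 fun U hU => ?_
    obtain ⟨V, hV, hVU⟩ := mem_comap.1 hU
    rw [nhds_pi, Filter.mem_pi] at hV
    obtain ⟨I, hI, t, ht, htV⟩ := hV
    have : Fintype I := hI.fintype
    have hε : ∀ f : StrongDual ℂ G, ∃ ε > 0, Metric.ball (φ f) ε ⊆ t f := fun f =>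
      Metric.mem_nhds_iff.1 (ht f)
    choose ε hε0 hε using hε
    obtain ⟨δ, hδ, hδε⟩ : ∃ δ > 0, ∀ f : I, δ ≤ ε f := by
      rcases isEmpty_or_nonempty I with h | h
      · exact ⟨1, one_pos, fun f => h.elim f⟩
      · obtain ⟨f₀, hf₀⟩ := Finite.exists_min fun f : I => ε f
        exact ⟨ε f₀, hε0 _, hf₀⟩
    obtain ⟨x, hx, hxf⟩ := exists_norm_le_one_forall_norm_sub_lt hφ.le (fun f : I => f.1) hδ
    refine ⟨x, hVU (htV fun f hf => hε f ?_), by simpa using hx⟩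
    rw [Metric.mem_ball, dist_eq_norm]
    exact (hxf ⟨f, hf⟩).trans_le (hδε ⟨f, hf⟩)
  have hcauchy : Cauchy 𝓕 := by
    refine Metric.cauchy_iff.2 ⟨hne, fun ε hε => ?_⟩
    obtain ⟨δ, hδ, h⟩ := exists_forall_closed_ball_dist_add_le_two_sub G hε
    -- If x and y both nearly attain φ(f), then |f(x+y)| exceeds |φ(f)| + 1 - δ/2 > 2 - δ; so ‖x+y‖
    -- > 2 - δ, and x, y are closer than ε.
    obtain ⟨f, hf, hφf⟩ := φ.exists_lt_apply_of_lt_opNorm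
      (r := 1 - δ / 2) (by rw [hφ]; linarith)
    refine ⟨{x | ‖x‖ ≤ 1 ∧ 1 - δ / 2 < ‖f x‖ ∧ ‖f x - φ f‖ < (‖φ f‖ - (1 - δ / 2)) / 2}, ?_, ?_⟩
    · filter_upwards [hball, (hF f).norm.eventually (lt_mem_nhds hφf),
        (tendsto_iff_norm_sub_tendsto_zero.1 (hF f)).eventually
          (gt_mem_nhds (by linarith : 0 < (‖φ f‖ - (1 - δ / 2)) / 2))] with x h1 h2 h3
      exact ⟨h1, h2, h3⟩
    · rintro x ⟨hx, -, hx'⟩ y ⟨hy, -, hy'⟩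
      by_contra! hxy
      rw [dist_eq_norm] at hxy
      have h1 := h hx hy hxy
      have h2 : ‖f (x + y)‖ ≤ ‖x + y‖ := calc
        ‖f (x + y)‖ ≤ ‖f‖ * ‖x + y‖ := f.le_opNorm _
        _ ≤ 1 * ‖x + y‖ := by gcongr
        _ = _ := one_mul _
      have h3 : 2 * ‖φ f‖ ≤ ‖f (x + y)‖ + (‖f x - φ f‖ + ‖f y - φ f‖) := by
        have h4 : (2 : ℂ) * φ f = f (x + y) - ((f x - φ f) + (f y - φ f)) := by
          rw [map_add]; ring
        have h5 := congrArg norm h4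
        rw [norm_mul, Complex.norm_ofNat] at h5
        rw [h5]
        exact (norm_sub_le _ _).trans (add_le_add_right (norm_add_le _ _) _)
      linarith
  obtain ⟨x, hx⟩ := CompleteSpace.complete hcauchy
  refine ⟨x, ContinuousLinearMap.ext fun f => ?_⟩
  rw [NormedSpace.dual_def]
  exact tendsto_nhds_unique ((f.continuous.tendsto x).mono_left hx) (hF f)

end MilmanPettis

end TriebelLizorkin

/-! ### Uniform convexity in terms of powers -/

namespace TriebelLizorkin

section UniformRoundness

/-- Uniform convexity of a family of quadruples `(‖u‖, ‖v‖, ‖u + v‖, ‖u - v‖)`. -/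
def UniformlyRound {ι : Type*} (a b s e : ι → ℝ≥0∞) : Prop :=
  ∀ ε : ℝ≥0, 0 < ε → ∃ δ : ℝ≥0, 0 < δ ∧ ∀ (i : ι) (t : ℝ≥0), a i ≤ t → b i ≤ t → ε * t ≤ e i →
    s i + δ * t ≤ 2 * t

/-- Uniform convexity in terms of `p`-th powers; this form can be summed and integrated. -/
def PowerRound {ι : Type*} (p : ℝ) (a b s e : ι → ℝ≥0∞) : Prop :=
  ∀ ε : ℝ≥0, 0 < ε → ∃ K : ℝ≥0, ∀ i,
    e i ^ p + K * s i ^ p ≤ ((ε + 2 ^ (p - 1) * K : ℝ≥0) : ℝ≥0∞) * (a i ^ p + b i ^ p)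

/-- Compactness in b ∈ [0, 1]: the gap is continuous in b, and positive by strict convexity of the
power when b < 1, and by s ≤ 2 - δ when b = 1. -/
lemma exists_rpow_add_le_of_le_one {p δ : ℝ} (hp : 1 < p) (hδ : 0 < δ) :
    ∃ κ > 0, ∀ b ∈ Icc (0 : ℝ) 1, ∀ s, 0 ≤ s → s ≤ 2 - δ → s ≤ 1 + b →
      s ^ p + κ ≤ 2 ^ (p - 1) * (1 + b ^ p) := by
  have hp0 : 0 < p := by linarith
  have h2 : (2 : ℝ) ^ (p - 1) * 2 = 2 ^ p := by
    rw [Real.rpow_sub_one two_ne_zero, div_mul_cancel₀ _ two_ne_zero]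
  set r := max (2 - δ) 0 with hr
  have hr2 : r < 2 := max_lt (by linarith) two_pos
  have hr0 : 0 ≤ r := le_max_right _ _
  let h : ℝ → ℝ := fun b => 2 ^ (p - 1) * (1 + b ^ p) - min r (1 + b) ^ p
  have hcont : Continuous h := by
    have h1 := Real.continuous_rpow_const (q := p) hp0.le
    exact (continuous_const.mul (continuous_const.add h1)).sub
      (h1.comp (continuous_const.min (continuous_const.add continuous_id)))
  have hpos : ∀ b ∈ Icc (0 : ℝ) 1, 0 < h b := by
    rintro b ⟨hb0, hb1⟩
    refine sub_pos.2 ?_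
    rcases hb1.eq_or_lt with rfl | hb1
    · rw [Real.one_rpow, one_add_one_eq_two, h2, min_eq_left hr2.le]
      exact Real.rpow_lt_rpow hr0 hr2 hp0
    · have hc := (strictConvexOn_rpow hp).2 (mem_Ici.2 (zero_le_one (α := ℝ)))
        (mem_Ici.2 hb0) hb1.ne' one_half_pos one_half_pos (add_halves 1)
      simp only [smul_eq_mul, mul_one, Real.one_rpow] at hc
      rw [← mul_one_add, ← mul_one_add, Real.mul_rpow (by norm_num) (by linarith),
        Real.div_rpow zero_le_one zero_le_two, Real.one_rpow] at hc
      refine (Real.rpow_le_rpow (le_min hr0 (by linarith)) (min_le_right _ _) hp0.le).trans_lt ?_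
      have h3 : 0 < (2 : ℝ) ^ p := by positivity
      have h4 := mul_lt_mul_of_pos_left hc h3
      rw [← mul_assoc, mul_one_div_cancel h3.ne', one_mul] at h4
      calc (1 + b) ^ p < 2 ^ p * (1 / 2 * (1 + b ^ p)) := h4
        _ = 2 ^ (p - 1) * (1 + b ^ p) := by rw [← h2]; ring
  obtain ⟨b₀, hb₀, hmin⟩ := isCompact_Icc.exists_isMinOn (nonempty_Icc.2 zero_le_one)
    hcont.continuousOn
  refine ⟨h b₀, hpos b₀ hb₀, fun b hb s hs hsδ hsb => ?_⟩
  have h1 : s ^ p ≤ min r (1 + b) ^ p :=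
    Real.rpow_le_rpow hs (le_min (hsδ.trans (le_max_left _ _)) hsb) hp0.le
  have h3 : h b₀ ≤ h b := hmin hb
  have h4 : h b = 2 ^ (p - 1) * (1 + b ^ p) - min r (1 + b) ^ p := rfl
  linarith

/-- The homogeneous form, by dividing by the larger of a and b. -/
lemma exists_rpow_add_le {p δ : ℝ} (hp : 1 < p) (hδ : 0 < δ) :
    ∃ κ > 0, ∀ a b s : ℝ, 0 ≤ a → 0 ≤ b → 0 ≤ s → s ≤ (2 - δ) * max a b → s ≤ a + b →
      s ^ p + κ * max a b ^ p ≤ 2 ^ (p - 1) * (a ^ p + b ^ p) := by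
  have hp0 : 0 < p := by linarith
  obtain ⟨κ, hκ, h⟩ := exists_rpow_add_le_of_le_one hp hδ
  refine ⟨κ, hκ, fun a b s ha hb hs => ?_⟩
  wlog hab : b ≤ a generalizing a b
  · have := this b a hb ha (le_of_not_ge hab)
    rwa [max_comm, add_comm b, add_comm (b ^ p)] at this
  rw [max_eq_left hab]
  intro h1 h2
  rcases ha.eq_or_lt with rfl | ha
  · have hb0 : b = 0 := le_antisymm hab hb
    have hs0 : s = 0 := le_antisymm (by simpa using h1) hs
    simp [hb0, hs0, Real.zero_rpow hp0.ne']
  · have h3 := h (b / a) ⟨by positivity, (div_le_one ha).2 hab⟩ (s / a) (by positivity)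
      ((div_le_iff₀ ha).2 h1) (by rw [div_le_iff₀ ha]; field_simp; exact h2)
    rw [Real.div_rpow hs ha.le, Real.div_rpow hb ha.le] at h3
    have h4 : 0 < a ^ p := by positivity
    have h5 := mul_le_mul_of_nonneg_right h3 h4.le
    field_simp at h5
    linarith

variable {ι : Type*} {a b s e : ι → ℝ≥0∞}

/-- If e^p ≤ ε(a^p + b^p), convexity of the power suffices. Otherwise e is large compared with
max(a, b), and roundness gives a gain κ max(a, b)^p in the inequality for s. As e ≤ 2 max(a, b),
multiplying by K = 2^p/κ makes the gain absorb e^p. -/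
lemma UniformlyRound.powerRound {p : ℝ} (hp : 1 < p) (hs : ∀ i, s i ≤ a i + b i)
    (he : ∀ i, e i ≤ a i + b i) (h : UniformlyRound a b s e) : PowerRound p a b s e := by
  have hp0 : 0 < p := by linarith
  intro ε hε
  obtain ⟨δ, hδ, hδs⟩ := h (ε ^ (1 / p)) (NNReal.rpow_pos hε)
  obtain ⟨κ, hκ, hκs⟩ := exists_rpow_add_le hp (show (0 : ℝ) < δ from hδ)
  lift κ to ℝ≥0 using hκ.le
  refine ⟨2 ^ p / κ, fun i => ?_⟩
  set K : ℝ≥0 := 2 ^ p / κ with hK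
  have hsi := hs i
  have hei := he i
  have hδi := hδs i
  generalize a i = a at *
  generalize b i = b at *
  generalize s i = s at *
  generalize e i = e at *
  have hc : ((ε + 2 ^ (p - 1) * K : ℝ≥0) : ℝ≥0∞) ≠ 0 := by
    rw [ENNReal.coe_ne_zero]; positivity
  by_cases ha : a = ∞
  · rw [ha, ENNReal.top_rpow_of_pos hp0, top_add, ENNReal.mul_top hc]; exact le_top
  by_cases hb : b = ∞
  · rw [hb, ENNReal.top_rpow_of_pos hp0, add_top, ENNReal.mul_top hc]; exact le_top
  lift a to ℝ≥0 using ha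
  lift b to ℝ≥0 using hb
  lift s to ℝ≥0 using ne_top_of_le_ne_top (by simp) hsi
  lift e to ℝ≥0 using ne_top_of_le_ne_top (by simp) hei
  simp only [← ENNReal.coe_rpow_of_nonneg _ hp0.le]
  norm_cast at hsi hei hδi ⊢
  have hsum : s ^ p ≤ 2 ^ (p - 1) * (a ^ p + b ^ p) := by
    refine (NNReal.rpow_le_rpow hsi hp0.le).trans ?_
    exact NNReal.rpow_add_le_mul_rpow_add_rpow _ _ hp.le
  rcases le_or_gt (e ^ p) (ε * (a ^ p + b ^ p)) with h1 | h1
  · calc e ^ p + K * s ^ p ≤ ε * (a ^ p + b ^ p) + K * (2 ^ (p - 1) * (a ^ p + b ^ p)) := by gcongr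
      _ = _ := by ring
  · have h2 : ε ^ (1 / p) * max a b ≤ e := by
      rw [← NNReal.rpow_le_rpow_iff hp0, NNReal.mul_rpow, ← NNReal.rpow_mul,
        one_div_mul_cancel hp0.ne', NNReal.rpow_one]
      refine le_trans ?_ h1.le
      gcongr
      rcases le_total a b with hab | hab
      · rw [max_eq_right hab]; exact le_add_self
      · rw [max_eq_left hab]; exact le_self_add
    have h3 : s + δ * max a b ≤ 2 * max a b := hδi _ (le_max_left _ _) (le_max_right _ _) h2
    have h4 := hκs a b s a.coe_nonneg b.coe_nonneg s.coe_nonneg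
      (by have : (s : ℝ) + δ * max a b ≤ 2 * max a b := by exact_mod_cast h3
          linarith) (by exact_mod_cast hsi)
    have h5 : s ^ p + κ * max a b ^ p ≤ 2 ^ (p - 1) * (a ^ p + b ^ p) := by
      rw [← NNReal.coe_le_coe]
      push_cast
      exact h4
    have h6 : e ^ p ≤ K * (κ * max a b ^ p) := by
      have hκ0 : κ ≠ 0 := (NNReal.coe_pos.1 hκ).ne'
      rw [hK, ← mul_assoc, div_mul_cancel₀ _ hκ0, ← NNReal.mul_rpow]
      refine NNReal.rpow_le_rpow (hei.trans ?_) hp0.le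
      rw [two_mul]
      exact add_le_add (le_max_left _ _) (le_max_right _ _)
    calc e ^ p + K * s ^ p ≤ K * (κ * max a b ^ p) + K * s ^ p := by gcongr
      _ = K * (s ^ p + κ * max a b ^ p) := by ring
      _ ≤ K * (2 ^ (p - 1) * (a ^ p + b ^ p)) := by gcongr
      _ ≤ (ε + 2 ^ (p - 1) * K) * (a ^ p + b ^ p) := by
        rw [← mul_assoc, mul_comm K]
        gcongr
        exact le_add_self

/-- When e ≥ εt, the inequality with a small parameter forces s^p below 2^p t^p by a fixed fraction.
The condition does not mention p, so the two conversions together allow a change of exponent. -/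
lemma PowerRound.uniformlyRound {p : ℝ} (hp : 0 < p) (hs : ∀ i, s i ≤ a i + b i)
    (h : PowerRound p a b s e) : UniformlyRound a b s e := by
  intro ε hε
  have hε' : 0 < ε ^ p / 4 := div_pos (NNReal.rpow_pos hε) (by norm_num)
  obtain ⟨K, hK⟩ := h (ε ^ p / 4) hε'
  -- With parameter ε^p/4 one gets K s^p ≤ (2^p K - ε^p/2) t^p. Adding s^p ≤ 2^p t^p allows division
  -- by K + 1 even if K = 0, and leaves s^p ≤ (2^p - c) t^p.
  set c : ℝ := ε ^ p / (2 * (K + 1)) with hc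
  have hc0 : 0 < c := by
    have : (0 : ℝ) < (ε : ℝ) ^ p := Real.rpow_pos_of_pos hε p
    positivity
  have h2 : (2 : ℝ) ^ (p - 1) * 2 = 2 ^ p := by
    rw [Real.rpow_sub_one two_ne_zero, div_mul_cancel₀ _ two_ne_zero]
  set r : ℝ := max (2 ^ p - c) 0 ^ (1 / p) with hr
  have hr0 : 0 ≤ r := by positivity
  have hrp : r ^ p = max (2 ^ p - c) 0 := by
    rw [hr, ← Real.rpow_mul (le_max_right _ _), one_div_mul_cancel hp.ne', Real.rpow_one]
  have hr2 : r < 2 := by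
    rw [← Real.rpow_lt_rpow_iff hr0 zero_le_two hp, hrp]
    exact max_lt (by linarith) (by positivity)
  refine ⟨(2 - r).toNNReal, Real.toNNReal_pos.2 (sub_pos.2 hr2), fun i t ha hb he => ?_⟩
  have hKi := hK i
  have hsi : s i ≤ t + t := (hs i).trans (add_le_add ha hb)
  have h3 : (ε * t : ℝ≥0∞) ^ p + K * s i ^ p
      ≤ ((ε ^ p / 4 + 2 ^ (p - 1) * K : ℝ≥0) : ℝ≥0∞) * (t ^ p + t ^ p) := by
    refine le_trans ?_ (hKi.trans ?_)
    · gcongr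
    · gcongr
  generalize s i = s at *
  lift s to ℝ≥0 using ne_top_of_le_ne_top (by simp) hsi
  rw [← ENNReal.coe_mul] at h3
  simp only [← ENNReal.coe_rpow_of_nonneg _ hp.le] at h3
  norm_cast at h3 hsi ⊢
  rw [NNReal.mul_rpow] at h3
  have h4 : (ε : ℝ) ^ p * t ^ p + K * s ^ p
      ≤ (ε ^ p / 4 + 2 ^ (p - 1) * K) * (t ^ p + t ^ p) := by exact_mod_cast h3
  have h5 : (s : ℝ) ^ p ≤ 2 ^ p * t ^ p := by
    rw [← Real.mul_rpow zero_le_two t.coe_nonneg, two_mul]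
    exact Real.rpow_le_rpow s.coe_nonneg (by exact_mod_cast hsi) hp.le
  have htp : (0 : ℝ) ≤ (t : ℝ) ^ p := Real.rpow_nonneg t.coe_nonneg p
  have h6 : (s : ℝ) ^ p ≤ (2 ^ p - c) * t ^ p := by
    have hK0 : (0 : ℝ) < 2 * (K + 1) := by have := K.coe_nonneg; positivity
    have h7 : c * (2 * (K + 1)) = (ε : ℝ) ^ p := div_mul_cancel₀ _ hK0.ne'
    refine le_of_mul_le_mul_left ?_ hK0
    have h8 : 2 * ((K : ℝ) + 1) * ((2 ^ p - c) * t ^ p)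
        = 2 * (K + 1) * 2 ^ p * t ^ p - ε ^ p * t ^ p := by rw [← h7]; ring
    rw [h8, ← h2]
    rw [← h2] at h5
    linarith
  have h9 : (s : ℝ) ≤ r * t := by
    rw [← Real.rpow_le_rpow_iff s.coe_nonneg (mul_nonneg hr0 t.coe_nonneg) hp, Real.mul_rpow hr0 t.coe_nonneg, hrp]
    exact h6.trans (mul_le_mul_of_nonneg_right (le_max_left _ _) htp)
  rw [← NNReal.coe_le_coe]
  push_cast
  rw [Real.coe_toNNReal _ (sub_pos.2 hr2).le]
  linarith

end UniformRoundness

end TriebelLizorkin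

/-! ### Uniform convexity of the mixed norm and reflexivity -/

namespace TriebelLizorkin

/-- Minkowski's inequality. -/
lemma ellq_add_le_add {ι : Type*} {q : ℝ≥0∞} (hq : 1 ≤ q) (a b : ι → ℝ≥0∞) :
    ellq q (fun i => a i + b i) ≤ ellq q a + ellq q b := by
  unfold ellq
  split_ifs with h
  · exact iSup_le fun i => add_le_add (le_iSup a i) (le_iSup b i)
  · let : MeasurableSpace ι := ⊤
    have h1 : 1 ≤ q.toReal := by
      rw [← ENNReal.toReal_one]; exact ENNReal.toReal_mono h hq
    have := ENNReal.lintegral_Lp_add_le (μ := Measure.count) (f := a) (g := b)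
      (measurable_from_top.aemeasurable) (measurable_from_top.aemeasurable) h1
    simpa only [lintegral_count, Pi.add_apply] using this

lemma ellq_rpow {ι : Type*} {q : ℝ≥0∞} (hq : 0 < q) (hq' : q ≠ ∞) (a : ι → ℝ≥0∞) :
    ellq q a ^ q.toReal = ∑' i, a i ^ q.toReal := by
  rw [ellq, if_neg hq', ← ENNReal.rpow_mul,
    one_div_mul_cancel (ENNReal.toReal_pos hq.ne' hq').ne', ENNReal.rpow_one]

section PowerRound

variable {ι κ : Type*} {a b s e : ι → ℝ≥0∞}

/-- The inequality between q-th powers is linear in them, so it can be summed termwise. The index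
map lets the summation set vary, as the cones do with ξ. -/
lemma PowerRound.ellq_family {q : ℝ≥0∞} (hq : 0 < q) (hq' : q ≠ ∞) {J : κ → Type*}
    (φ : ∀ k, J k → ι) (h : PowerRound q.toReal a b s e) :
    PowerRound q.toReal (fun k => ellq q fun j => a (φ k j)) (fun k => ellq q fun j => b (φ k j))
      (fun k => ellq q fun j => s (φ k j)) fun k => ellq q fun j => e (φ k j) := by
  intro ε hε
  obtain ⟨K, hK⟩ := h ε hε
  refine ⟨K, fun k => ?_⟩
  simp only [ellq_rpow hq hq']
  rw [← ENNReal.tsum_mul_left, ← ENNReal.tsum_add, ← ENNReal.tsum_add, ← ENNReal.tsum_mul_left]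
  exact ENNReal.tsum_le_tsum fun j => hK _

lemma PowerRound.lintegral_family {p : ℝ} (hp : 0 < p) {Y : Type*} [MeasurableSpace Y]
    (ν : Measure Y) (φ : κ → Y → ι) (h : PowerRound p a b s e)
    (hae : ∀ k, Measurable fun y => a (φ k y)) (hem : ∀ k, Measurable fun y => e (φ k y)) :
    PowerRound p (fun k => (∫⁻ y, a (φ k y) ^ p ∂ν) ^ (1 / p))
      (fun k => (∫⁻ y, b (φ k y) ^ p ∂ν) ^ (1 / p)) (fun k => (∫⁻ y, s (φ k y) ^ p ∂ν) ^ (1 / p))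
      fun k => (∫⁻ y, e (φ k y) ^ p ∂ν) ^ (1 / p) := by
  intro ε hε
  obtain ⟨K, hK⟩ := h ε hε
  refine ⟨K, fun k => ?_⟩
  simp only [← ENNReal.rpow_mul, one_div_mul_cancel hp.ne', ENNReal.rpow_one]
  rw [← lintegral_const_mul' _ _ ENNReal.coe_ne_top, ← lintegral_add_left ((hem k).pow_const p),
    ← lintegral_add_left ((hae k).pow_const p), ← lintegral_const_mul' _ _ ENNReal.coe_ne_top]
  exact lintegral_mono fun y => hK _

end PowerRound

lemma enorm_add_sq_add_enorm_sub_sq (x y : ℂ) :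
    ‖x + y‖ₑ ^ (2 : ℝ) + ‖x - y‖ₑ ^ (2 : ℝ) = 2 * (‖x‖ₑ ^ (2 : ℝ) + ‖y‖ₑ ^ (2 : ℝ)) := by
  have h := parallelogram_law_with_nnnorm ℂ x y
  simp only [ENNReal.rpow_two, enorm_eq_nnnorm]
  exact_mod_cast h

variable {Z : Type*} [MetricSpace Z] {H : HyperbolicFilling Z}

lemma absD_add_le (u v : H.Vertex → ℂ) (x : H.Vertex) :
    absD (u + v) x ≤ absD u x + absD v x := by
  refine (ellq_mono 2 fun y => ?_).trans (ellq_add_le_add one_le_two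
    (fun y : {y // H.graph.Adj x y} => ‖u y - u x‖ₑ) fun y => ‖v y - v x‖ₑ)
  rw [Pi.add_apply, Pi.add_apply, add_sub_add_comm]
  exact enorm_add_le _ _

lemma absD_sub_le (u v : H.Vertex → ℂ) (x : H.Vertex) :
    absD (u - v) x ≤ absD u x + absD v x := by
  have h := absD_add_le u ((-1 : ℂ) • v) x
  rwa [absD_smul, enorm_neg, enorm_one, one_mul, neg_smul, one_smul, ← sub_eq_add_neg] at h

lemma absD_parallelogram (u v : H.Vertex → ℂ) (x : H.Vertex) :
    absD (u + v) x ^ (2 : ℝ) + absD (u - v) x ^ (2 : ℝ)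
      = 2 * (absD u x ^ (2 : ℝ) + absD v x ^ (2 : ℝ)) := by
  have h := fun w : H.Vertex → ℂ => ellq_rpow two_pos (by simp)
    fun y : {y // H.graph.Adj x y} => ‖w y - w x‖ₑ
  simp only [ENNReal.toReal_ofNat] at h
  simp only [absD, h]
  rw [← ENNReal.tsum_add, ← ENNReal.tsum_add, ← ENNReal.tsum_mul_left]
  refine tsum_congr fun y => ?_
  rw [← enorm_add_sq_add_enorm_sub_sq]
  simp only [Pi.add_apply, Pi.sub_apply, add_sub_add_comm, sub_sub_sub_comm]

/-- The discrete derivative with weights is uniformly round. -/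
lemma uniformlyRound_absD (w : H.Vertex → ℝ≥0∞) :
    UniformlyRound
      (fun i : ((H.Vertex → ℂ) × (H.Vertex → ℂ)) × H.Vertex => w i.2 * absD i.1.1 i.2)
      (fun i => w i.2 * absD i.1.2 i.2) (fun i => w i.2 * absD (i.1.1 + i.1.2) i.2)
      fun i => w i.2 * absD (i.1.1 - i.1.2) i.2 := by
  -- The parallelogram law is the power inequality with exponent 2 and K = 1 for every ε, since
  -- 2^{2-1} K = 2.
  refine PowerRound.uniformlyRound two_pos (fun i => ?_) fun ε hε => ⟨1, fun i => ?_⟩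
  · rw [← mul_add]
    exact mul_le_mul_right (absD_add_le _ _ _) _
  · simp only [ENNReal.mul_rpow_of_nonneg _ _ (zero_le_two (α := ℝ))]
    rw [ENNReal.coe_one, one_mul, ← mul_add, add_comm, absD_parallelogram, ← mul_add,
      mul_left_comm]
    refine mul_le_mul_left ?_ _
    norm_num

variable {s p : ℝ} {q : ℝ≥0∞}

/-- The integrand in the quasi-norm of the difference space. -/
noncomputable def coneNorm (s : ℝ) (q : ℝ≥0∞) (u : H.Vertex → ℂ) (ξ : Z) : ℝ≥0∞ :=
  ellq q fun x : H.cone ξ => ENNReal.ofReal ((2 : ℝ) ^ ((level x.1 : ℝ) * s)) * absD u x.1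

lemma coneNorm_add_le (hq : 1 ≤ q) (u v : H.Vertex → ℂ) (ξ : Z) :
    coneNorm s q (u + v) ξ ≤ coneNorm s q u ξ + coneNorm s q v ξ := by
  refine (ellq_mono q fun x => ?_).trans (ellq_add_le_add hq _ _)
  rw [← mul_add]
  exact mul_le_mul_right (absD_add_le _ _ _) _

lemma coneNorm_sub_le (hq : 1 ≤ q) (u v : H.Vertex → ℂ) (ξ : Z) :
    coneNorm s q (u - v) ξ ≤ coneNorm s q u ξ + coneNorm s q v ξ := by
  refine (ellq_mono q fun x => ?_).trans (ellq_add_le_add hq _ _)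
  rw [← mul_add]
  exact mul_le_mul_right (absD_sub_le _ _ _) _

/-- From the inner ℓ² norm to ℓ^q: convert to q-th powers, sum over the cone, convert back. Finite q
> 1 is needed for the powers. -/
lemma uniformlyRound_coneNorm (hq : 1 < q) (hq' : q < ∞) :
    UniformlyRound
      (fun k : ((H.Vertex → ℂ) × (H.Vertex → ℂ)) × Z => coneNorm s q k.1.1 k.2)
      (fun k => coneNorm s q k.1.2 k.2) (fun k => coneNorm s q (k.1.1 + k.1.2) k.2)
      fun k => coneNorm s q (k.1.1 - k.1.2) k.2 := by
  have hq1 : 1 < q.toReal := by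
    rw [← ENNReal.toReal_one]
    exact (ENNReal.toReal_lt_toReal ENNReal.one_ne_top hq'.ne).2 hq
  have h1 := (uniformlyRound_absD (H := H) fun x =>
    ENNReal.ofReal ((2 : ℝ) ^ ((level x : ℝ) * s))).powerRound hq1
    (fun i => by rw [← mul_add]; exact mul_le_mul_right (absD_add_le _ _ _) _)
    fun i => by rw [← mul_add]; exact mul_le_mul_right (absD_sub_le _ _ _) _
  exact (h1.ellq_family (one_pos.trans hq) hq'.ne
    (κ := ((H.Vertex → ℂ) × (H.Vertex → ℂ)) × Z) (J := fun k => H.cone k.2)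
    fun k x => (k.1, x.1)).uniformlyRound (one_pos.trans hq1) fun k =>
      coneNorm_add_le hq.le k.1.1 k.1.2 k.2

variable [MeasurableSpace Z] [BorelSpace Z] {μ : Measure Z}

lemma jNorm_add_le (hp : 1 ≤ p) (hq : 1 ≤ q) (f g : H.Vertex → ℝ≥0∞) :
    jNorm μ s p q (fun x => f x + g x) ≤ jNorm μ s p q f + jNorm μ s p q g := by
  have hq0 : 0 < q := one_pos.trans_le hq
  have hm := fun f : H.Vertex → ℝ≥0∞ => measurable_ellq_cone (H := H) hq0
    fun x => ENNReal.ofReal ((2 : ℝ) ^ ((level x : ℝ) * s)) * f x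
  unfold jNorm
  simp_rw [mul_add]
  refine le_trans ?_ (ENNReal.lintegral_Lp_add_le (hm f).aemeasurable (hm g).aemeasurable hp)
  gcongr with ξ
  exact ellq_add_le_add hq _ _

lemma jNorm_absD_add_le (hp : 1 ≤ p) (hq : 1 ≤ q) (u v : H.Vertex → ℂ) :
    jNorm μ s p q (absD (u + v)) ≤ jNorm μ s p q (absD u) + jNorm μ s p q (absD v) :=
  (jNorm_mono μ s (one_pos.trans_le hp) q (absD_add_le u v)).trans (jNorm_add_le hp hq _ _)

/-- The same passage with exponent p, integrating over Z in place of summing over the cone. -/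
lemma uniformlyRound_jNorm_absD (hp : 1 < p) (hq : 1 < q) (hq' : q < ∞) :
    UniformlyRound (fun i : (H.Vertex → ℂ) × (H.Vertex → ℂ) => jNorm μ s p q (absD i.1))
      (fun i => jNorm μ s p q (absD i.2)) (fun i => jNorm μ s p q (absD (i.1 + i.2)))
      fun i => jNorm μ s p q (absD (i.1 - i.2)) := by
  have hp0 : 0 < p := one_pos.trans hp
  have hm : ∀ u : H.Vertex → ℂ, Measurable fun ξ => coneNorm s q u ξ := fun u =>
    measurable_ellq_cone (H := H) (one_pos.trans hq)
      fun x => ENNReal.ofReal ((2 : ℝ) ^ ((level x : ℝ) * s)) * absD u x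
  have h := (uniformlyRound_coneNorm (H := H) (s := s) hq hq').powerRound hp
    (fun k => coneNorm_add_le hq.le _ _ _) fun k => coneNorm_sub_le hq.le _ _ _
  exact (h.lintegral_family hp0 μ (κ := (H.Vertex → ℂ) × (H.Vertex → ℂ)) (fun i ξ => (i, ξ))
    (fun k => hm k.1) fun k => hm (k.1 - k.2)).uniformlyRound hp0 fun i =>
      jNorm_absD_add_le hp.le hq.le i.1 i.2

section Reflexive

variable {V : Type*} [AddCommGroup V] [Module ℂ V]

/-- A complete uniformly convex norm turns the space into a reflexive Banach space. -/
lemma IsQuasiBanach.isReflexiveBanach {M : V → ℝ} (hM : IsQuasiBanach M)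
    (hadd : ∀ x y, M (x + y) ≤ M x + M y)
    (huc : ∀ ε > 0, ∃ δ > 0, ∀ x y, M x = 1 → M y = 1 → ε ≤ M (x - y) → M (x + y) ≤ 2 - δ) :
    IsReflexiveBanach M := by
  let : Norm V := ⟨M⟩
  have core : NormedSpace.Core ℂ V :=
    { norm_nonneg := hM.nonneg
      norm_smul := hM.smul
      norm_triangle := hadd
      norm_eq_zero_iff := hM.eq_zero_iff }
  let : NormedAddCommGroup V := NormedAddCommGroup.ofCore core
  let : NormedSpace ℂ V := NormedSpace.ofCore core
  have hcomplete : CompleteSpace V := by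
    refine Metric.complete_of_cauchySeq_tendsto fun v hv => ?_
    obtain ⟨w, hw⟩ := hM.complete v fun ε hε => by
      obtain ⟨n₀, h⟩ := Metric.cauchySeq_iff.1 hv ε hε
      refine ⟨n₀, fun m hm n hn => ?_⟩
      have := h m hm n hn
      rwa [dist_eq_norm] at this
    exact ⟨w, tendsto_iff_norm_sub_tendsto_zero.2 hw⟩
  have hconvex : UniformConvexSpace V := ⟨fun ε hε => by
    obtain ⟨δ, hδ, h⟩ := huc ε hε
    exact ⟨δ, hδ, fun x hx y hy hxy => h x y hx hy hxy⟩⟩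
  exact ⟨V, inferInstance, inferInstance, LinearEquiv.refl ℂ V, fun x => rfl, hcomplete,
    surjective_inclusionInDoubleDual⟩

end Reflexive

variable [BoundedSpace Z] [Nonempty Z] {Q : ℝ} {E : H.Vertex → Set Z} {C : ℝ≥0} {N : ℕ}

/-- `Ḟ^s_{p,q}(Z)` is reflexive for `1 < p, q < ∞`. -/
theorem FillingGeometry.isReflexiveBanach_aeConst (hG : FillingGeometry H μ Q E C N)
    (hE : AdmissibleExponents Q s p q) (Ψ : LipschitzPartition H) (hp : 1 < p) (hq : 1 < q)
    (hq' : q < ∞) :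
    IsReflexiveBanach (quotientNorm (H.aeConst μ s hE.p_pos hE.q_pos)
      (H.funNorm μ s hE.p_pos hE.q_pos)) := by
  have hadd : ∀ f g : H.funSpace μ s hE.p_pos hE.q_pos,
      H.poisson μ (f + g).1 = H.poisson μ f.1 + H.poisson μ g.1 := fun f g =>
    poisson_add f.2.1 g.2.1
  refine (hG.isQuasiBanach_aeConst hE Ψ).isReflexiveBanach (fun x y => ?_) fun ε hε => ?_
  · obtain ⟨f, rfl⟩ := Submodule.Quotient.mk_surjective _ x
    obtain ⟨g, rfl⟩ := Submodule.Quotient.mk_surjective _ y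
    rw [← Submodule.Quotient.mk_add]
    simp only [hG.quotientNorm_aeConst_mk, funNorm, hadd]
    rw [← ENNReal.toReal_add f.2.2.ne g.2.2.ne]
    exact ENNReal.toReal_mono (ENNReal.add_ne_top.2 ⟨f.2.2.ne, g.2.2.ne⟩)
      (jNorm_absD_add_le hp.le hq.le _ _)
  · obtain ⟨δ, hδ, h⟩ := uniformlyRound_jNorm_absD (H := H) (μ := μ) (s := s) hp hq hq'
      ε.toNNReal (Real.toNNReal_pos.2 hε)
    refine ⟨δ, hδ, fun x y => ?_⟩
    obtain ⟨f, rfl⟩ := Submodule.Quotient.mk_surjective _ x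
    obtain ⟨g, rfl⟩ := Submodule.Quotient.mk_surjective _ y
    rw [← Submodule.Quotient.mk_add, ← Submodule.Quotient.mk_sub]
    simp only [hG.quotientNorm_aeConst_mk, funNorm, hadd, poisson_sub]
    intro hf hg hfg
    -- Vectors of norm one: the scale t in the roundness condition is 1.
    specialize h (H.poisson μ f.1, H.poisson μ g.1) 1
    dsimp only at h
    have h1 := h
      (by rw [← ENNReal.ofReal_toReal f.2.2.ne, hf]; simp)
      (by rw [← ENNReal.ofReal_toReal g.2.2.ne, hg]; simp)
      (by rw [ENNReal.coe_one, mul_one]; exact ENNReal.ofReal_le_of_le_toReal hfg)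
    have h2 := ENNReal.toReal_mono (by simp) h1
    simp only [ENNReal.coe_one, mul_one] at h2
    rw [ENNReal.toReal_add (ne_top_of_le_ne_top (by simp) (le_self_add.trans h1)) (by simp)] at h2
    simp only [ENNReal.coe_toReal, ENNReal.toReal_ofNat] at h2
    linarith

end TriebelLizorkin

/-! ### The theorem -/

theorem theorem2p6 {Z : Type*} [MetricSpace Z] [BoundedSpace Z] [Nonempty Z]
    [MeasurableSpace Z] [BorelSpace Z] (μ : Measure Z)
    (hpos : ∀ (z : Z) (r : ℝ), 0 < r → 0 < μ (Metric.ball z r))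
    (hfin : ∀ (z : Z) (r : ℝ), 0 < r → μ (Metric.ball z r) < ∞)
    (Q : ℝ) (hQ : 0 < Q)
    (hdoubling : ∃ C : ℝ≥0, ∀ (z : Z) (r t : ℝ), 0 < r → 1 ≤ t →
      μ (Metric.ball z (t * r)) ≤ C * ENNReal.ofReal (t ^ Q) * μ (Metric.ball z r))
    (H : HyperbolicFilling Z) (Ψ : LipschitzPartition H)
    (s : ℝ) (hs : 0 < s)
    (p : ℝ) (hp : 0 < p) (hpQ : Q / (Q + s) < p)
    (q : ℝ≥0∞) (hq : 0 < q) (hqQ : ENNReal.ofReal (Q / (Q + s)) < q) :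
    -- traces exist on the difference space, and the trace is zero exactly on `seqSpaceZero`
    H.seqSpaceZero μ s hp hq ≤ H.diffSpace μ s hp hq ∧
    (∀ u ∈ H.diffSpace μ s hp hq, ∃ f : Z → ℂ, HasTrace μ Ψ u f ∧
      (f =ᵐ[μ] 0 ↔ u ∈ H.seqSpaceZero μ s hp hq)) ∧
    -- the trace induces an isomorphism onto the space of functions, constants not divided out
    (∃ e : (H.diffSpace μ s hp hq ⧸
          (H.seqSpaceZero μ s hp hq).comap (H.diffSpace μ s hp hq).subtype) ≃ₗ[ℂ]
        (H.funSpace μ s hp hq ⧸ H.aeZero μ s hp hq),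
      (∀ u : H.diffSpace μ s hp hq, ∃ f : H.funSpace μ s hp hq, HasTrace μ Ψ u.1 f.1 ∧
        e (Submodule.Quotient.mk u) = Submodule.Quotient.mk f) ∧
      IsQuasiNormIso (quotientNorm _ (H.diffNorm μ s hp hq))
        (quotientNorm _ (H.funNormMean μ s hp hq)) e) ∧
    -- the trace induces an isomorphism onto `Ḟ^s_{p,q}(Z)`, constants divided out
    (∃ e : (H.diffSpace μ s hp hq ⧸
          (H.seqSpaceConst μ s hp hq).comap (H.diffSpace μ s hp hq).subtype) ≃ₗ[ℂ]
        H.TL μ s hp hq,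
      (∀ u : H.diffSpace μ s hp hq, ∃ f : H.funSpace μ s hp hq, HasTrace μ Ψ u.1 f.1 ∧
        e (Submodule.Quotient.mk u) = Submodule.Quotient.mk f) ∧
      IsQuasiNormIso (quotientNorm _ (H.diffNorm μ s hp hq))
        (quotientNorm _ (H.funNorm μ s hp hq)) e) ∧
    -- completeness and reflexivity
    IsQuasiBanach (quotientNorm (H.aeConst μ s hp hq) (H.funNorm μ s hp hq)) ∧
    (1 < p → 1 < q → q < ∞ →
      IsReflexiveBanach (quotientNorm (H.aeConst μ s hp hq) (H.funNorm μ s hp hq))) := by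
  have hE : AdmissibleExponents Q s p q := ⟨hQ, hs, hp, hq, hpQ, hqQ⟩
  obtain ⟨C, hC⟩ := hdoubling
  obtain ⟨E, C', N, hG⟩ := exists_fillingGeometry (μ := μ) (Q := Q) (C := C)
    ⟨hpos, hfin, hQ, hC⟩ H
  refine ⟨hG.seqSpaceZero_le_diffSpace hE, fun u hu => ?_, hG.exists_traceEquiv_aeZero hE Ψ,
    hG.exists_traceEquiv_aeConst hE Ψ, hG.isQuasiBanach_aeConst hE Ψ,
    fun hp1 hq1 hq2 => hG.isReflexiveBanach_aeConst hE Ψ hp1 hq1 hq2⟩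
  obtain ⟨f, hf⟩ := hG.exists_trace_mem hE Ψ ⟨u, hu⟩
  refine ⟨f.1, hf, ?_⟩
  rw [hG.trace_eq_zero_iff hE hu.1 hf]
  exact ⟨fun h => ⟨h, hu.2⟩, fun h => h.1⟩
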